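/- Let $\mathbb U=\{z=x+iy\in\mathbb C: y>0\}$ be the upper half-plane. A locally integrable function $\varphi:\mathbb R\to\mathbb R$ is said to be in $H^{1/2}$ if $$\int_{\mathbb R}\int_{\mathbb R}\frac{|\varphi(u)-\varphi(v)|^2}{|u-v|^2}\,du\,dv<+\infty,$$ and a function $f:\mathbb R\to\mathbb R$ is said to be in $H^{3/2}$ if it is locally absolutely continuous and $f'\in H^{1/2}$. A function $F:\mathbb U\to\mathbb C$ is called a quasiconformal deformation of $\mathbb U$ if it has a generalized (distributional) derivative $\bar\partial F=\frac12(\partial_x+i\partial_y)F$ on $\mathbb U$ with $\bar\partial F\in L^\infty(\mathbb U)$. **Theorem 8.2.** Let $f:\mathbb R\to\mathbb R$ be continuous. Then $f\in H^{3/2}$ if and only if $f$ has an extension $\tilde f:\mathbb U\cup\mathbb R\to\mathbb C$ which is continuous on $\mathbb U\cup\mathbb R$, coincides with $f$ on $\mathbb R$, is a quasiconformal deformation of $\mathbb U$, and satisfies $\tilde f(z)=o(z^2)$ as $z\to\infty$ in $\mathbb U$ and $$\iint_{\mathbb U}|\bar\partial\tilde f(z)|^2\,y^{-2}\,dx\,dy<+\infty,\qquad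 z=x+iy.$$ -/

import Mathlib

open MeasureTheory Filter Topology Asymptotics
open scoped ContDiff

noncomputable section

namespace QCDef

/-- The open upper half plane, as a subset of the complex plane. -/
def U : Set ℂ := {z : ℂ | 0 < z.im}

/-- The closed upper half plane (without the point at infinity). -/
def closedU : Set ℂ := {z : ℂ | 0 ≤ z.im}

/-- The class `H^{1/2}` of real-valued functions on the real line: locally integrable functions
with finite double integral of `|φ(u) - φ(v)|² / |u - v|²`. The integral is an extended
nonnegative one, so that no integrability convention is involved. -/
def MemHHalf (φ : ℝ → ℝ) : Prop :=
  LocallyIntegrable φ volume ∧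
    ∫⁻ u : ℝ, ∫⁻ v : ℝ, ‖φ u - φ v‖ₑ ^ 2 / ‖u - v‖ₑ ^ 2 < (⊤ : ENNReal)

/-- The class `H^{3/2}` of real-valued functions on the real line: locally absolutely continuous
functions whose (almost everywhere existing) derivative is in `H^{1/2}`. -/
def MemHThreeHalves (f : ℝ → ℝ) : Prop :=
  (∀ a b : ℝ, AbsolutelyContinuousOnInterval f a b) ∧ MemHHalf (deriv f)

/-- The classical operator `∂/∂z̄ = (∂/∂x + i ∂/∂y) / 2`. -/
def dbar (φ : ℂ → ℂ) (z : ℂ) : ℂ :=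
  (1 / 2) * (fderiv ℝ φ z 1 + Complex.I * fderiv ℝ φ z Complex.I)

/-- `g` is the generalized (distributional) `∂/∂z̄`-derivative of `F` in the open set `Ω`. -/
def HasWeakDbar (Ω : Set ℂ) (F g : ℂ → ℂ) : Prop :=
  LocallyIntegrableOn F Ω volume ∧ LocallyIntegrableOn g Ω volume ∧
    ∀ φ : ℂ → ℂ, ContDiff ℝ ∞ φ → HasCompactSupport φ → tsupport φ ⊆ Ω →
      ∫ z in Ω, F z * dbar φ z = -∫ z in Ω, g z * φ z

/-- `F` is a quasiconformal deformation in `Ω`: it has a generalized `∂/∂z̄`-derivative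
which is essentially bounded in `Ω`. -/
def IsQuasiconformalDeformation (Ω : Set ℂ) (F : ℂ → ℂ) : Prop :=
  ∃ g : ℂ → ℂ, HasWeakDbar Ω F g ∧ MemLp g (⊤ : ENNReal) (volume.restrict Ω)

end QCDef

end

open Set
open scoped ENNReal NNReal

namespace QCDef

/-! ### A Schur test on the upper half plane -/

/-! Everything rests on comparing `f` with affine functions. If `f ∈ H^{3/2}`, take the
Beurling–Ahlfors type extension built from the averages of `f` on either side of `x` at scale `y`.
It sends `c + m t` to `c + m z`, so its `∂/∂z̄` at `x + iy` is at most a constant times (deviation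
of `f` from an affine function on `[x - y, x + y]`)/`y` (`norm_dbar_extension_le`). With the chord
slope, Cauchy–Schwarz bounds that deviation by the mean square oscillation of `f'` on the interval
(`sq_enorm_sub_affine_le`). A crude bound on the oscillation gives `L^∞`; Tonelli over the pairs
`(u, v)` below a point gives the weighted `L²` bound (`lintegral_oscEnergy_le`); finiteness of the
energy also forces `f(t) = O(|t|^{3/2})`, whence `o(z²)`. Conversely, let `g = ∂F/∂z̄`. Growth
`o(z²)` does not allow Green's formula with a single Cauchy kernel, but the combination `testKernel`
decays like `ζ⁻³`, and it represents the second difference `(q - p)(f b - f a) - (b - a)(f q - f p)`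
as a constant times the real part of the integral of `g` against it (`pi_mul_second_difference_eq`).
This difference is formally the integral of `f'(s) - f'(t)` over `[a, b] × [p, q]`, and `testKernel`
is the integral of `(ζ - s)⁻² - (ζ - t)⁻²` over the same rectangle. Hence the second difference is
dominated by the integral of `cauchyIncrement g` over the rectangle (`enorm_second_difference_le`).
A Schur test gives `cauchyIncrement g` finite Gagliardo energy
(`lintegral_sq_cauchyIncrement_lt_top`), and Lebesgue differentiation turns rectangle bounds into
absolute continuity of `f` and a pointwise bound for `|f'(s) - f'(t)|`
(`memHThreeHalves_of_increment_le`). -/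

lemma measurableSet_U : MeasurableSet U :=
  measurableSet_lt measurable_const Complex.measurable_im

/-- Cauchy–Schwarz for the lower Lebesgue integral. -/
lemma sq_lintegral_mul_le {α : Type*} [MeasurableSpace α] {μ : Measure α} {f g : α → ℝ≥0∞}
    (hf : AEMeasurable f μ) (hg : AEMeasurable g μ) :
    (∫⁻ a, f a * g a ∂μ) ^ 2 ≤ (∫⁻ a, f a ^ 2 ∂μ) * ∫⁻ a, g a ^ 2 ∂μ := by
  have h := ENNReal.lintegral_mul_le_Lp_mul_Lq μ Real.HolderConjugate.two_two hf hg
  simp only [Pi.mul_apply, ENNReal.rpow_two] at h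
  calc (∫⁻ a, f a * g a ∂μ) ^ 2
      ≤ ((∫⁻ a, f a ^ 2 ∂μ) ^ (1 / 2 : ℝ) * (∫⁻ a, g a ^ 2 ∂μ) ^ (1 / 2 : ℝ)) ^ 2 := by gcongr
    _ = _ := by
      rw [mul_pow, ← ENNReal.rpow_two, ← ENNReal.rpow_two, ← ENNReal.rpow_mul, ← ENNReal.rpow_mul]
      norm_num

lemma sq_setLIntegral_le {α : Type*} [MeasurableSpace α] {μ : Measure α} {f : α → ℝ≥0∞}
    (hf : AEMeasurable f μ) :
    (∫⁻ a, f a ∂μ) ^ 2 ≤ μ univ * ∫⁻ a, f a ^ 2 ∂μ := by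
  simpa [mul_comm] using sq_lintegral_mul_le hf (aemeasurable_const (b := (1 : ℝ≥0∞)))

lemma sq_add_le_two_mul (a b : ℝ≥0∞) : (a + b) ^ 2 ≤ 2 * (a ^ 2 + b ^ 2) := by
  have := ENNReal.rpow_add_le_mul_rpow_add_rpow a b (p := 2) (by norm_num)
  norm_num at this
  exact this

/-- Integration over the upper half plane in Cartesian coordinates. -/
lemma lintegral_U_eq {F : ℂ → ℝ≥0∞} (hF : Measurable F) :
    ∫⁻ z in U, F z = ∫⁻ y in Ioi (0 : ℝ), ∫⁻ x : ℝ, F (⟨x, y⟩ : ℂ) := by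
  have hm : Measurable (fun p : ℝ × ℝ => (⟨p.1, p.2⟩ : ℂ)) :=
    Complex.measurableEquivRealProd.symm.measurable
  have h := (Complex.volume_preserving_equiv_real_prod.symm).setLIntegral_comp_preimage_emb
    Complex.measurableEquivRealProd.symm.measurableEmbedding F U
  rw [← h]
  have hpre : Complex.measurableEquivRealProd.symm ⁻¹' U = univ ×ˢ Ioi (0 : ℝ) := by
    ext p; simp [U, Complex.measurableEquivRealProd]
  rw [hpre, Measure.volume_eq_prod, ← Measure.prod_restrict, lintegral_prod_symm]
  · simp only [Measure.restrict_univ]; rfl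
  · exact (hF.comp hm).aemeasurable

lemma lintegral_real_abs (h : ℝ → ℝ≥0∞) :
    ∫⁻ u : ℝ, h |u| = 2 * ∫⁻ u in Ioi (0 : ℝ), h u := by
  have h1 : ∫⁻ u in Iio (0 : ℝ), h |u| = ∫⁻ u in Ioi (0 : ℝ), h u := by
    have := (Measure.measurePreserving_neg (volume : Measure ℝ)).setLIntegral_comp_preimage_emb
      (MeasurableEquiv.neg ℝ).measurableEmbedding h (Ioi 0)
    rw [← this]
    have hs : Neg.neg ⁻¹' Ioi (0 : ℝ) = Iio 0 := by ext; simp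
    rw [hs]
    exact setLIntegral_congr_fun measurableSet_Iio fun x hx => by
      simp only [abs_of_neg (show x < 0 from hx)]
  have h2 : ∫⁻ u in Ioi (0 : ℝ), h |u| = ∫⁻ u in Ioi (0 : ℝ), h u :=
    setLIntegral_congr_fun measurableSet_Ioi fun x hx => by
      simp only [abs_of_pos (show 0 < x from hx)]
  rw [← lintegral_add_compl _ (measurableSet_Ioi (a := (0 : ℝ))), h2, compl_Ioi,
    setLIntegral_congr Iio_ae_eq_Iic.symm, h1, two_mul]

lemma measurable_mk_im (y : ℝ) : Measurable fun x : ℝ => (⟨x, y⟩ : ℂ) :=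
  Complex.measurableEquivRealProd.symm.measurable.comp (measurable_id.prodMk measurable_const)

lemma lintegral_poisson (s : ℝ) {y : ℝ} (hy : 0 < y) :
    ∫⁻ x : ℝ, (‖(⟨x, y⟩ : ℂ) - s‖ₑ ^ 2)⁻¹ = ENNReal.ofReal Real.pi * (ENNReal.ofReal y)⁻¹ := by
  lift y to ℝ≥0 using hy.le
  have h := ProbabilityTheory.lintegral_cauchyPDF_eq_one s (γ := y) (by exact_mod_cast hy.ne')
  have e : ∀ x : ℝ, (‖(⟨x, y⟩ : ℂ) - s‖ₑ ^ 2)⁻¹ =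
      ENNReal.ofReal (Real.pi * (y : ℝ)⁻¹) * ProbabilityTheory.cauchyPDF s y x := by
    intro x
    have hp : 0 < (x - s) ^ 2 + (y : ℝ) ^ 2 := by positivity
    rw [ProbabilityTheory.cauchyPDF_def, ProbabilityTheory.cauchyPDFReal_def,
      ← ENNReal.ofReal_mul (by positivity), ← ofReal_norm, ← ENNReal.ofReal_pow
      (norm_nonneg _), Complex.sq_norm, Complex.normSq_apply, ← ENNReal.ofReal_inv_of_pos]
    · congr 1
      simp only [Complex.sub_re, Complex.ofReal_re, Complex.sub_im, Complex.ofReal_im]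
      have : (0:ℝ) < Real.pi := Real.pi_pos
      have e1 : (x - s) * (x - s) + ((y : ℝ) - 0) * (y - 0) = (x - s) ^ 2 + (y : ℝ) ^ 2 := by ring
      rw [e1]
      field_simp
    · simp only [Complex.sub_re, Complex.ofReal_re, Complex.sub_im, Complex.ofReal_im]
      nlinarith
  simp_rw [e]
  rw [lintegral_const_mul _ (ProbabilityTheory.measurable_cauchyPDF _ _), h, mul_one,
    ENNReal.ofReal_mul Real.pi_pos.le, ENNReal.ofReal_inv_of_pos hy]

/-- Split at `x = c` and keep only the larger of `c` and `x` in the denominator; each piece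
contributes `2 c^{-1/2}`. -/
lemma lintegral_rpow_div_add_le {c : ℝ} (hc : 0 < c) :
    ∫⁻ x in Ioi (0 : ℝ), ENNReal.ofReal x ^ (-1 / 2 : ℝ) * (ENNReal.ofReal c + ENNReal.ofReal x)⁻¹
      ≤ 4 * ENNReal.ofReal c ^ (-1 / 2 : ℝ) := by
  have hsplit : Ioi (0 : ℝ) = Ioc 0 c ∪ Ioi c := (Ioc_union_Ioi_eq_Ioi hc.le).symm
  rw [hsplit, lintegral_union measurableSet_Ioi (by
    rw [Set.disjoint_left]; intro x hx hx'; exact absurd hx.2 (not_le.2 hx'))]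
  have hc' : ENNReal.ofReal c ^ (-1 / 2 : ℝ) = ENNReal.ofReal (c ^ (-1 / 2 : ℝ)) :=
    ENNReal.ofReal_rpow_of_pos hc
  have hcc : c ^ (1 / 2 : ℝ) * c⁻¹ = c ^ (-1 / 2 : ℝ) := by
    rw [← Real.rpow_neg_one c, ← Real.rpow_add hc]; norm_num
  have h1 : ∫⁻ x in Ioc (0 : ℝ) c, ENNReal.ofReal x ^ (-1 / 2 : ℝ) *
      (ENNReal.ofReal c + ENNReal.ofReal x)⁻¹ ≤ 2 * ENNReal.ofReal c ^ (-1 / 2 : ℝ) := by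
    calc _ ≤ ∫⁻ x in Ioc (0 : ℝ) c, ENNReal.ofReal (x ^ (-1 / 2 : ℝ) * c⁻¹) := by
          refine setLIntegral_mono' measurableSet_Ioc fun x hx => ?_
          rw [ENNReal.ofReal_mul (Real.rpow_nonneg hx.1.le _), ENNReal.ofReal_rpow_of_pos hx.1,
            ENNReal.ofReal_inv_of_pos hc]
          gcongr
          exact le_self_add
      _ = ENNReal.ofReal (∫ x in Ioc (0 : ℝ) c, x ^ (-1 / 2 : ℝ) * c⁻¹) := by
          rw [ofReal_integral_eq_lintegral_ofReal]
          · refine Integrable.mul_const ?_ _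
            have := (intervalIntegral.intervalIntegrable_rpow' (a := 0) (b := c)
              (r := -1 / 2) (by norm_num))
            rwa [intervalIntegrable_iff_integrableOn_Ioc_of_le hc.le] at this
          · refine (ae_restrict_iff' measurableSet_Ioc).2 (Eventually.of_forall fun x hx => ?_)
            exact mul_nonneg (Real.rpow_nonneg hx.1.le _) (by positivity)
      _ ≤ _ := by
          rw [← intervalIntegral.integral_of_le hc.le, intervalIntegral.integral_mul_const,
            integral_rpow (Or.inl (by norm_num)), hc', ← hcc,
            show (2 : ℝ≥0∞) = ENNReal.ofReal 2 by norm_num, ← ENNReal.ofReal_mul (by norm_num)]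
          apply ENNReal.ofReal_le_ofReal
          rw [Real.zero_rpow (by norm_num)]
          norm_num
          exact le_of_eq (by ring)
  have h2 : ∫⁻ x in Ioi c, ENNReal.ofReal x ^ (-1 / 2 : ℝ) *
      (ENNReal.ofReal c + ENNReal.ofReal x)⁻¹ ≤ 2 * ENNReal.ofReal c ^ (-1 / 2 : ℝ) := by
    calc _ ≤ ∫⁻ x in Ioi c, ENNReal.ofReal (x ^ (-3 / 2 : ℝ)) := by
          refine setLIntegral_mono' measurableSet_Ioi fun x hx => ?_
          have hx0 : 0 < x := hc.trans hx
          have : x ^ (-3 / 2 : ℝ) = x ^ (-1 / 2 : ℝ) * x⁻¹ := by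
            rw [← Real.rpow_neg_one x, ← Real.rpow_add hx0]; norm_num
          rw [this, ENNReal.ofReal_mul (Real.rpow_nonneg hx0.le _),
            ENNReal.ofReal_rpow_of_pos hx0, ENNReal.ofReal_inv_of_pos hx0]
          gcongr
          exact le_add_self
      _ = ENNReal.ofReal (∫ x in Ioi c, x ^ (-3 / 2 : ℝ)) := by
          rw [ofReal_integral_eq_lintegral_ofReal]
          · exact integrableOn_Ioi_rpow_of_lt (by norm_num) hc
          · refine (ae_restrict_iff' measurableSet_Ioi).2 (Eventually.of_forall fun x hx => ?_)
            exact Real.rpow_nonneg (hc.trans hx).le _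
      _ ≤ _ := by
          rw [integral_Ioi_rpow_of_lt (by norm_num) hc, hc',
            show (2 : ℝ≥0∞) = ENNReal.ofReal 2 by norm_num, ← ENNReal.ofReal_mul (by norm_num)]
          apply ENNReal.ofReal_le_ofReal
          norm_num
          exact le_of_eq (by ring)
  calc _ ≤ _ := add_le_add h1 h2
    _ = _ := by rw [← add_mul]; norm_num

/-- The kernel `1 / ((r + Im ζ) |ζ - s|²)`. -/
noncomputable def schurKernel (r : ℝ) (s : ℝ) (ζ : ℂ) : ℝ≥0∞ :=
  (ENNReal.ofReal r + ENNReal.ofReal ζ.im)⁻¹ * (‖ζ - s‖ₑ ^ 2)⁻¹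

lemma measurable_schurKernel :
    Measurable fun p : (ℝ × ℝ) × ℂ => schurKernel |p.1.1 - p.1.2| p.1.1 p.2 := by
  unfold schurKernel
  fun_prop

/-- First half of the Schur test, with weight `y^{1/2}`. The horizontal integral is a Poisson
integral equal to `π / y`, which leaves `y^{-1/2} / (r + y)` to integrate. -/
lemma lintegral_schurKernel_le {r : ℝ} (hr : 0 < r) (s : ℝ) :
    ∫⁻ ζ in U, ENNReal.ofReal ζ.im ^ (1 / 2 : ℝ) * schurKernel r s ζ ≤
      4 * ENNReal.ofReal Real.pi * ENNReal.ofReal r ^ (-1 / 2 : ℝ) := by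
  rw [lintegral_U_eq (by unfold schurKernel; fun_prop)]
  calc _ = ∫⁻ y in Ioi (0 : ℝ), ENNReal.ofReal Real.pi * (ENNReal.ofReal y ^ (-1 / 2 : ℝ) *
        (ENNReal.ofReal r + ENNReal.ofReal y)⁻¹) := by
        refine setLIntegral_congr_fun measurableSet_Ioi fun y hy => ?_
        have hy : 0 < y := hy
        simp only [schurKernel, ← mul_assoc]
        have hm : Measurable fun x : ℝ => (‖(⟨x, y⟩ : ℂ) - s‖ₑ ^ 2)⁻¹ :=
          ((measurable_mk_im y).sub_const _).enorm.pow_const 2 |>.inv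
        rw [lintegral_const_mul _ hm, lintegral_poisson s hy]
        have : ENNReal.ofReal y ^ (-1 / 2 : ℝ) =
            ENNReal.ofReal y ^ (1 / 2 : ℝ) * (ENNReal.ofReal y)⁻¹ := by
          rw [← ENNReal.rpow_neg_one, ← ENNReal.rpow_add _ _ (by simpa using hy) (by simp)]
          norm_num
        rw [this]; ring
    _ ≤ _ := by
        rw [lintegral_const_mul _ (by fun_prop)]
        calc _ ≤ ENNReal.ofReal Real.pi * (4 * ENNReal.ofReal r ^ (-1 / 2 : ℝ)) := by
              gcongr; exact lintegral_rpow_div_add_le hr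
          _ = _ := by ring

/-- Cauchy–Schwarz with the kernel split evenly and the weight `y^{∓1/4}` shared between the
factors, so that the factor without `g` squares to the integral of `lintegral_schurKernel_le`. -/
lemma sq_lintegral_schurKernel_le {g : ℂ → ℂ} (hg : Measurable g) {r : ℝ} (hr : 0 < r) (s : ℝ) :
    (∫⁻ ζ in U, ‖g ζ‖ₑ * schurKernel r s ζ) ^ 2 ≤
      4 * ENNReal.ofReal Real.pi * (ENNReal.ofReal r ^ (-1 / 2 : ℝ) *
      ∫⁻ ζ in U, ‖g ζ‖ₑ ^ 2 * ENNReal.ofReal ζ.im ^ (-1 / 2 : ℝ) * schurKernel r s ζ) := by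
  have hK : Measurable (schurKernel r s) := by unfold schurKernel; fun_prop
  have e : ∫⁻ ζ in U, ‖g ζ‖ₑ * schurKernel r s ζ = ∫⁻ ζ in U,
      (‖g ζ‖ₑ * ENNReal.ofReal ζ.im ^ (-1 / 4 : ℝ) * schurKernel r s ζ ^ (1 / 2 : ℝ)) *
      (ENNReal.ofReal ζ.im ^ (1 / 4 : ℝ) * schurKernel r s ζ ^ (1 / 2 : ℝ)) := by
    refine setLIntegral_congr_fun measurableSet_U fun ζ hζ => ?_
    have hζ : 0 < ζ.im := hζ
    have h1 : ENNReal.ofReal ζ.im ^ (-1 / 4 : ℝ) * ENNReal.ofReal ζ.im ^ (1 / 4 : ℝ) = 1 := by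
      rw [← ENNReal.rpow_add _ _ (by simpa using hζ) (by simp)]; norm_num
    have h2 : schurKernel r s ζ ^ (1 / 2 : ℝ) * schurKernel r s ζ ^ (1 / 2 : ℝ)
        = schurKernel r s ζ := by
      rw [← ENNReal.rpow_add_of_nonneg _ _ (by norm_num) (by norm_num)]; norm_num
    conv_lhs => rw [← h2, ← mul_one ‖g ζ‖ₑ, ← h1]
    ring
  rw [e]
  refine (sq_lintegral_mul_le (by fun_prop) (by fun_prop)).trans ?_
  have hs : ∀ x : ℝ≥0∞, (x ^ (1 / 2 : ℝ)) ^ 2 = x := fun x => by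
    rw [← ENNReal.rpow_two, ← ENNReal.rpow_mul]; norm_num
  have hs' : ∀ x : ℝ≥0∞, (x ^ (1 / 4 : ℝ)) ^ 2 = x ^ (1 / 2 : ℝ) := fun x => by
    rw [← ENNReal.rpow_two, ← ENNReal.rpow_mul]; norm_num
  have hs'' : ∀ x : ℝ≥0∞, (x ^ (-1 / 4 : ℝ)) ^ 2 = x ^ (-1 / 2 : ℝ) := fun x => by
    rw [← ENNReal.rpow_two, ← ENNReal.rpow_mul]; norm_num
  simp only [mul_pow, hs, hs', hs'']
  calc _ ≤ _ := mul_le_mul_right (lintegral_schurKernel_le hr s) _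
    _ = _ := by ring

/-- Second half of the Schur test. The weight `|s - t|^{-1/2}` is what the first half produces, and
the resulting `y^{-3/2}` joins the remaining `y^{-1/2}` to form the `y^{-2}` of the energy. -/
lemma lintegral_weight_schurKernel_le {ζ : ℂ} (hζ : ζ ∈ U) :
    ∫⁻ s : ℝ, ∫⁻ t : ℝ, ENNReal.ofReal |s - t| ^ (-1 / 2 : ℝ) * schurKernel |s - t| s ζ ≤
      8 * ENNReal.ofReal Real.pi * ENNReal.ofReal ζ.im ^ (-3 / 2 : ℝ) := by
  have hζ : 0 < ζ.im := hζ
  have h1 : ∀ s : ℝ, ∫⁻ t : ℝ, ENNReal.ofReal |s - t| ^ (-1 / 2 : ℝ) * schurKernel |s - t| s ζ ≤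
      8 * ENNReal.ofReal ζ.im ^ (-1 / 2 : ℝ) * (‖ζ - s‖ₑ ^ 2)⁻¹ := by
    intro s
    simp only [schurKernel, ← mul_assoc]
    rw [lintegral_mul_const _ (by fun_prop)]
    gcongr
    rw [lintegral_sub_left_eq_self (fun u => ENNReal.ofReal |u| ^ (-1 / 2 : ℝ) *
      (ENNReal.ofReal |u| + ENNReal.ofReal ζ.im)⁻¹) s,
      lintegral_real_abs (fun u => ENNReal.ofReal u ^ (-1 / 2 : ℝ) *
      (ENNReal.ofReal u + ENNReal.ofReal ζ.im)⁻¹)]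
    calc _ ≤ 2 * (4 * ENNReal.ofReal ζ.im ^ (-1 / 2 : ℝ)) := by
          gcongr
          simp_rw [add_comm (ENNReal.ofReal _) (ENNReal.ofReal ζ.im)]
          exact lintegral_rpow_div_add_le hζ
      _ = _ := by rw [← mul_assoc]; norm_num
  have h2 : ∫⁻ s : ℝ, (‖ζ - s‖ₑ ^ 2)⁻¹ = ENNReal.ofReal Real.pi * (ENNReal.ofReal ζ.im)⁻¹ := by
    rw [← lintegral_poisson ζ.re hζ]
    refine lintegral_congr fun s => ?_
    congr 2
    rw [← ofReal_norm, ← ofReal_norm]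
    congr 1
    rw [← sq_eq_sq₀ (norm_nonneg _) (norm_nonneg _), Complex.sq_norm, Complex.sq_norm,
      Complex.normSq_apply, Complex.normSq_apply]
    simp; ring
  have h3 : ENNReal.ofReal ζ.im ^ (-3 / 2 : ℝ) =
      ENNReal.ofReal ζ.im ^ (-1 / 2 : ℝ) * (ENNReal.ofReal ζ.im)⁻¹ := by
    rw [← ENNReal.rpow_neg_one, ← ENNReal.rpow_add _ _ (by simpa using hζ) (by simp)]
    norm_num
  calc _ ≤ ∫⁻ s : ℝ, 8 * ENNReal.ofReal ζ.im ^ (-1 / 2 : ℝ) * (‖ζ - s‖ₑ ^ 2)⁻¹ :=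
        lintegral_mono h1
    _ = _ := by
        rw [lintegral_const_mul _ (by fun_prop), h2, h3]; ring

/-- The modulus of the increment of `s ↦ ∫ g(ζ) (ζ - s)⁻² dA(ζ)`, with absolute values inside. -/
noncomputable def cauchyIncrement (g : ℂ → ℂ) (s t : ℝ) : ℝ≥0∞ :=
  ∫⁻ ζ in U, ‖g ζ‖ₑ * ‖((ζ - s) ^ 2)⁻¹ - ((ζ - t) ^ 2)⁻¹‖ₑ

lemma measurable_cauchyIncrement {g : ℂ → ℂ} (hg : Measurable g) :
    Measurable fun p : ℝ × ℝ => cauchyIncrement g p.1 p.2 := by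
  unfold cauchyIncrement
  refine Measurable.lintegral_prod_right' (f := fun q : (ℝ × ℝ) × ℂ =>
    ‖g q.2‖ₑ * ‖((q.2 - q.1.1) ^ 2)⁻¹ - ((q.2 - q.1.2) ^ 2)⁻¹‖ₑ) ?_
  fun_prop

/-- With `A = |ζ - s|`, `B = |ζ - t|`, `r = |s - t|`, the difference has modulus at most `r (A + B)
/ (A² B²)`. Since `r ≤ A + B` and `Im ζ ≤ min(A, B)`, one has `(A + B)(r + Im ζ) ≤ 3 (A² + B²)`,
which separates the two poles. -/
lemma norm_inv_sq_sub_inv_sq_le {ζ : ℂ} (hζ : ζ ∈ U) (s t : ℝ) :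
    ‖((ζ - s) ^ 2)⁻¹ - ((ζ - t) ^ 2)⁻¹‖ ≤
      3 * |s - t| * ((|s - t| + ζ.im)⁻¹ * ((‖ζ - s‖ ^ 2)⁻¹ + (‖ζ - t‖ ^ 2)⁻¹)) := by
  have hζ : 0 < ζ.im := hζ
  have him : ∀ x : ℝ, ζ.im ≤ ‖ζ - x‖ := fun x => by
    have := Complex.im_le_norm (ζ - x); simpa using this
  have hA : 0 < ‖ζ - s‖ := hζ.trans_le (him s)
  have hB : 0 < ‖ζ - t‖ := hζ.trans_le (him t)
  have hA0 : ζ - s ≠ 0 := norm_pos_iff.1 hA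
  have hB0 : ζ - t ≠ 0 := norm_pos_iff.1 hB
  have e : ((ζ - s) ^ 2)⁻¹ - ((ζ - t) ^ 2)⁻¹ =
      ((s - t : ℝ) : ℂ) * ((ζ - s) + (ζ - t)) / ((ζ - s) ^ 2 * (ζ - t) ^ 2) := by
    field_simp; push_cast; ring
  have hr : |s - t| ≤ ‖ζ - s‖ + ‖ζ - t‖ := by
    have : ((s - t : ℝ) : ℂ) = (ζ - t) - (ζ - s) := by push_cast; ring
    rw [← Real.norm_eq_abs, ← Complex.norm_real, this, add_comm]
    exact norm_sub_le _ _
  rw [e, norm_div, norm_mul, norm_mul, norm_pow, norm_pow, Complex.norm_real, Real.norm_eq_abs]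
  set A := ‖ζ - s‖
  set B := ‖ζ - t‖
  set r := |s - t|
  have hr0 : 0 ≤ r := abs_nonneg _
  have hsum : ‖(ζ - s) + (ζ - t)‖ ≤ A + B := norm_add_le _ _
  have key : (A + B) * (r + ζ.im) ≤ 3 * (A ^ 2 + B ^ 2) := by
    nlinarith [him s, him t, sq_nonneg (A - B)]
  calc r * ‖(ζ - s) + (ζ - t)‖ / (A ^ 2 * B ^ 2) ≤ r * (A + B) / (A ^ 2 * B ^ 2) := by gcongr
    _ ≤ r * (3 * (A ^ 2 + B ^ 2) / (r + ζ.im)) / (A ^ 2 * B ^ 2) := by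
        gcongr
        rw [le_div_iff₀ (by positivity)]
        exact key
    _ = _ := by field_simp; ring

lemma cauchyIncrement_le {g : ℂ → ℂ} (hg : Measurable g) (s t : ℝ) :
    cauchyIncrement g s t ≤ 3 * ‖s - t‖ₑ * ((∫⁻ ζ in U, ‖g ζ‖ₑ * schurKernel |s - t| s ζ) +
      ∫⁻ ζ in U, ‖g ζ‖ₑ * schurKernel |t - s| t ζ) := by
  have hm1 : Measurable (schurKernel |s - t| s) := by unfold schurKernel; fun_prop
  have hm2 : Measurable (schurKernel |t - s| t) := by unfold schurKernel; fun_prop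
  rw [← lintegral_add_left (by fun_prop), ← lintegral_const_mul _ (by fun_prop)]
  refine setLIntegral_mono' measurableSet_U fun ζ hζ => ?_
  have hζ0 : 0 < ζ.im := hζ
  have him : ∀ x : ℝ, 0 < ‖ζ - x‖ := fun x => by
    have := Complex.im_le_norm (ζ - x); simp at this; linarith
  have h := ENNReal.ofReal_le_ofReal (norm_inv_sq_sub_inv_sq_le hζ s t)
  have hs := him s
  have ht := him t
  rw [ofReal_norm, ENNReal.ofReal_mul (by positivity), ENNReal.ofReal_mul (by norm_num),
    ENNReal.ofReal_mul (by positivity), ENNReal.ofReal_add (by positivity) (by positivity),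
    ENNReal.ofReal_inv_of_pos (by positivity), ENNReal.ofReal_inv_of_pos (by positivity),
    ENNReal.ofReal_inv_of_pos (by positivity), ENNReal.ofReal_add (by positivity) hζ0.le,
    ENNReal.ofReal_pow (norm_nonneg _), ENNReal.ofReal_pow (norm_nonneg _), ofReal_norm,
    ofReal_norm, ENNReal.ofReal_ofNat, ← Real.norm_eq_abs, ofReal_norm] at h
  calc _ ≤ _ := mul_le_mul_right h _
    _ = _ := by
      simp only [schurKernel, abs_sub_comm t s]
      rw [← Real.norm_eq_abs, ofReal_norm]; ring

/-- One of the two halves of the bound `cauchyIncrement_le`: only the pole at `s` is kept, so it is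
not symmetric in `s` and `t`. -/
noncomputable def schurPotential (g : ℂ → ℂ) (s t : ℝ) : ℝ≥0∞ :=
  ∫⁻ ζ in U, ‖g ζ‖ₑ * schurKernel |s - t| s ζ

lemma measurable_schurPotential {g : ℂ → ℂ} (hg : Measurable g) :
    Measurable fun p : ℝ × ℝ => schurPotential g p.1 p.2 := by
  have hm := measurable_schurKernel
  exact Measurable.lintegral_prod_right' (f := fun q : (ℝ × ℝ) × ℂ =>
      ‖g q.2‖ₑ * schurKernel |q.1.1 - q.1.2| q.1.1 q.2) (by fun_prop)

/-- Apply the first half of the Schur test for fixed `(s, t)`, move the `ζ`-integral outside by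
Tonelli, then apply the second half; the constants are `4π · 8π`. -/
lemma lintegral_sq_schurPotential_le {g : ℂ → ℂ} (hg : Measurable g) :
    ∫⁻ s : ℝ, ∫⁻ t : ℝ, schurPotential g s t ^ 2 ≤
      32 * ENNReal.ofReal Real.pi ^ 2 * ∫⁻ ζ in U, ‖g ζ‖ₑ ^ 2 / ENNReal.ofReal (ζ.im ^ 2) := by
  have hm := measurable_schurKernel
  have hG : Measurable fun p : (ℝ × ℝ) × ℂ => ENNReal.ofReal |p.1.1 - p.1.2| ^ (-1 / 2 : ℝ) *
      (‖g p.2‖ₑ ^ 2 * ENNReal.ofReal p.2.im ^ (-1 / 2 : ℝ) *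
        schurKernel |p.1.1 - p.1.2| p.1.1 p.2) := by fun_prop
  have hms : ∀ s t, Measurable (schurKernel |s - t| s) := fun s t => by
    unfold schurKernel; fun_prop
  calc _ ≤ ∫⁻ s : ℝ, ∫⁻ t : ℝ, 4 * ENNReal.ofReal Real.pi *
        ∫⁻ ζ in U, ENNReal.ofReal |s - t| ^ (-1 / 2 : ℝ) *
          (‖g ζ‖ₑ ^ 2 * ENNReal.ofReal ζ.im ^ (-1 / 2 : ℝ) * schurKernel |s - t| s ζ) := by
        refine lintegral_mono fun s => lintegral_mono_ae ?_
        -- The kernel estimate needs `r = |s - t| > 0`, so the diagonal is discarded as a null set.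
        have : ∀ᵐ t : ℝ, t ≠ s := by simp [ae_iff]
        filter_upwards [this] with t ht
        rw [lintegral_const_mul _ (by fun_prop)]
        exact sq_lintegral_schurKernel_le hg (abs_pos.2 (sub_ne_zero.2 ht.symm)) s
    _ = 4 * ENNReal.ofReal Real.pi * ∫⁻ ζ in U, ∫⁻ s : ℝ, ∫⁻ t : ℝ,
          ENNReal.ofReal |s - t| ^ (-1 / 2 : ℝ) *
          (‖g ζ‖ₑ ^ 2 * ENNReal.ofReal ζ.im ^ (-1 / 2 : ℝ) * schurKernel |s - t| s ζ) := by
        have hI : Measurable fun p : ℝ × ℝ => ∫⁻ ζ in U, ENNReal.ofReal |p.1 - p.2| ^ (-1 / 2 : ℝ) *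
          (‖g ζ‖ₑ ^ 2 * ENNReal.ofReal ζ.im ^ (-1 / 2 : ℝ) * schurKernel |p.1 - p.2| p.1 ζ) :=
          Measurable.lintegral_prod_right' hG
        have h1 : ∀ s : ℝ, ∫⁻ t : ℝ, 4 * ENNReal.ofReal Real.pi *
            ∫⁻ ζ in U, ENNReal.ofReal |s - t| ^ (-1 / 2 : ℝ) *
            (‖g ζ‖ₑ ^ 2 * ENNReal.ofReal ζ.im ^ (-1 / 2 : ℝ) * schurKernel |s - t| s ζ) =
            4 * ENNReal.ofReal Real.pi * ∫⁻ ζ in U, ∫⁻ t : ℝ,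
            ENNReal.ofReal |s - t| ^ (-1 / 2 : ℝ) *
            (‖g ζ‖ₑ ^ 2 * ENNReal.ofReal ζ.im ^ (-1 / 2 : ℝ) * schurKernel |s - t| s ζ) := by
          intro s
          have hIs : Measurable fun t : ℝ => ∫⁻ ζ in U, ENNReal.ofReal |s - t| ^ (-1 / 2 : ℝ) *
              (‖g ζ‖ₑ ^ 2 * ENNReal.ofReal ζ.im ^ (-1 / 2 : ℝ) * schurKernel |s - t| s ζ) :=
            Measurable.comp (f := fun t : ℝ => (s, t)) hI (by fun_prop)
          rw [lintegral_const_mul _ hIs, lintegral_lintegral_swap]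
          have : Measurable fun q : ℝ × ℂ => ENNReal.ofReal |s - q.1| ^ (-1 / 2 : ℝ) *
              (‖g q.2‖ₑ ^ 2 * ENNReal.ofReal q.2.im ^ (-1 / 2 : ℝ) * schurKernel |s - q.1| s q.2) :=
            Measurable.comp (f := fun q : ℝ × ℂ => ((s, q.1), q.2)) hG (by fun_prop)
          exact this.aemeasurable
        simp_rw [h1]
        have hJ : Measurable fun p : ℝ × ℂ => ∫⁻ t : ℝ, ENNReal.ofReal |p.1 - t| ^ (-1 / 2 : ℝ) *
            (‖g p.2‖ₑ ^ 2 * ENNReal.ofReal p.2.im ^ (-1 / 2 : ℝ) *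
              schurKernel |p.1 - t| p.1 p.2) :=
          Measurable.lintegral_prod_right' (f := fun q : (ℝ × ℂ) × ℝ =>
            ENNReal.ofReal |q.1.1 - q.2| ^ (-1 / 2 : ℝ) *
            (‖g q.1.2‖ₑ ^ 2 * ENNReal.ofReal q.1.2.im ^ (-1 / 2 : ℝ) *
              schurKernel |q.1.1 - q.2| q.1.1 q.1.2))
            (Measurable.comp (f := fun q : (ℝ × ℂ) × ℝ => ((q.1.1, q.2), q.1.2)) hG (by fun_prop))
        rw [lintegral_const_mul _ (Measurable.lintegral_prod_right' hJ),
          lintegral_lintegral_swap hJ.aemeasurable]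
    _ ≤ 4 * ENNReal.ofReal Real.pi * ∫⁻ ζ in U, 8 * ENNReal.ofReal Real.pi *
          (‖g ζ‖ₑ ^ 2 / ENNReal.ofReal (ζ.im ^ 2)) := by
        gcongr 4 * ENNReal.ofReal Real.pi * ?_
        refine setLIntegral_mono' measurableSet_U fun ζ hζ => ?_
        have hζ0 : 0 < ζ.im := hζ
        have hm2 : Measurable fun p : ℝ × ℝ => ENNReal.ofReal |p.1 - p.2| ^ (-1 / 2 : ℝ) *
            schurKernel |p.1 - p.2| p.1 ζ :=
          Measurable.mul (by fun_prop) (Measurable.comp (f := fun q : ℝ × ℝ => (q, ζ)) hm (by fun_prop))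
        calc _ = ‖g ζ‖ₑ ^ 2 * ENNReal.ofReal ζ.im ^ (-1 / 2 : ℝ) * ∫⁻ s : ℝ, ∫⁻ t : ℝ,
              ENNReal.ofReal |s - t| ^ (-1 / 2 : ℝ) * schurKernel |s - t| s ζ := by
              rw [← lintegral_const_mul _ (Measurable.lintegral_prod_right' hm2)]
              refine lintegral_congr fun s => ?_
              have hm3 : Measurable fun t : ℝ => ENNReal.ofReal |s - t| ^ (-1 / 2 : ℝ) *
                  schurKernel |s - t| s ζ :=
                Measurable.comp (f := fun t : ℝ => (s, t)) hm2 (by fun_prop)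
              dsimp only
              rw [← lintegral_const_mul _ hm3]
              refine lintegral_congr fun t => ?_
              ring
          _ ≤ ‖g ζ‖ₑ ^ 2 * ENNReal.ofReal ζ.im ^ (-1 / 2 : ℝ) *
              (8 * ENNReal.ofReal Real.pi * ENNReal.ofReal ζ.im ^ (-3 / 2 : ℝ)) := by
              gcongr; exact lintegral_weight_schurKernel_le hζ
          _ = _ := by
              have : (ENNReal.ofReal (ζ.im ^ 2))⁻¹ = ENNReal.ofReal ζ.im ^ (-1 / 2 : ℝ) *
                  ENNReal.ofReal ζ.im ^ (-3 / 2 : ℝ) := by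
                rw [← ENNReal.rpow_add _ _ (by simpa using hζ0) (by simp),
                  ENNReal.ofReal_pow hζ0.le, ← ENNReal.rpow_two, ← ENNReal.rpow_neg]
                norm_num
              rw [ENNReal.div_eq_inv_mul, this]; ring
    _ = _ := by
        rw [lintegral_const_mul' _ _ (by finiteness)]; ring

lemma sq_cauchyIncrement_le {g : ℂ → ℂ} (hg : Measurable g) (s t : ℝ) :
    cauchyIncrement g s t ^ 2 / ‖s - t‖ₑ ^ 2 ≤
      18 * (schurPotential g s t ^ 2 + schurPotential g t s ^ 2) := by
  refine ENNReal.div_le_of_le_mul ?_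
  calc _ ≤ (3 * ‖s - t‖ₑ * (schurPotential g s t + schurPotential g t s)) ^ 2 := by
        gcongr; exact cauchyIncrement_le hg s t
    _ = 9 * (schurPotential g s t + schurPotential g t s) ^ 2 * ‖s - t‖ₑ ^ 2 := by ring
    _ ≤ 9 * (2 * (schurPotential g s t ^ 2 + schurPotential g t s ^ 2)) * ‖s - t‖ₑ ^ 2 := by
        gcongr; exact sq_add_le_two_mul _ _
    _ = _ := by ring

/-- The increments of the Beurling-type transform of `g` have finite Gagliardo energy. -/
theorem lintegral_sq_cauchyIncrement_lt_top {g : ℂ → ℂ} (hg : Measurable g)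
    (hfin : ∫⁻ z in U, ‖g z‖ₑ ^ 2 / ENNReal.ofReal (z.im ^ 2) < ⊤) :
    ∫⁻ s : ℝ, ∫⁻ t : ℝ, cauchyIncrement g s t ^ 2 / ‖s - t‖ₑ ^ 2 < ⊤ := by
  have hA := measurable_schurPotential hg
  have hA' : Measurable fun p : ℝ × ℝ => schurPotential g p.2 p.1 := by fun_prop
  have hfinA : ∫⁻ s : ℝ, ∫⁻ t : ℝ, schurPotential g s t ^ 2 < ⊤ :=
    (lintegral_sq_schurPotential_le hg).trans_lt (by finiteness)
  have hsw : ∫⁻ s : ℝ, ∫⁻ t : ℝ, schurPotential g t s ^ 2 =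
      ∫⁻ s : ℝ, ∫⁻ t : ℝ, schurPotential g s t ^ 2 :=
    lintegral_lintegral_swap (hA'.pow_const 2).aemeasurable
  have h1 : ∀ s : ℝ, ∫⁻ t : ℝ, 18 * (schurPotential g s t ^ 2 + schurPotential g t s ^ 2) =
      18 * ((∫⁻ t : ℝ, schurPotential g s t ^ 2) + ∫⁻ t : ℝ, schurPotential g t s ^ 2) := by
    intro s
    have m1 : Measurable fun t => schurPotential g s t := by fun_prop
    have m2 : Measurable fun t => schurPotential g t s := by fun_prop
    rw [lintegral_const_mul _ (by fun_prop), lintegral_add_left (by fun_prop)]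
  have m1 : Measurable fun s => ∫⁻ t : ℝ, schurPotential g s t ^ 2 :=
    Measurable.lintegral_prod_right' (hA.pow_const 2)
  have m2 : Measurable fun s => ∫⁻ t : ℝ, schurPotential g t s ^ 2 :=
    Measurable.lintegral_prod_right' (hA'.pow_const 2)
  refine (lintegral_mono fun s => lintegral_mono fun t => sq_cauchyIncrement_le hg s t).trans_lt ?_
  simp_rw [h1]
  rw [lintegral_const_mul _ (by fun_prop), lintegral_add_left m1, hsw]
  finiteness

/-! ### From increment bounds to membership in `H^{3/2}` -/

lemma AbsolutelyContinuousOnInterval.of_dist_le {f G : ℝ → ℝ} {a b : ℝ}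
    (hG : AbsolutelyContinuousOnInterval G a b)
    (h : ∀ x ∈ uIcc a b, ∀ y ∈ uIcc a b, dist (f x) (f y) ≤ dist (G x) (G y)) :
    AbsolutelyContinuousOnInterval f a b := by
  rw [absolutelyContinuousOnInterval_iff] at hG ⊢
  intro ε hε
  obtain ⟨δ, hδ, H⟩ := hG ε hε
  refine ⟨δ, hδ, fun E hE hlt => (Finset.sum_le_sum fun i hi => ?_).trans_lt (H E hE hlt)⟩
  exact h _ (hE.1 i hi).1 _ (hE.1 i hi).2

lemma locallyIntegrable_of_intervalIntegrable {φ : ℝ → ℝ}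
    (h : ∀ a b : ℝ, IntervalIntegrable φ volume a b) : LocallyIntegrable φ volume := by
  rw [locallyIntegrable_iff]
  intro K hK
  obtain ⟨R, hR⟩ := hK.isBounded.subset_closedBall 0
  rw [Real.closedBall_eq_Icc] at hR
  rcases le_total (0 - R) (0 + R) with h0 | h0
  · exact ((intervalIntegrable_iff_integrableOn_Icc_of_le h0).1 (h _ _)).mono_set hR
  · exact ((intervalIntegrable_iff_integrableOn_Icc_of_le h0).1 (h _ _)).mono_set
      (hR.trans fun x hx => ⟨by linarith [hx.1, hx.2], by linarith [hx.1, hx.2]⟩)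

lemma enorm_le_iff_norm_le_toReal {x : ℝ} {c : ℝ≥0∞} (hc : c ≠ ⊤) :
    ‖x‖ₑ ≤ c ↔ ‖x‖ ≤ c.toReal := by
  rw [← toReal_enorm, ENNReal.toReal_le_toReal enorm_ne_top hc]

/-- Turns finite Gagliardo energy into local integrability: on a bounded set `T ≤ 1 + L² T² / d²`,
where `d ≤ L` is the distance of the two coordinates. -/
lemma le_one_add_mul_sq_div {L d x : ℝ≥0∞} (hd : d ≤ L) (hL : L ≠ 0) (hdt : d ≠ ⊤) :
    x ≤ 1 + L ^ 2 * (x ^ 2 / d ^ 2) := by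
  have h1 : x ≤ 1 + x ^ 2 := by
    rcases le_total x 1 with h | h
    · exact h.trans le_self_add
    · calc x = x * 1 := (mul_one x).symm
        _ ≤ x * x := by gcongr
        _ ≤ _ := by rw [sq]; exact le_add_self
  refine h1.trans ?_
  gcongr
  rcases eq_or_ne x 0 with rfl | hx
  · simp
  rcases eq_or_ne d 0 with rfl | hd0
  -- On the diagonal, division by zero of a nonzero quantity gives `⊤`, so the bound is trivial
  -- there.
  · have : x ^ 2 / 0 ^ 2 = ⊤ := by
      rw [zero_pow two_ne_zero]; exact ENNReal.div_zero (pow_ne_zero _ hx)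
    rw [this, ENNReal.mul_top (pow_ne_zero _ hL)]; exact le_top
  calc x ^ 2 = d ^ 2 * (x ^ 2 / d ^ 2) :=
        (ENNReal.mul_div_cancel (pow_ne_zero _ hd0) (ENNReal.pow_ne_top hdt)).symm
    _ ≤ _ := by gcongr

section Increment

variable {f : ℝ → ℝ} {T : ℝ × ℝ → ℝ≥0∞}

lemma lintegral_isBounded_lt_top
    (hfin : ∫⁻ p : ℝ × ℝ, T p ^ 2 / ‖p.1 - p.2‖ₑ ^ 2 < ⊤) {K : Set (ℝ × ℝ)}
    (hK : Bornology.IsBounded K) : ∫⁻ p in K, T p < ⊤ := by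
  obtain ⟨R, hR0, hR⟩ := hK.subset_closedBall_lt 0 0
  refine (lintegral_mono_set hR).trans_lt ?_
  have hL : ∀ p ∈ Metric.closedBall (0 : ℝ × ℝ) R, ‖p.1 - p.2‖ₑ ≤ ENNReal.ofReal (R + R) := by
    intro p hp
    rw [← ofReal_norm]
    apply ENNReal.ofReal_le_ofReal
    rw [mem_closedBall_zero_iff, Prod.norm_def] at hp
    exact (norm_sub_le _ _).trans (add_le_add ((le_max_left _ _).trans hp)
      ((le_max_right _ _).trans hp))
  calc _ ≤ ∫⁻ p in Metric.closedBall (0 : ℝ × ℝ) R,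
        (1 + ENNReal.ofReal (R + R) ^ 2 * (T p ^ 2 / ‖p.1 - p.2‖ₑ ^ 2)) :=
        setLIntegral_mono' Metric.isClosed_closedBall.measurableSet fun p hp =>
          le_one_add_mul_sq_div (hL p hp) (by simpa using hR0) enorm_ne_top
    _ = volume (Metric.closedBall (0 : ℝ × ℝ) R) + ENNReal.ofReal (R + R) ^ 2 *
        ∫⁻ p in Metric.closedBall (0 : ℝ × ℝ) R, (T p ^ 2 / ‖p.1 - p.2‖ₑ ^ 2) := by
        rw [lintegral_add_left measurable_const, lintegral_const_mul' _ _ (by finiteness)]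
        simp
    _ < ⊤ := by
        refine ENNReal.add_lt_top.2 ⟨measure_closedBall_lt_top, ENNReal.mul_lt_top (by finiteness) ?_⟩
        exact (setLIntegral_le_lintegral _ _).trans_lt hfin

/-- Freeze the second interval at `[0, 1]`: the hypothesis then bounds `|f y - f x|` by the integral
over `[x, y]` of the locally integrable `w(s) = |f 1 - f 0| + ∫₀¹ T(s, t) dt`, so `f` inherits
absolute continuity from a primitive of `w`. -/
lemma absolutelyContinuousOnInterval_of_increment_le (hT : Measurable T)
    (hloc : ∀ K : Set (ℝ × ℝ), Bornology.IsBounded K → ∫⁻ p in K, T p < ⊤)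
    (h : ∀ a b p q : ℝ, a ≤ b → p ≤ q → ‖(q - p) * (f b - f a) - (b - a) * (f q - f p)‖ₑ ≤
      ∫⁻ x in Icc a b ×ˢ Icc p q, T x) (a b : ℝ) :
    AbsolutelyContinuousOnInterval f a b := by
  set S : ℝ → ℝ≥0∞ := fun s => ∫⁻ t in Icc (0 : ℝ) 1, T (s, t) with hS
  have hSm : Measurable S := hT.lintegral_prod_right'
  have hSeq : ∀ x y : ℝ, ∫⁻ p in Icc x y ×ˢ Icc (0 : ℝ) 1, T p = ∫⁻ s in Icc x y, S s := by
    intro x y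
    rw [Measure.volume_eq_prod, ← Measure.prod_restrict, lintegral_prod _ hT.aemeasurable]
  have hSfin : ∀ x y : ℝ, ∫⁻ s in Icc x y, S s < ⊤ := fun x y => by
    rw [← hSeq]
    exact hloc _ ((Metric.isBounded_Icc _ _).prod (Metric.isBounded_Icc _ _))
  set w : ℝ → ℝ := fun s => |f 1 - f 0| + (S s).toReal with hw
  have hSint : ∀ x y : ℝ, IntegrableOn (fun s => (S s).toReal) (Icc x y) := fun x y =>
    integrable_toReal_of_lintegral_ne_top hSm.aemeasurable (hSfin x y).ne
  have hwint : ∀ x y : ℝ, IntervalIntegrable w volume x y := by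
    intro x y
    have : IntervalIntegrable (fun s => (S s).toReal) volume x y := by
      rw [intervalIntegrable_iff]
      exact (hSint (min x y) (max x y)).mono_set Ioc_subset_Icc_self
    exact (intervalIntegrable_const).add this
  have key : ∀ x y : ℝ, x ≤ y → |f y - f x| ≤ ∫ s in x..y, w s := by
    intro x y hxy
    have h1 := h x y 0 1 hxy zero_le_one
    rw [hSeq, enorm_le_iff_norm_le_toReal (hSfin x y).ne] at h1
    have h2 : (∫⁻ s in Icc x y, S s).toReal = ∫ s in x..y, (S s).toReal := by
      rw [intervalIntegral.integral_of_le hxy, ← integral_Icc_eq_integral_Ioc,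
        integral_toReal hSm.aemeasurable (ae_lt_top hSm (hSfin x y).ne)]
    have h3 : ∫ s in x..y, w s = (y - x) * |f 1 - f 0| + ∫ s in x..y, (S s).toReal := by
      rw [hw, intervalIntegral.integral_add intervalIntegrable_const]
      · simp
      · rw [intervalIntegrable_iff_integrableOn_Icc_of_le hxy]; exact hSint x y
    rw [h3, ← h2]
    rw [Real.norm_eq_abs] at h1
    have h4 : |f y - f x| ≤ |(1 - 0) * (f y - f x) - (y - x) * (f 1 - f 0)| +
        |(y - x) * (f 1 - f 0)| := by
      have := abs_add_le ((1 - 0) * (f y - f x) - (y - x) * (f 1 - f 0)) ((y - x) * (f 1 - f 0))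
      calc _ = _ := by congr 1; ring
        _ ≤ _ := this
    rw [abs_mul (y - x), abs_of_nonneg (sub_nonneg.2 hxy)] at h4
    linarith
  refine AbsolutelyContinuousOnInterval.of_dist_le
    ((hwint a b).absolutelyContinuousOnInterval_intervalIntegral (c := a) left_mem_uIcc)
    fun x _ y _ => ?_
  rw [Real.dist_eq, Real.dist_eq, intervalIntegral.integral_interval_sub_left (hwint _ _)
    (hwint _ _)]
  rcases le_total x y with hxy | hxy
  · rw [intervalIntegral.integral_symm, abs_neg, abs_sub_comm]
    exact (key x y hxy).trans (le_abs_self _)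
  · exact (key y x hxy).trans (le_abs_self _)

lemma tendsto_symmetric_slope {f' s : ℝ} (hf : HasDerivAt f f' s) {δ : ℕ → ℝ}
    (hδ : Tendsto δ atTop (𝓝[>] 0)) :
    Tendsto (fun n => (f (s + δ n) - f (s - δ n)) / (2 * δ n)) atTop (𝓝 f') := by
  have hpos : ∀ᶠ n in atTop, 0 < δ n := (tendsto_nhdsWithin_iff.1 hδ).2
  have h0 : Tendsto δ atTop (𝓝[≠] 0) :=
    hδ.mono_right (nhdsWithin_mono _ fun x hx => ne_of_gt hx)
  have h0' : Tendsto (fun n => -δ n) atTop (𝓝[≠] 0) := by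
    refine tendsto_nhdsWithin_iff.2 ⟨by simpa using (tendsto_nhdsWithin_iff.1 h0).1.neg, ?_⟩
    filter_upwards [hpos] with n hn
    simpa using hn.ne'
  have h1 := hf.tendsto_slope_zero.comp h0
  have h2 := hf.tendsto_slope_zero.comp h0'
  have h3 := (h1.add h2).div_const 2
  rw [add_self_div_two] at h3
  refine h3.congr' ?_
  filter_upwards [hpos] with n hn
  simp only [Function.comp_apply, smul_eq_mul, ← sub_eq_add_neg]
  field_simp
  ring

/-- Lebesgue differentiation in the plane: closed balls of the sup metric on `ℝ × ℝ` are squares, so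
the hypothesis on shrinking squares, divided by the area `4 δ²`, compares a difference of symmetric
slopes of `f` with an average of `T`. -/
lemma ae_abs_deriv_sub_le (hT : Measurable T)
    (hloc : ∀ K : Set (ℝ × ℝ), Bornology.IsBounded K → ∫⁻ p in K, T p < ⊤)
    (h : ∀ a b p q : ℝ, a ≤ b → p ≤ q → ‖(q - p) * (f b - f a) - (b - a) * (f q - f p)‖ₑ ≤
      ∫⁻ x in Icc a b ×ˢ Icc p q, T x) (hd : ∀ᵐ x : ℝ, DifferentiableAt ℝ f x) :
    ∀ᵐ p : ℝ × ℝ, ‖deriv f p.1 - deriv f p.2‖ₑ ≤ T p := by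
  have hint : ∀ K : Set (ℝ × ℝ), Bornology.IsBounded K →
      IntegrableOn (fun p => (T p).toReal) K := fun K hK =>
    integrable_toReal_of_lintegral_ne_top hT.aemeasurable (hloc K hK).ne
  have hLI : LocallyIntegrable (fun p => (T p).toReal) (volume : Measure (ℝ × ℝ)) := by
    rw [locallyIntegrable_iff]
    exact fun K hK => hint K hK.isBounded
  have hA := IsUnifLocDoublingMeasure.ae_tendsto_average (μ := (volume : Measure (ℝ × ℝ))) hLI 1
  have h1 : ∀ᵐ p : ℝ × ℝ, DifferentiableAt ℝ f p.1 :=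
    Measure.quasiMeasurePreserving_fst.ae hd
  have h2 : ∀ᵐ p : ℝ × ℝ, DifferentiableAt ℝ f p.2 :=
    Measure.quasiMeasurePreserving_snd.ae hd
  filter_upwards [hA, h1, h2] with p hp hp1 hp2
  rcases eq_or_ne (T p) ⊤ with htop | htop
  · rw [htop]; exact le_top
  rw [enorm_le_iff_norm_le_toReal htop]
  set δ : ℕ → ℝ := fun n => 1 / ((n : ℝ) + 1) with hδdef
  have hδpos : ∀ n, 0 < δ n := fun n => by positivity
  have hδ : Tendsto δ atTop (𝓝[>] 0) :=
    tendsto_nhdsWithin_iff.2 ⟨tendsto_one_div_add_atTop_nhds_zero_nat,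
      Eventually.of_forall hδpos⟩
  have hlim := hp (fun _ => p) δ hδ (Eventually.of_forall fun n => by
    simpa using (hδpos n).le)
  have hslope := ((tendsto_symmetric_slope hp1.hasDerivAt hδ).sub
    (tendsto_symmetric_slope hp2.hasDerivAt hδ)).norm
  refine le_of_tendsto_of_tendsto hslope hlim (Eventually.of_forall fun n => ?_)
  have hn := hδpos n
  have hball : Metric.closedBall p (δ n) =
      Icc (p.1 - δ n) (p.1 + δ n) ×ˢ Icc (p.2 - δ n) (p.2 + δ n) := by
    rw [← closedBall_prod_same, Real.closedBall_eq_Icc, Real.closedBall_eq_Icc]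
  have hvol : volume.real (Metric.closedBall p (δ n)) = 4 * δ n ^ 2 := by
    rw [hball, Measure.volume_eq_prod, measureReal_prod_prod, Real.volume_real_Icc,
      Real.volume_real_Icc, max_eq_left (by linarith), max_eq_left (by linarith)]
    ring
  have hb := h (p.1 - δ n) (p.1 + δ n) (p.2 - δ n) (p.2 + δ n) (by linarith) (by linarith)
  rw [← hball, enorm_le_iff_norm_le_toReal (hloc _ Metric.isBounded_closedBall).ne,
    ← integral_toReal hT.aemeasurable (ae_lt_top hT (hloc _ Metric.isBounded_closedBall).ne)] at hb
  dsimp only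
  rw [setAverage_eq, hvol, smul_eq_mul, ← div_eq_inv_mul, le_div_iff₀ (by positivity)]
  refine le_trans (le_of_eq ?_) hb
  rw [← abs_of_pos (show 0 < 4 * δ n ^ 2 by positivity), ← Real.norm_eq_abs, ← norm_mul]
  congr 1
  field_simp
  ring

theorem memHThreeHalves_of_increment_le (hT : Measurable T)
    (hfin : ∫⁻ p : ℝ × ℝ, T p ^ 2 / ‖p.1 - p.2‖ₑ ^ 2 < ⊤)
    (h : ∀ a b p q : ℝ, a ≤ b → p ≤ q → ‖(q - p) * (f b - f a) - (b - a) * (f q - f p)‖ₑ ≤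
      ∫⁻ x in Icc a b ×ˢ Icc p q, T x) : MemHThreeHalves f := by
  have hloc : ∀ K : Set (ℝ × ℝ), Bornology.IsBounded K → ∫⁻ p in K, T p < ⊤ :=
    fun K hK => lintegral_isBounded_lt_top hfin hK
  have hAC := absolutelyContinuousOnInterval_of_increment_le hT hloc h
  have hd : ∀ᵐ x : ℝ, DifferentiableAt ℝ f x := by
    have : ∀ᵐ x : ℝ, ∀ n : ℕ, x ∈ uIcc (-(n : ℝ)) n → DifferentiableAt ℝ f x :=
      ae_all_iff.2 fun n => (hAC (-(n : ℝ)) n).ae_differentiableAt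
    filter_upwards [this] with x hx
    obtain ⟨n, hn⟩ := exists_nat_ge |x|
    exact hx n (by rw [uIcc_of_le (by linarith [abs_nonneg x])]; exact abs_le.1 hn)
  refine ⟨hAC, locallyIntegrable_of_intervalIntegrable fun a b =>
    (hAC a b).intervalIntegrable_deriv, ?_⟩
  have hm : Measurable (deriv f) := measurable_deriv f
  have hmeas : Measurable fun p : ℝ × ℝ =>
      ‖deriv f p.1 - deriv f p.2‖ₑ ^ 2 / ‖p.1 - p.2‖ₑ ^ 2 := by fun_prop
  rw [← lintegral_prod _ hmeas.aemeasurable]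
  refine (lintegral_mono_ae ?_).trans_lt hfin
  filter_upwards [ae_abs_deriv_sub_le hT hloc h hd] with p hp
  gcongr

end Increment

/-! ### Green's formula up to the boundary -/

lemma dbar_mul {u v : ℂ → ℂ} {z : ℂ} (hu : DifferentiableAt ℝ u z) (hv : DifferentiableAt ℝ v z) :
    dbar (fun w => u w * v w) z = dbar u z * v z + u z * dbar v z := by
  unfold dbar
  rw [fderiv_fun_mul hu hv]
  simp only [add_apply, smul_apply, smul_eq_mul]
  ring

lemma dbar_eq_zero {u : ℂ → ℂ} {z : ℂ} (hu : DifferentiableAt ℂ u z) : dbar u z = 0 := by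
  unfold dbar
  rw [hu.fderiv_restrictScalars ℝ]
  have h : fderiv ℂ u z Complex.I = Complex.I * fderiv ℂ u z 1 := by
    conv_lhs => rw [← mul_one Complex.I, ← smul_eq_mul, map_smul, smul_eq_mul]
  simp only [ContinuousLinearMap.coe_restrictScalars', h, ← mul_assoc, Complex.I_mul_I]
  ring

lemma dbar_ofReal_comp_im {s : ℝ → ℝ} {s' : ℝ} {z : ℂ} (hs : HasDerivAt s s' z.im) :
    dbar (fun w : ℂ => (s w.im : ℂ)) z = Complex.I / 2 * s' := by
  have h1 : HasFDerivAt (fun w : ℂ => s w.im) _ z :=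
    hs.hasFDerivAt.comp z Complex.imCLM.hasFDerivAt
  have h : HasFDerivAt (fun w : ℂ => (s w.im : ℂ)) _ z :=
    Complex.ofRealCLM.hasFDerivAt.comp z h1
  unfold dbar
  rw [h.fderiv]
  simp
  ring

lemma continuousAt_dbar {φ : ℂ → ℂ} {z : ℂ} (h : ContDiffAt ℝ ∞ φ z) :
    ContinuousAt (dbar φ) z := by
  have h1 : ContinuousAt (fderiv ℝ φ) z :=
    (h.fderiv_right (m := 0) (by norm_num)).continuousAt
  unfold dbar
  exact continuousAt_const.mul ((h1.clm_apply continuousAt_const).add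
    (continuousAt_const.mul (h1.clm_apply continuousAt_const)))

lemma dbar_eq_zero_of_vanishing {φ : ℂ → ℂ} {R : ℝ} (h : ∀ z, R < ‖z‖ → φ z = 0) {z : ℂ}
    (hz : R < ‖z‖) : dbar φ z = 0 := by
  have : φ =ᶠ[𝓝 z] fun _ => 0 := by
    filter_upwards [(isOpen_lt continuous_const continuous_norm).mem_nhds hz] with w hw
    exact h w hw
  unfold dbar
  rw [this.fderiv_eq]
  simp

lemma U_subset_closedU : U ⊆ closedU := fun z (hz : 0 < z.im) => hz.le

lemma isClosed_closedU : IsClosed closedU := isClosed_le continuous_const Complex.continuous_im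

lemma integrableOn_of_continuousOn_of_vanishing {H : ℂ → ℂ} (hH : ContinuousOn H closedU) {R : ℝ}
    (h : ∀ z, R < ‖z‖ → H z = 0) : IntegrableOn H U := by
  have hK : IsCompact (closedU ∩ Metric.closedBall 0 R) :=
    (isCompact_closedBall 0 R).inter_left isClosed_closedU
  have h1 : IntegrableOn H (U ∩ Metric.closedBall 0 R) :=
    ((hH.mono inter_subset_left).integrableOn_compact hK).mono_set
      (inter_subset_inter_left _ U_subset_closedU)
  refine h1.of_forall_sdiff_eq_zero measurableSet_U fun z hz => h z ?_
  have := hz.2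
  simp only [mem_inter_iff, hz.1, true_and, mem_closedBall_zero_iff, not_le] at this
  exact this

/-- A smooth function vanishing for `y ≤ 1 / (n + 1)` and equal to one for `y ≥ 2 / (n + 1)`. -/
noncomputable def step (n : ℕ) (y : ℝ) : ℝ := Real.smoothTransition ((n + 1) * y - 1)

lemma contDiff_step (n : ℕ) : ContDiff ℝ ∞ (step n) :=
  Real.smoothTransition.contDiff.comp (by fun_prop)

lemma step_eq_zero {n : ℕ} {y : ℝ} (h : y ≤ 1 / ((n : ℝ) + 1)) : step n y = 0 := by
  refine Real.smoothTransition.zero_of_nonpos ?_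
  rw [le_div_iff₀ (by positivity)] at h
  linarith

lemma tendsto_step {y : ℝ} (hy : 0 < y) : Tendsto (fun n => step n y) atTop (𝓝 1) := by
  refine tendsto_const_nhds.congr' ?_
  obtain ⟨N, hN⟩ := exists_nat_ge (2 / y)
  filter_upwards [eventually_ge_atTop N] with n hn
  refine (Real.smoothTransition.one_of_one_le ?_).symm
  rw [div_le_iff₀ hy] at hN
  have : (N : ℝ) ≤ n := by exact_mod_cast hn
  nlinarith

lemma norm_step_le (n : ℕ) (y : ℝ) : ‖(step n y : ℂ)‖ ≤ 1 := by
  rw [Complex.norm_real, step, Real.norm_of_nonneg (Real.smoothTransition.nonneg _)]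
  exact Real.smoothTransition.le_one _

lemma hasDerivAt_step (n : ℕ) (y : ℝ) :
    HasDerivAt (step n) ((n + 1) * deriv Real.smoothTransition ((n + 1) * y - 1)) y := by
  have h1 : HasDerivAt Real.smoothTransition (deriv Real.smoothTransition ((n + 1) * y - 1))
      ((n + 1) * y - 1) :=
    ((Real.smoothTransition.contDiff (n := 1)).differentiable (by norm_num) _).hasDerivAt
  have h2 : HasDerivAt (fun y : ℝ => ((n : ℝ) + 1) * y - 1) ((n + 1) * 1) y :=
    ((hasDerivAt_id y).const_mul _).sub_const 1
  have := h1.comp y h2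
  rw [mul_one, mul_comm] at this
  exact this

lemma continuous_deriv_smoothTransition : Continuous (deriv Real.smoothTransition) :=
  (Real.smoothTransition.contDiff (n := 1)).continuous_deriv le_rfl

lemma deriv_smoothTransition_of_not_mem {u : ℝ} (hu : u ∉ Icc (0 : ℝ) 1) :
    deriv Real.smoothTransition u = 0 := by
  rw [mem_Icc, not_and_or, not_le, not_le] at hu
  rcases hu with hu | hu
  · have : Real.smoothTransition =ᶠ[𝓝 u] fun _ => 0 := by
      filter_upwards [gt_mem_nhds hu] with v hv
      exact Real.smoothTransition.zero_of_nonpos (le_of_lt hv)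
    rw [this.deriv_eq, deriv_const]
  · have : Real.smoothTransition =ᶠ[𝓝 u] fun _ => 1 := by
      filter_upwards [lt_mem_nhds hu] with v hv
      exact Real.smoothTransition.one_of_one_le (le_of_lt hv)
    rw [this.deriv_eq, deriv_const]

lemma integral_deriv_smoothTransition : ∫ u, deriv Real.smoothTransition u = 1 := by
  have h1 : ∫ u in (0:ℝ)..1, deriv Real.smoothTransition u = 1 := by
    rw [intervalIntegral.integral_deriv_eq_sub
      (fun x _ => (Real.smoothTransition.contDiff (n := 1)).differentiable (by norm_num) x)
      (continuous_deriv_smoothTransition.intervalIntegrable _ _)]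
    simp
  rw [← h1, intervalIntegral.integral_of_le zero_le_one, ← integral_Icc_eq_integral_Ioc]
  exact (setIntegral_eq_integral_of_forall_compl_eq_zero fun u hu =>
    deriv_smoothTransition_of_not_mem hu).symm

/-- The derivative of `step n` has total mass one and concentrates at the origin; the substitution
`u = (n + 1) y - 1` moves the dependence on `n` into the argument of `m`. -/
lemma tendsto_integral_deriv_step {m : ℝ → ℂ} (hm : Continuous m) :
    Tendsto (fun n : ℕ => ∫ y : ℝ,
      (((n + 1) * deriv Real.smoothTransition ((n + 1) * y - 1) : ℝ) : ℂ) * m y)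
      atTop (𝓝 (m 0)) := by
  have e : ∀ n : ℕ, ∫ y : ℝ,
      (((n + 1) * deriv Real.smoothTransition ((n + 1) * y - 1) : ℝ) : ℂ) * m y =
      ∫ u : ℝ, ((deriv Real.smoothTransition u : ℝ) : ℂ) * m ((u + 1) / (n + 1)) := by
    intro n
    have hn : (0 : ℝ) < n + 1 := by positivity
    have h2 := Measure.integral_comp_mul_left
      (fun v : ℝ => ((deriv Real.smoothTransition (v - 1) : ℝ) : ℂ) * m (v / (n + 1))) ((n : ℝ) + 1)
    have h1 := integral_sub_right_eq_self
      (fun u : ℝ => ((deriv Real.smoothTransition u : ℝ) : ℂ) * m ((u + 1) / (n + 1))) 1 (μ := volume)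
    simp only [sub_add_cancel] at h1
    rw [← h1]
    have e2 : ∀ y : ℝ, (((n + 1) * deriv Real.smoothTransition ((n + 1) * y - 1) : ℝ) : ℂ) * m y =
        ((n + 1 : ℝ) : ℂ) * (((deriv Real.smoothTransition (((n : ℝ) + 1) * y - 1) : ℝ) : ℂ) *
          m (((n : ℝ) + 1) * y / (n + 1))) := by
      intro y
      rw [mul_div_cancel_left₀ _ hn.ne']
      push_cast
      ring
    simp_rw [e2]
    rw [integral_const_mul, h2, abs_of_pos (by positivity), ← Complex.coe_smul, smul_eq_mul,
      ← mul_assoc, ← Complex.ofReal_mul, mul_inv_cancel₀ hn.ne']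
    simp
  simp_rw [e]
  obtain ⟨C, hC⟩ := (isCompact_Icc (a := (0 : ℝ)) (b := 2)).exists_bound_of_continuousOn
    hm.continuousOn
  have hlim : m 0 = ∫ u : ℝ, ((deriv Real.smoothTransition u : ℝ) : ℂ) * m 0 := by
    rw [integral_mul_const, integral_complex_ofReal, integral_deriv_smoothTransition]; simp
  rw [hlim]
  refine tendsto_integral_of_dominated_convergence
    (fun u => ‖deriv Real.smoothTransition u‖ * C) (fun n => ?_) ?_ (fun n => ?_) ?_
  · exact Continuous.aestronglyMeasurable
      ((Complex.continuous_ofReal.comp continuous_deriv_smoothTransition).mul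
        (hm.comp (by fun_prop)))
  · refine Integrable.mul_const (Integrable.norm ?_) _
    exact continuous_deriv_smoothTransition.integrable_of_hasCompactSupport
      (HasCompactSupport.intro isCompact_Icc fun u hu => deriv_smoothTransition_of_not_mem hu)
  · refine Eventually.of_forall fun u => ?_
    rw [norm_mul, Complex.norm_real]
    by_cases hu : u ∈ Icc (0 : ℝ) 1
    · gcongr
      refine hC _ ⟨div_nonneg (by linarith [hu.1]) (by positivity), ?_⟩
      rw [div_le_iff₀ (by positivity)]
      have : (0 : ℝ) ≤ n := by positivity
      nlinarith [hu.2]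
    · rw [deriv_smoothTransition_of_not_mem hu]; simp
  · refine Eventually.of_forall fun u => ?_
    refine tendsto_const_nhds.mul ?_
    refine (hm.tendsto 0).comp ?_
    have := (tendsto_one_div_add_atTop_nhds_zero_nat (𝕜 := ℝ)).const_mul (u + 1)
    simpa [div_eq_mul_inv] using this

/-- The projection of the plane onto the closed upper half plane. -/
noncomputable def projU (z : ℂ) : ℂ := ⟨z.re, max z.im 0⟩

lemma continuous_projU : Continuous projU := by
  have : projU = fun z : ℂ => ((z.re : ℂ) + ((max z.im 0 : ℝ) : ℂ) * Complex.I) := by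
    ext z
    apply Complex.ext <;> simp [projU]
  rw [this]
  fun_prop

lemma projU_of_mem {z : ℂ} (hz : z ∈ closedU) : projU z = z := by
  have hz : 0 ≤ z.im := hz
  apply Complex.ext <;> simp [projU, hz]

lemma projU_mem (z : ℂ) : projU z ∈ closedU := by
  simp [projU, closedU]

/-- The one-dimensional statement applied to the slice integrals `m(y) = ∫ H(x + iy) dx`.
Composition with `projU` extends `H` continuously to the plane, which makes `m` continuous on all of
`ℝ`. -/
lemma tendsto_integral_U_deriv_step {H : ℂ → ℂ} (hH : ContinuousOn H closedU) {R : ℝ}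
    (hR : ∀ z, R < ‖z‖ → H z = 0) :
    Tendsto (fun n : ℕ => ∫ z in U,
      (((n + 1) * deriv Real.smoothTransition ((n + 1) * z.im - 1) : ℝ) : ℂ) * H z)
      atTop (𝓝 (∫ x : ℝ, H x)) := by
  set H' : ℂ → ℂ := fun z => H (projU z) with hH'
  have hc : Continuous H' := by
    rw [← continuousOn_univ]
    exact hH.comp continuous_projU.continuousOn fun z _ => projU_mem z
  have hz : ∀ z : ℂ, R < |z.re| → H' z = 0 := fun z hz =>
    hR _ (hz.trans_le (Complex.abs_re_le_norm (projU z)))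
  set m : ℝ → ℂ := fun y => ∫ x : ℝ, H' (x + y * Complex.I) with hm
  have hm' : m = fun y : ℝ => ∫ x in Icc (-R) R, H' (x + y * Complex.I) := by
    ext y
    refine (setIntegral_eq_integral_of_forall_compl_eq_zero fun x hx => hz _ ?_).symm
    rw [mem_Icc, ← abs_le, not_le] at hx
    simpa using hx
  have hmc : Continuous m := by
    rw [hm']
    exact continuous_parametric_integral_of_continuous
      (f := fun y x : ℝ => H' (x + y * Complex.I)) (by fun_prop) isCompact_Icc
  have hm0 : m 0 = ∫ x : ℝ, H x := by
    rw [hm]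
    refine integral_congr_ae (Eventually.of_forall fun x => ?_)
    simp [hH', projU_of_mem (show (x : ℂ) ∈ closedU by simp [closedU])]
  rw [← hm0]
  refine (tendsto_integral_deriv_step hmc).congr fun n => ?_
  set k : ℝ → ℝ := fun y => (n + 1) * deriv Real.smoothTransition ((n + 1) * y - 1) with hk
  have hkc : Continuous k := by
    have := continuous_deriv_smoothTransition
    fun_prop
  have hk0 : ∀ y, y ∉ Icc (0 : ℝ) 2 → k y = 0 := by
    intro y hy
    rw [hk]
    simp only
    rw [deriv_smoothTransition_of_not_mem, mul_zero]
    intro h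
    apply hy
    have hn : (0 : ℝ) ≤ n := by positivity
    constructor
    · by_contra hneg; nlinarith [h.1]
    · by_contra hneg; nlinarith [h.2]
  have h1 : ∫ z in U, (k z.im : ℂ) * H z = ∫ z : ℂ, (k z.im : ℂ) * H' z := by
    rw [setIntegral_congr_fun (g := fun z : ℂ => (k z.im : ℂ) * H' z) measurableSet_U]
    · refine setIntegral_eq_integral_of_forall_compl_eq_zero fun z hz => ?_
      have hz : z.im ≤ 0 := not_lt.1 hz
      have : k z.im = 0 := by
        rw [hk]
        simp only
        rw [deriv_smoothTransition_of_not_mem, mul_zero]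
        intro h
        have hn : (0 : ℝ) ≤ n := by positivity
        nlinarith [h.1]
      simp [this]
    · intro z hz
      simp only [hH', projU_of_mem (U_subset_closedU hz)]
  rw [h1, ← (Complex.volume_preserving_equiv_real_prod.symm).integral_comp
    Complex.measurableEquivRealProd.symm.measurableEmbedding, Measure.volume_eq_prod,
    integral_prod_symm]
  · refine integral_congr_ae (Eventually.of_forall fun y => ?_)
    simp only [Complex.measurableEquivRealProd_symm_apply, hm]
    rw [← integral_const_mul]
    refine integral_congr_ae (Eventually.of_forall fun x => ?_)
    have : (⟨x, y⟩ : ℂ) = x + y * Complex.I := by apply Complex.ext <;> simp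
    simp [this, hk]
  · have : (fun p : ℝ × ℝ => ((k (Complex.measurableEquivRealProd.symm p).im : ℝ) : ℂ) *
        H' (Complex.measurableEquivRealProd.symm p)) =
        fun p : ℝ × ℝ => (k p.2 : ℂ) * H' (p.1 + p.2 * Complex.I) := by
      ext p
      have : (⟨p.1, p.2⟩ : ℂ) = p.1 + p.2 * Complex.I := by apply Complex.ext <;> simp
      simp [Complex.measurableEquivRealProd_symm_apply, this]
    rw [this]
    refine Continuous.integrable_of_hasCompactSupport (by fun_prop)
      (HasCompactSupport.intro ((isCompact_Icc (a := -R) (b := R)).prod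
        (isCompact_Icc (a := (0 : ℝ)) (b := 2))) fun p hp => ?_)
    rw [mem_prod, not_and_or] at hp
    rcases hp with hp | hp
    · rw [mem_Icc, ← abs_le, not_le] at hp
      rw [hz _ (by simpa using hp), mul_zero]
    · rw [hk0 _ hp]; simp

/-- Green's formula on the upper half plane for a continuous function with a weak `∂/∂z̄`-derivative
and a smooth function of bounded support. -/
theorem integral_mul_dbar_eq {F g φ : ℂ → ℂ} (hF : ContinuousOn F closedU)
    (hw : HasWeakDbar U F g) (hφ : ∀ z ∈ closedU, ContDiffAt ℝ ∞ φ z) {R : ℝ}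
    (hR : ∀ z, R < ‖z‖ → φ z = 0) (hg : IntegrableOn (fun z => g z * φ z) U) :
    ∫ z in U, F z * dbar φ z =
      -(∫ z in U, g z * φ z) - Complex.I / 2 * ∫ x : ℝ, F x * φ x := by
  -- Multiplying by `step n` gives a test function supported in the open half plane. In the Leibniz
  -- rule the term containing the derivative of `step n` survives in the limit as the boundary
  -- integral, with the factor `i/2` of `dbar_ofReal_comp_im`.
  set ψ : ℕ → ℂ → ℂ := fun n z => (step n z.im : ℂ) * φ z with hψ
  have hφc : ContinuousOn φ closedU := fun z hz => (hφ z hz).continuousAt.continuousWithinAt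
  have hstep : ∀ n, ContDiff ℝ ∞ fun z : ℂ => (step n z.im : ℂ) := fun n =>
    Complex.ofRealCLM.contDiff.comp ((contDiff_step n).comp Complex.imCLM.contDiff)
  have hψsmooth : ∀ n, ContDiff ℝ ∞ (ψ n) := by
    intro n
    rw [contDiff_iff_contDiffAt]
    intro z
    rcases le_or_gt 0 z.im with hz | hz
    · exact (hstep n).contDiffAt.mul (hφ z hz)
    · have : ψ n =ᶠ[𝓝 z] fun _ => 0 := by
        filter_upwards [(isOpen_lt Complex.continuous_im continuous_const).mem_nhds hz] with w hw
        rw [hψ]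
        simp only
        rw [step_eq_zero ((show w.im < 0 from hw).le.trans (by positivity))]
        simp
      exact contDiffAt_const.congr_of_eventuallyEq this
  have hψcomp : ∀ n, HasCompactSupport (ψ n) := fun n =>
    HasCompactSupport.intro (isCompact_closedBall 0 R) fun z hz => by
      rw [mem_closedBall_zero_iff, not_le] at hz
      simp [hψ, hR z hz]
  have hψsupp : ∀ n, tsupport (ψ n) ⊆ U := by
    intro n
    have h1 : tsupport (ψ n) ⊆ {z : ℂ | 1 / ((n : ℝ) + 1) ≤ z.im} := by
      refine closure_minimal (fun z hz => ?_) (isClosed_le continuous_const Complex.continuous_im)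
      by_contra hlt
      apply hz
      simp only [mem_ofPred_eq, not_le] at hlt
      simp [hψ, step_eq_zero hlt.le]
    refine h1.trans fun z hz => ?_
    have hz : 1 / ((n : ℝ) + 1) ≤ z.im := hz
    exact lt_of_lt_of_le (by positivity) hz
  have hweak := fun n => hw.2.2 (ψ n) (hψsmooth n) (hψcomp n) (hψsupp n)
  have hdc : ContinuousOn (dbar φ) closedU := fun z hz =>
    (continuousAt_dbar (hφ z hz)).continuousWithinAt
  have hint1 : IntegrableOn (fun z => F z * dbar φ z) U :=
    integrableOn_of_continuousOn_of_vanishing (hF.mul hdc) fun z hz => by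
      rw [dbar_eq_zero_of_vanishing hR hz, mul_zero]
  have hst : ∀ n, Continuous fun z : ℂ => (step n z.im : ℂ) := fun n => (hstep n).continuous
  have hint1n : ∀ n, IntegrableOn (fun z => (step n z.im : ℂ) * (F z * dbar φ z)) U := fun n =>
    integrableOn_of_continuousOn_of_vanishing ((hst n).continuousOn.mul (hF.mul hdc))
      fun z hz => by rw [dbar_eq_zero_of_vanishing hR hz, mul_zero, mul_zero]
  have hint2n : ∀ n : ℕ, IntegrableOn (fun z => Complex.I / 2 *
      ((((n + 1) * deriv Real.smoothTransition ((n + 1) * z.im - 1) : ℝ) : ℂ) * (F z * φ z))) U := by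
    intro n
    refine integrableOn_of_continuousOn_of_vanishing ?_ (R := R) fun z hz => by simp [hR z hz]
    refine continuousOn_const.mul (ContinuousOn.mul (Continuous.continuousOn ?_) (hF.mul hφc))
    have := continuous_deriv_smoothTransition
    fun_prop
  have hsplit : ∀ n : ℕ, ∫ z in U, F z * dbar (ψ n) z =
      (∫ z in U, (step n z.im : ℂ) * (F z * dbar φ z)) + Complex.I / 2 * ∫ z in U,
        (((n + 1) * deriv Real.smoothTransition ((n + 1) * z.im - 1) : ℝ) : ℂ) * (F z * φ z) := by
    intro n
    rw [← integral_const_mul, ← integral_add (hint1n n) (hint2n n)]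
    refine setIntegral_congr_fun measurableSet_U fun z hz => ?_
    have hd : dbar (ψ n) z = _ := dbar_mul ((hstep n).differentiable (by norm_num) z)
      ((hφ z (U_subset_closedU hz)).differentiableAt (by norm_num))
    rw [hd, dbar_ofReal_comp_im (hasDerivAt_step n z.im)]
    push_cast
    ring
  have hlim1 : Tendsto (fun n => ∫ z in U, (step n z.im : ℂ) * (F z * dbar φ z)) atTop
      (𝓝 (∫ z in U, F z * dbar φ z)) := by
    refine tendsto_integral_of_dominated_convergence (fun z => ‖F z * dbar φ z‖)
      (fun n => (hint1n n).aestronglyMeasurable) hint1.norm (fun n => ?_) ?_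
    · refine Eventually.of_forall fun z => ?_
      rw [norm_mul]
      exact mul_le_of_le_one_left (norm_nonneg _) (norm_step_le n _)
    · refine (ae_restrict_iff' measurableSet_U).2 (Eventually.of_forall fun z hz => ?_)
      have := ((Complex.continuous_ofReal.tendsto _).comp (tendsto_step hz)).mul_const
        (F z * dbar φ z)
      simpa using this
  have hlim2 : Tendsto (fun n => ∫ z in U, g z * ψ n z) atTop (𝓝 (∫ z in U, g z * φ z)) := by
    have e : ∀ n z, g z * ψ n z = (step n z.im : ℂ) * (g z * φ z) := fun n z => by
      simp only [hψ]; ring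
    simp_rw [e]
    refine tendsto_integral_of_dominated_convergence (fun z => ‖g z * φ z‖)
      (fun n => (hst n).aestronglyMeasurable.mul hg.aestronglyMeasurable) hg.norm (fun n => ?_) ?_
    · refine Eventually.of_forall fun z => ?_
      rw [norm_mul]
      exact mul_le_of_le_one_left (norm_nonneg _) (norm_step_le n _)
    · refine (ae_restrict_iff' measurableSet_U).2 (Eventually.of_forall fun z hz => ?_)
      have := ((Complex.continuous_ofReal.tendsto _).comp (tendsto_step hz)).mul_const
        (g z * φ z)
      simpa using this
  have hlim3 := (tendsto_integral_U_deriv_step (H := fun z => F z * φ z) (hF.mul hφc) (R := R)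
    fun z hz => by simp [hR z hz]).const_mul (Complex.I / 2)
  have hL := hlim1.add hlim3
  have hRt := hlim2.neg
  have hEq := tendsto_nhds_unique (hL.congr fun n => by
    rw [← hsplit n, hweak n]) hRt
  rw [← hEq]
  ring

/-! ### Cutoffs at infinity -/

/-- A fixed smooth bump on the plane, equal to one on the unit disc and supported in the disc of
radius two. -/
noncomputable def bump : ContDiffBump (0 : ℂ) := ⟨1, 2, one_pos, one_lt_two⟩

/-- The bump rescaled to radius `n + 1`. -/
noncomputable def cutoff (n : ℕ) (z : ℂ) : ℝ := bump (((n : ℝ) + 1)⁻¹ • z)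

lemma norm_scaled (n : ℕ) (z : ℂ) : ‖((n : ℝ) + 1)⁻¹ • z‖ = ‖z‖ / (n + 1) := by
  rw [norm_smul, Real.norm_of_nonneg (by positivity), div_eq_inv_mul]

lemma cutoff_nonneg (n : ℕ) (z : ℂ) : 0 ≤ cutoff n z := bump.nonneg

lemma cutoff_le_one (n : ℕ) (z : ℂ) : cutoff n z ≤ 1 := bump.le_one

lemma cutoff_eq_one {n : ℕ} {z : ℂ} (h : ‖z‖ ≤ n + 1) : cutoff n z = 1 := by
  refine bump.one_of_mem_closedBall ?_
  rw [mem_closedBall_zero_iff, norm_scaled]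
  exact (div_le_one (by positivity)).2 h

lemma cutoff_eq_zero {n : ℕ} {z : ℂ} (h : 2 * ((n : ℝ) + 1) ≤ ‖z‖) : cutoff n z = 0 := by
  refine bump.zero_of_le_dist ?_
  rw [dist_zero_right, norm_scaled]
  exact (le_div_iff₀ (by positivity)).2 h

lemma contDiff_cutoff (n : ℕ) : ContDiff ℝ ∞ fun z => (cutoff n z : ℂ) :=
  Complex.ofRealCLM.contDiff.comp (bump.contDiff.comp (contDiff_const_smul _))

lemma norm_cutoff_le (n : ℕ) (z : ℂ) : ‖(cutoff n z : ℂ)‖ ≤ 1 := by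
  rw [Complex.norm_real, Real.norm_of_nonneg (cutoff_nonneg n z)]
  exact cutoff_le_one n z

/-- All cutoffs are dilates of one bump, so a derivative costs one factor `1 / (n + 1)`. -/
lemma exists_norm_dbar_cutoff_le :
    ∃ C : ℝ, 0 ≤ C ∧ ∀ (n : ℕ) (z : ℂ), ‖dbar (fun z => (cutoff n z : ℂ)) z‖ ≤ C / (n + 1) := by
  set u : ℂ → ℂ := fun z => (bump z : ℂ) with hu
  have hus : ContDiff ℝ ∞ u := Complex.ofRealCLM.contDiff.comp bump.contDiff
  have huc : Continuous (dbar u) :=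
    continuous_iff_continuousAt.2 fun z => continuousAt_dbar hus.contDiffAt
  have hsupp : HasCompactSupport (dbar u) :=
    HasCompactSupport.intro (isCompact_closedBall 0 2) fun z hz => by
      rw [mem_closedBall_zero_iff, not_le] at hz
      refine dbar_eq_zero_of_vanishing (R := 2) (fun w hw => ?_) hz
      have : bump w = 0 := bump.zero_of_le_dist (by rw [dist_zero_right]; exact hw.le)
      simp [hu, this]
  obtain ⟨C, hC⟩ := huc.bounded_above_of_compact_support hsupp
  refine ⟨C, (norm_nonneg _).trans (hC 0), fun n z => ?_⟩
  have : dbar (fun z => (cutoff n z : ℂ)) z =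
      ((((n : ℝ) + 1)⁻¹ : ℝ) : ℂ) * dbar u (((n : ℝ) + 1)⁻¹ • z) := by
    have e := fderiv_comp_smul (𝕜 := ℝ) (f := u) (x := z) (((n : ℝ) + 1)⁻¹)
    unfold dbar
    rw [show (fun z => (cutoff n z : ℂ)) = (u <| ((n : ℝ) + 1)⁻¹ • ·) from rfl, e]
    simp only [smul_apply, Complex.real_smul]
    ring
  rw [this, norm_mul, Complex.norm_real, Real.norm_of_nonneg (by positivity), div_eq_inv_mul]
  gcongr
  exact hC _

lemma dbar_cutoff_eq_zero {n : ℕ} {z : ℂ} (h : ‖z‖ < n + 1) :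
    dbar (fun z => (cutoff n z : ℂ)) z = 0 := by
  have : (fun z => (cutoff n z : ℂ)) =ᶠ[𝓝 z] fun _ => 1 := by
    filter_upwards [(isOpen_lt continuous_norm continuous_const).mem_nhds h] with w hw
    rw [cutoff_eq_one (le_of_lt hw)]; simp
  unfold dbar
  rw [this.fderiv_eq]
  simp

lemma tendsto_cutoff (z : ℂ) : Tendsto (fun n => cutoff n z) atTop (𝓝 1) := by
  refine tendsto_const_nhds.congr' ?_
  obtain ⟨N, hN⟩ := exists_nat_ge ‖z‖
  filter_upwards [eventually_ge_atTop N] with n hn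
  have : (N : ℝ) ≤ n := by exact_mod_cast hn
  exact (cutoff_eq_one (by linarith)).symm

lemma eventually_norm_le_of_isLittleO {F : ℂ → ℂ}
    (ho : F =o[Bornology.cobounded ℂ ⊓ 𝓟 U] fun z : ℂ => z ^ 2) {ε : ℝ} (hε : 0 < ε) :
    ∃ R : ℝ, ∀ z ∈ U, R ≤ ‖z‖ → ‖F z‖ ≤ ε * ‖z‖ ^ 2 := by
  have h := ho.bound hε
  rw [eventually_inf_principal, ← comap_norm_atTop, eventually_comap] at h
  obtain ⟨R, hR⟩ := eventually_atTop.1 h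
  refine ⟨R, fun z hz hzR => ?_⟩
  have := hR ‖z‖ hzR z rfl hz
  rwa [norm_pow] at this

/-- A holomorphic function decaying like `ζ⁻³` pairs with the boundary values of `F` as it pairs with
the weak `∂/∂z̄`-derivative of `F`. -/
theorem tendsto_integral_boundary {F g h : ℂ → ℂ} (hF : ContinuousOn F closedU)
    (hw : HasWeakDbar U F g) (ho : F =o[Bornology.cobounded ℂ ⊓ 𝓟 U] fun z : ℂ => z ^ 2)
    (hh : ∀ z ∈ closedU, AnalyticAt ℂ h z) {C R₀ : ℝ}
    (hdecay : ∀ z ∈ U, R₀ ≤ ‖z‖ → ‖h z‖ ≤ C / ‖z‖ ^ 3)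
    (hgh : IntegrableOn (fun z => g z * h z) U) :
    Tendsto (fun n : ℕ => ∫ x : ℝ, F x * (cutoff n x * h x)) atTop
      (𝓝 (2 * Complex.I * ∫ z in U, g z * h z)) := by
  have hsm : ∀ n, ∀ z ∈ closedU, ContDiffAt ℝ ∞ (fun z => (cutoff n z : ℂ) * h z) z :=
    fun n z hz => (contDiff_cutoff n).contDiffAt.mul
      ((hh z hz).contDiffAt.restrict_scalars ℝ)
  have hcut : ∀ n, Continuous fun z => (cutoff n z : ℂ) := fun n => (contDiff_cutoff n).continuous
  have hR : ∀ n : ℕ, ∀ z : ℂ, 2 * ((n : ℝ) + 1) < ‖z‖ → (cutoff n z : ℂ) * h z = 0 :=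
    fun n z hz => by rw [cutoff_eq_zero hz.le]; simp
  have e : ∀ n z, g z * ((cutoff n z : ℂ) * h z) = (cutoff n z : ℂ) * (g z * h z) :=
    fun n z => by ring
  have hg : ∀ n, IntegrableOn (fun z => g z * ((cutoff n z : ℂ) * h z)) U := by
    intro n
    simp_rw [e]
    refine Integrable.mono hgh ((hcut n).aestronglyMeasurable.mul hgh.aestronglyMeasurable)
      (Eventually.of_forall fun z => ?_)
    rw [norm_mul]
    exact mul_le_of_le_one_left (norm_nonneg _) (norm_cutoff_le n z)
  have hgreen := fun n => integral_mul_dbar_eq hF hw (hsm n) (hR n) (hg n)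
  have hlim : Tendsto (fun n => ∫ z in U, g z * ((cutoff n z : ℂ) * h z)) atTop
      (𝓝 (∫ z in U, g z * h z)) := by
    refine tendsto_integral_of_dominated_convergence (fun z => ‖g z * h z‖)
      (fun n => (hg n).aestronglyMeasurable) hgh.norm (fun n => ?_) ?_
    · refine Eventually.of_forall fun z => ?_
      rw [e, norm_mul]
      exact mul_le_of_le_one_left (norm_nonneg _) (norm_cutoff_le n _)
    · refine Eventually.of_forall fun z => ?_
      simp_rw [e]
      have := ((Complex.continuous_ofReal.tendsto _).comp (tendsto_cutoff z)).mul_const (g z * h z)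
      simpa using this
  -- As `h` is holomorphic, only `∂χ/∂z̄ · h` remains, for `χ` the cutoff, and it vanishes for `|z|
  -- < n + 1`. Where it lives, `F = o(|z|²)`, `∂χ/∂z̄ = O(1/n)` and `h = O(|z|⁻³)`, so the integrand
  -- is `o(n⁻²)` on a region of area `O(n²)`.
  have hzero : Tendsto (fun n => ∫ z in U, F z * dbar (fun z => (cutoff n z : ℂ) * h z) z) atTop
      (𝓝 0) := by
    obtain ⟨C₁, hC₁, hβ⟩ := exists_norm_dbar_cutoff_le
    rw [Metric.tendsto_atTop]
    intro ε hε
    set A : ℝ := |C| * C₁ * (4 * Real.pi) with hA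
    have hA0 : 0 ≤ A := by positivity
    obtain ⟨R, hRF⟩ := eventually_norm_le_of_isLittleO ho (ε := ε / (A + 1)) (by positivity)
    obtain ⟨N, hN⟩ := exists_nat_ge (max R R₀)
    refine ⟨N, fun n hn => ?_⟩
    have hnN : (N : ℝ) ≤ n := by exact_mod_cast hn
    have hn1 : (0 : ℝ) < (n : ℝ) + 1 := by positivity
    have hdb : ∀ z ∈ U, dbar (fun z => (cutoff n z : ℂ) * h z) z =
        dbar (fun z => (cutoff n z : ℂ)) z * h z := fun z hz => by
      have hz' := U_subset_closedU hz
      rw [dbar_mul ((contDiff_cutoff n).differentiable (by norm_num) z)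
        ((hh z hz').differentiableAt.restrictScalars ℝ),
        dbar_eq_zero (hh z hz').differentiableAt, mul_zero, add_zero]
    have hbd : ∀ z ∈ U, ‖F z * dbar (fun z => (cutoff n z : ℂ) * h z) z‖ ≤
        ε / (A + 1) * |C| * C₁ / (n + 1) ^ 2 := by
      intro z hz
      rcases lt_or_ge ‖z‖ (n + 1) with hlt | hge
      · rw [hdb z hz, dbar_cutoff_eq_zero hlt]
        simp only [zero_mul, mul_zero, norm_zero]
        positivity
      · have hz0 : 0 < ‖z‖ := hn1.trans_le hge
        have h1 := hRF z hz (by linarith [le_max_left R R₀])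
        have h2 := hdecay z hz (by linarith [le_max_right R R₀])
        rw [hdb z hz, norm_mul, norm_mul]
        calc ‖F z‖ * (‖dbar (fun z => (cutoff n z : ℂ)) z‖ * ‖h z‖)
            ≤ (ε / (A + 1) * ‖z‖ ^ 2) * (C₁ / (n + 1) * (|C| / ‖z‖ ^ 3)) := by
              gcongr
              · exact hβ n z
              · exact h2.trans (by gcongr; exact le_abs_self C)
          _ = ε / (A + 1) * |C| * C₁ / ((n + 1) * ‖z‖) := by field_simp
          _ ≤ _ := by
              rw [sq]; gcongr
    have hvan : ∀ z ∈ U \ (U ∩ Metric.closedBall 0 (2 * ((n : ℝ) + 1))),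
        F z * dbar (fun z => (cutoff n z : ℂ) * h z) z = 0 := by
      intro z hz
      have := hz.2
      simp only [mem_inter_iff, hz.1, true_and, mem_closedBall_zero_iff, not_le] at this
      rw [dbar_eq_zero_of_vanishing (hR n) this, mul_zero]
    rw [dist_zero_right, setIntegral_eq_of_subset_of_forall_sdiff_eq_zero measurableSet_U
      inter_subset_left hvan]
    have hfin : volume (U ∩ Metric.closedBall (0 : ℂ) (2 * ((n : ℝ) + 1))) < ⊤ :=
      (measure_mono inter_subset_right).trans_lt measure_closedBall_lt_top
    have hvol : volume.real (U ∩ Metric.closedBall (0 : ℂ) (2 * ((n : ℝ) + 1))) ≤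
        4 * Real.pi * (n + 1) ^ 2 := by
      calc _ ≤ volume.real (Metric.closedBall (0 : ℂ) (2 * ((n : ℝ) + 1))) :=
            measureReal_mono inter_subset_right measure_closedBall_lt_top.ne
        _ = _ := by
            rw [Measure.real, Complex.volume_closedBall, ENNReal.toReal_mul, ENNReal.toReal_pow,
              ENNReal.toReal_ofReal (by positivity)]
            simp
            ring
    calc _ ≤ ε / (A + 1) * |C| * C₁ / (n + 1) ^ 2 *
          volume.real (U ∩ Metric.closedBall (0 : ℂ) (2 * ((n : ℝ) + 1))) :=
          norm_setIntegral_le_of_norm_le_const hfin fun z hz => hbd z hz.1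
      _ ≤ ε / (A + 1) * |C| * C₁ / (n + 1) ^ 2 * (4 * Real.pi * (n + 1) ^ 2) := by gcongr
      _ = ε * (A / (A + 1)) := by rw [hA]; field_simp
      _ < ε := by
          apply mul_lt_of_lt_one_right hε
          rw [div_lt_one (by positivity)]
          linarith
  have hcomb := ((hlim.neg.sub hzero).const_mul (-(2 * Complex.I)))
  have e2 : -(2 * Complex.I) * (-(∫ z in U, g z * h z) - 0) = 2 * Complex.I * ∫ z in U, g z * h z := by
    ring
  rw [e2] at hcomb
  refine hcomb.congr fun n => ?_
  rw [hgreen n]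
  have hI : Complex.I * Complex.I = -1 := Complex.I_mul_I
  linear_combination (-(∫ x : ℝ, F x * (cutoff n x * h x))) * hI

/-! ### Second-difference combinations of Cauchy kernels -/

/-- The combination of Cauchy kernels representing
`(q - p) (f b - f a) - (b - a) (f q - f p)`; it decays like `ζ⁻³`. -/
noncomputable def testKernel (a b p q : ℝ) (ζ : ℂ) : ℂ :=
  (q - p) * ((ζ - b)⁻¹ - (ζ - a)⁻¹) - (b - a) * ((ζ - q)⁻¹ - (ζ - p)⁻¹)

lemma sub_ofReal_ne_zero {ζ : ℂ} (hζ : 0 < ζ.im) (x : ℝ) : ζ - x ≠ 0 := by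
  intro h
  have := congrArg Complex.im h
  simp at this
  exact hζ.ne' this

/-- The weights `q - p` and `b - a` make the `ζ⁻²` terms of the two differences cancel. What is left
is a linear numerator over four linear factors, hence decay `ζ⁻³`. -/
lemma testKernel_eq (a b p q : ℝ) {ζ : ℂ} (hζ : 0 < ζ.im) :
    testKernel a b p q ζ = (((q - p) * (b - a) : ℝ) : ℂ) *
      (((a + b - p - q : ℝ) : ℂ) * ζ + ((p * q - a * b : ℝ) : ℂ)) *
      ((ζ - a)⁻¹ * (ζ - b)⁻¹ * ((ζ - p)⁻¹ * (ζ - q)⁻¹)) := by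
  have ha := sub_ofReal_ne_zero hζ a
  have hb := sub_ofReal_ne_zero hζ b
  have hp := sub_ofReal_ne_zero hζ p
  have hq := sub_ofReal_ne_zero hζ q
  unfold testKernel
  field_simp
  push_cast
  ring

/-- `z` has size at most `A` and argument at most `k δ` relative to this size. -/
def NearReal (k A δ : ℝ) (z : ℂ) : Prop := ‖z‖ ≤ A ∧ |z.im| ≤ k * δ * A

lemma NearReal.mul {k l A B δ : ℝ} {z w : ℂ} (hz : NearReal k A δ z) (hw : NearReal l B δ w) :
    NearReal (k + l) (A * B) δ (z * w) := by
  have hA := (norm_nonneg z).trans hz.1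
  refine ⟨by rw [norm_mul]; exact mul_le_mul hz.1 hw.1 (norm_nonneg _) hA, ?_⟩
  rw [Complex.mul_im]
  calc |z.re * w.im + z.im * w.re| ≤ |z.re| * |w.im| + |z.im| * |w.re| := by
        rw [← abs_mul, ← abs_mul]; exact abs_add_le _ _
    _ ≤ A * (l * δ * B) + (k * δ * A) * B := by
        refine add_le_add (mul_le_mul ((Complex.abs_re_le_norm z).trans hz.1) hw.2
          (abs_nonneg _) hA) (mul_le_mul hz.2 ((Complex.abs_re_le_norm w).trans hw.1)
          (abs_nonneg _) ((abs_nonneg _).trans hz.2))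
    _ = _ := by ring

lemma nearReal_inv_sub {M x : ℝ} (hx : |x| ≤ M) {ζ : ℂ} (hζ : 0 < ζ.im) (hM : 2 * M ≤ ‖ζ‖) :
    NearReal 2 (2 / ‖ζ‖) (ζ.im / ‖ζ‖) (ζ - x)⁻¹ := by
  have hpos : 0 < ‖ζ‖ := hζ.trans_le (Complex.im_le_norm ζ)
  have h1 : ‖ζ‖ / 2 ≤ ‖ζ - x‖ := by
    have := norm_sub_norm_le ζ (x : ℂ)
    rw [Complex.norm_real, Real.norm_eq_abs] at this
    linarith
  have h2 : ‖(ζ - x)⁻¹‖ ≤ 2 / ‖ζ‖ := by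
    rw [norm_inv, ← inv_div]
    exact inv_anti₀ (by positivity) h1
  refine ⟨h2, ?_⟩
  rw [Complex.inv_im, ← Complex.sq_norm, abs_div, abs_neg, abs_of_nonneg (sq_nonneg ‖ζ - x‖)]
  simp only [Complex.sub_im, Complex.ofReal_im, sub_zero, abs_of_pos hζ]
  calc ζ.im / ‖ζ - x‖ ^ 2 ≤ ζ.im / (‖ζ‖ / 2) ^ 2 := by gcongr
    _ = _ := by field_simp

lemma nearReal_ofReal (x δ : ℝ) : NearReal 0 |x| δ (x : ℂ) := by
  simp [NearReal]

/-- Multiply the factors of `testKernel_eq`, whose coefficients are real. The sizes give `5M · 2⁴ =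
80M`, and the relative imaginary parts add up to `0 + 1 + 4 · 2 = 9`. -/
lemma nearReal_testKernel {a b p q M : ℝ} (hM : 1 ≤ M) (ha : |a| ≤ M) (hb : |b| ≤ M) (hp : |p| ≤ M)
    (hq : |q| ≤ M) {ζ : ℂ} (hζ : 0 < ζ.im) (h : 2 * M ≤ ‖ζ‖) :
    NearReal 9 (|(q - p) * (b - a)| * (80 * M) / ‖ζ‖ ^ 3) (ζ.im / ‖ζ‖) (testKernel a b p q ζ) := by
  have hpos : 0 < ‖ζ‖ := hζ.trans_le (Complex.im_le_norm ζ)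
  have hlin : NearReal 1 (5 * M * ‖ζ‖) (ζ.im / ‖ζ‖)
      (((a + b - p - q : ℝ) : ℂ) * ζ + ((p * q - a * b : ℝ) : ℂ)) := by
    have h1 : |a + b - p - q| ≤ 4 * M := by
      rw [abs_le] at *
      constructor <;> linarith [ha.1, ha.2, hb.1, hb.2, hp.1, hp.2, hq.1, hq.2]
    have h2 : |p * q - a * b| ≤ 2 * M ^ 2 := by
      calc |p * q - a * b| ≤ |p * q| + |a * b| := abs_sub _ _
        _ = |p| * |q| + |a| * |b| := by rw [abs_mul, abs_mul]
        _ ≤ M * M + M * M := by gcongr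
        _ = _ := by ring
    constructor
    · refine (norm_add_le _ _).trans ?_
      rw [norm_mul, Complex.norm_real, Complex.norm_real, Real.norm_eq_abs, Real.norm_eq_abs]
      nlinarith
    · simp only [Complex.add_im, Complex.mul_im, Complex.ofReal_re, Complex.ofReal_im, zero_mul,
        add_zero, abs_mul, abs_of_pos hζ]
      calc |a + b - p - q| * ζ.im ≤ 4 * M * ζ.im := by gcongr
        _ ≤ 5 * M * ζ.im := by gcongr; norm_num
        _ = _ := by field_simp
  have := ((nearReal_ofReal ((q - p) * (b - a)) (ζ.im / ‖ζ‖)).mul hlin).mul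
    (((nearReal_inv_sub ha hζ h).mul (nearReal_inv_sub hb hζ h)).mul
      ((nearReal_inv_sub hp hζ h).mul (nearReal_inv_sub hq hζ h)))
  rw [testKernel_eq a b p q hζ]
  convert this using 1
  · norm_num
  · field_simp
    ring

lemma im_mul_norm_testKernel_le {a b p q : ℝ} {ζ : ℂ} (hζ : 0 < ζ.im) :
    ζ.im * ‖testKernel a b p q ζ‖ ≤ 2 * |q - p| + 2 * |b - a| := by
  have h1 : ∀ x : ℝ, ζ.im * ‖(ζ - x)⁻¹‖ ≤ 1 := by
    intro x
    have hne := norm_pos_iff.2 (sub_ofReal_ne_zero hζ x)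
    rw [norm_inv, ← div_eq_mul_inv, div_le_one hne]
    simpa using Complex.im_le_norm (ζ - x)
  have h2 : ‖testKernel a b p q ζ‖ ≤ |q - p| * (‖(ζ - b)⁻¹‖ + ‖(ζ - a)⁻¹‖) +
      |b - a| * (‖(ζ - q)⁻¹‖ + ‖(ζ - p)⁻¹‖) := by
    refine (norm_sub_le _ _).trans ?_
    rw [norm_mul, norm_mul, ← Complex.ofReal_sub, ← Complex.ofReal_sub, Complex.norm_real,
      Complex.norm_real, Real.norm_eq_abs, Real.norm_eq_abs]
    gcongr <;> exact norm_sub_le _ _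
  calc _ ≤ ζ.im * (|q - p| * (‖(ζ - b)⁻¹‖ + ‖(ζ - a)⁻¹‖) +
        |b - a| * (‖(ζ - q)⁻¹‖ + ‖(ζ - p)⁻¹‖)) := by gcongr
    _ = |q - p| * (ζ.im * ‖(ζ - b)⁻¹‖ + ζ.im * ‖(ζ - a)⁻¹‖) +
        |b - a| * (ζ.im * ‖(ζ - q)⁻¹‖ + ζ.im * ‖(ζ - p)⁻¹‖) := by ring
    _ ≤ |q - p| * (1 + 1) + |b - a| * (1 + 1) := by
        gcongr <;> exact h1 _
    _ = _ := by ring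

/-- The first bound controls the cutoff error in Green's formula, the second gains a factor `Im ζ /
|ζ|` for the tail of the boundary integral, and the third, valid up to the poles, gives domination
of the area integral. -/
lemma exists_testKernel_bounds (a b p q : ℝ) : ∃ K R : ℝ, 0 ≤ K ∧ 1 ≤ R ∧
    (∀ ζ : ℂ, 0 < ζ.im → R ≤ ‖ζ‖ → ‖testKernel a b p q ζ‖ ≤ K / ‖ζ‖ ^ 3) ∧
    (∀ ζ : ℂ, 0 < ζ.im → R ≤ ‖ζ‖ → |(testKernel a b p q ζ).im| ≤ K * ζ.im / ‖ζ‖ ^ 4) ∧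
    (∀ ζ : ℂ, 0 < ζ.im → ζ.im * ‖testKernel a b p q ζ‖ ≤ K * (1 + ‖ζ‖ ^ 2)⁻¹) := by
  set M := 1 + |a| + |b| + |p| + |q| with hMdef
  have hM : 1 ≤ M := by
    linarith [abs_nonneg a, abs_nonneg b, abs_nonneg p, abs_nonneg q]
  have ha : |a| ≤ M := by linarith [abs_nonneg a, abs_nonneg b, abs_nonneg p, abs_nonneg q]
  have hb : |b| ≤ M := by linarith [abs_nonneg a, abs_nonneg b, abs_nonneg p, abs_nonneg q]
  have hp : |p| ≤ M := by linarith [abs_nonneg a, abs_nonneg b, abs_nonneg p, abs_nonneg q]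
  have hq : |q| ≤ M := by linarith [abs_nonneg a, abs_nonneg b, abs_nonneg p, abs_nonneg q]
  set A := |(q - p) * (b - a)| * (80 * M) with hA
  have hA0 : 0 ≤ A := by positivity
  set B := (2 * |q - p| + 2 * |b - a|) * (1 + (2 * M) ^ 2) with hB
  have hB0 : 0 ≤ B := by positivity
  have hfar : ∀ ζ : ℂ, 0 < ζ.im → 2 * M ≤ ‖ζ‖ → ‖testKernel a b p q ζ‖ ≤ A / ‖ζ‖ ^ 3 :=
    fun ζ hζ h => (nearReal_testKernel hM ha hb hp hq hζ h).1
  refine ⟨9 * A + B, 2 * M, by positivity, by linarith, fun ζ hζ h => ?_, fun ζ hζ h => ?_,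
    fun ζ hζ => ?_⟩
  · refine (hfar ζ hζ h).trans ?_
    gcongr
    linarith
  · have hpos : 0 < ‖ζ‖ := by linarith
    have := (nearReal_testKernel hM ha hb hp hq hζ h).2
    calc _ ≤ _ := this
      _ = 9 * A * ζ.im / ‖ζ‖ ^ 4 := by rw [← hA]; field_simp
      _ ≤ _ := by gcongr; linarith
  · rw [← div_eq_mul_inv, le_div_iff₀ (by positivity)]
    rcases le_or_gt (2 * M) ‖ζ‖ with h | h
    · have hpos : 0 < ‖ζ‖ := by linarith
      calc ζ.im * ‖testKernel a b p q ζ‖ * (1 + ‖ζ‖ ^ 2)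
          ≤ ‖ζ‖ * (A / ‖ζ‖ ^ 3) * (‖ζ‖ ^ 2 + ‖ζ‖ ^ 2) := by
            gcongr
            · exact Complex.im_le_norm ζ
            · exact hfar ζ hζ h
            · nlinarith
        _ = 2 * A := by field_simp; norm_num
        _ ≤ _ := by linarith
    · calc ζ.im * ‖testKernel a b p q ζ‖ * (1 + ‖ζ‖ ^ 2)
          ≤ (2 * |q - p| + 2 * |b - a|) * (1 + (2 * M) ^ 2) := by
            gcongr
            exact im_mul_norm_testKernel_le hζ
        _ ≤ _ := by linarith

/-! ### The Poisson kernel as an approximate identity -/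

lemma im_inv_sub_add_mul_I (t x ε : ℝ) :
    (((t : ℂ) + ε * Complex.I - x)⁻¹).im = -ε / ((t - x) ^ 2 + ε ^ 2) := by
  rw [Complex.inv_im, Complex.normSq_apply]
  simp [sq]

/-- The imaginary part of a shifted Cauchy kernel is `-π` times the Poisson kernel; rescaling by `ε`
reduces the limit to dominated convergence against `(1 + s²)⁻¹`. -/
lemma tendsto_integral_mul_im_inv {u : ℝ → ℝ} (hu : Continuous u) {C : ℝ} (hC : ∀ t, ‖u t‖ ≤ C)
    (x : ℝ) {ε : ℕ → ℝ} (hε : ∀ n, 0 < ε n) (hε0 : Tendsto ε atTop (𝓝 0)) :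
    Tendsto (fun n => ∫ t : ℝ, u t * (((t : ℂ) + ε n * Complex.I - x)⁻¹).im) atTop
      (𝓝 (-Real.pi * u x)) := by
  have e : ∀ n, ∫ t : ℝ, u t * (((t : ℂ) + ε n * Complex.I - x)⁻¹).im =
      ∫ s : ℝ, -(u (x + ε n * s) * (1 + s ^ 2)⁻¹) := by
    intro n
    have hn := hε n
    have h1 := integral_add_left_eq_self
      (fun t : ℝ => u t * (((t : ℂ) + ε n * Complex.I - x)⁻¹).im) x (μ := volume)
    have h2 := Measure.integral_comp_mul_left
      (fun v : ℝ => u (x + v) * ((((x + v : ℝ) : ℂ) + ε n * Complex.I - x)⁻¹).im) (ε n)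
    rw [← h1, eq_comm]
    rw [abs_of_pos (by positivity), smul_eq_mul, inv_mul_eq_div, eq_div_iff hn.ne', mul_comm,
      ← integral_const_mul] at h2
    rw [← h2]
    refine integral_congr_ae (Eventually.of_forall fun s => ?_)
    simp only [im_inv_sub_add_mul_I]
    have : (x + ε n * s - x) ^ 2 + ε n ^ 2 = ε n ^ 2 * (1 + s ^ 2) := by ring
    rw [this]
    field_simp
  simp_rw [e]
  have hlim : -Real.pi * u x = ∫ s : ℝ, -(u x * (1 + s ^ 2)⁻¹) := by
    rw [integral_neg, integral_const_mul, integral_univ_inv_one_add_sq]; ring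
  rw [hlim]
  refine tendsto_integral_of_dominated_convergence (fun s => C * (1 + s ^ 2)⁻¹) (fun n => ?_)
    (integrable_inv_one_add_sq.const_mul C) (fun n => ?_) ?_
  · refine Continuous.aestronglyMeasurable ?_
    refine (Continuous.mul (by fun_prop) (Continuous.inv₀ (by fun_prop) fun s => ?_)).neg
    positivity
  · refine Eventually.of_forall fun s => ?_
    rw [norm_neg, norm_mul, Real.norm_of_nonneg (show 0 ≤ (1 + s ^ 2)⁻¹ by positivity)]
    gcongr
    exact hC _
  · refine Eventually.of_forall fun s => ?_
    refine Tendsto.neg (Tendsto.mul_const _ ?_)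
    refine (hu.tendsto x).comp ?_
    simpa using (hε0.mul_const s).const_add x

lemma integrable_mul_im_inv {u : ℝ → ℝ} (hu : Continuous u) (hs : HasCompactSupport u) (x : ℝ)
    {ε : ℝ} (hε : 0 < ε) :
    Integrable fun t : ℝ => u t * (((t : ℂ) + ε * Complex.I - x)⁻¹).im := by
  have hc : Continuous fun t : ℝ => (((t : ℂ) + ε * Complex.I - x)⁻¹).im := by
    refine Complex.continuous_im.comp (Continuous.inv₀ (by fun_prop) fun t => ?_)
    exact sub_ofReal_ne_zero (by simpa using hε) x
  exact (hu.mul hc).integrable_of_hasCompactSupport hs.mul_right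

lemma tendsto_integral_mul_im_testKernel {u : ℝ → ℝ} (hu : Continuous u) (hs : HasCompactSupport u)
    (a b p q : ℝ) {ε : ℕ → ℝ} (hε : ∀ n, 0 < ε n) (hε0 : Tendsto ε atTop (𝓝 0)) :
    Tendsto (fun n => ∫ t : ℝ, u t * (testKernel a b p q ((t : ℂ) + ε n * Complex.I)).im) atTop
      (𝓝 (-Real.pi * ((q - p) * (u b - u a) - (b - a) * (u q - u p)))) := by
  obtain ⟨C, hC⟩ := hu.bounded_above_of_compact_support hs
  have hT := fun x => tendsto_integral_mul_im_inv hu hC x hε hε0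
  have hI := fun n x => integrable_mul_im_inv hu hs x (hε n)
  have key := (((hT b).sub (hT a)).const_mul (q - p)).sub (((hT q).sub (hT p)).const_mul (b - a))
  convert key using 1
  · ext n
    rw [← integral_sub (hI n b) (hI n a), ← integral_sub (hI n q) (hI n p), ← integral_const_mul,
      ← integral_const_mul]
    have h1 := ((hI n b).sub (hI n a)).const_mul (q - p)
    have h2 := ((hI n q).sub (hI n p)).const_mul (b - a)
    refine Eq.trans ?_ (integral_sub h1 h2)
    refine integral_congr_ae (Eventually.of_forall fun t => ?_)
    simp only [testKernel, Complex.sub_im, ← Complex.ofReal_sub,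
      Complex.im_ofReal_mul]
    ring
  · congr 1; ring

/-! ### The second-difference representation and the increment bound -/

lemma norm_le_norm_add_mul_I {ζ : ℂ} (hζ : 0 ≤ ζ.im) {ε : ℝ} (hε : 0 ≤ ε) :
    ‖ζ‖ ≤ ‖ζ + ε * Complex.I‖ := by
  rw [← sq_le_sq₀ (norm_nonneg _) (norm_nonneg _), Complex.sq_norm, Complex.sq_norm,
    Complex.normSq_apply, Complex.normSq_apply]
  simp
  nlinarith

/-- A product of two square-integrable functions: `|g| / y` by the energy hypothesis, and `(1 +
|z|²)⁻¹` because the plane has dimension two. -/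
lemma integrableOn_majorant {g : ℂ → ℂ} (hg : Measurable g)
    (hE : ∫⁻ z in U, ‖g z‖ₑ ^ 2 / ENNReal.ofReal (z.im ^ 2) < ⊤) :
    IntegrableOn (fun z => ‖g z‖ / z.im * (1 + ‖z‖ ^ 2)⁻¹) U := by
  have h1 : IntegrableOn (fun z => (‖g z‖ / z.im) ^ 2) U := by
    have hm : Measurable fun z => (‖g z‖ / z.im) ^ 2 :=
      (hg.norm.div Complex.measurable_im).pow_const 2
    refine ⟨hm.aestronglyMeasurable, ?_⟩
    refine lt_of_le_of_lt (le_of_eq ?_) hE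
    refine setLIntegral_congr_fun measurableSet_U fun z hz => ?_
    have hz : 0 < z.im := hz
    simp only
    rw [Real.enorm_eq_ofReal (by positivity), div_pow, ENNReal.ofReal_div_of_pos (by positivity),
      ENNReal.ofReal_pow (norm_nonneg _), ofReal_norm]
  have h2 : Integrable (fun z : ℂ => ((1 + ‖z‖ ^ 2)⁻¹) ^ 2) := by
    have := integrable_rpow_neg_one_add_norm_sq (E := ℂ) (μ := volume) (r := 4)
      (by rw [Complex.finrank_real_complex]; norm_num)
    refine this.congr (Eventually.of_forall fun z => ?_)
    simp only
    rw [show (-4 / 2 : ℝ) = -(2 : ℕ) by norm_num, Real.rpow_neg (by positivity),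
      Real.rpow_natCast, inv_pow]
  have hm : Measurable fun z => ‖g z‖ / z.im * (1 + ‖z‖ ^ 2)⁻¹ :=
    (hg.norm.div Complex.measurable_im).mul (by fun_prop)
  refine (h1.add h2.integrableOn).mono' hm.aestronglyMeasurable ?_
  refine (ae_restrict_iff' measurableSet_U).2 (Eventually.of_forall fun z hz => ?_)
  have hz : 0 < z.im := hz
  rw [Real.norm_of_nonneg (by positivity)]
  simp only [Pi.add_apply]
  have hx : 0 ≤ ‖g z‖ / z.im := by positivity
  have hy : (0 : ℝ) ≤ (1 + ‖z‖ ^ 2)⁻¹ := by positivity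
  nlinarith [sq_nonneg (‖g z‖ / z.im - (1 + ‖z‖ ^ 2)⁻¹), mul_nonneg hx hy]

lemma analyticAt_testKernel (a b p q : ℝ) {ζ : ℂ} (hζ : 0 < ζ.im) :
    AnalyticAt ℂ (testKernel a b p q) ζ := by
  have h : ∀ x : ℝ, AnalyticAt ℂ (fun z : ℂ => (z - x)⁻¹) ζ := fun x =>
    (analyticAt_id.sub analyticAt_const).inv (sub_ofReal_ne_zero hζ x)
  exact (analyticAt_const.mul ((h b).sub (h a))).sub (analyticAt_const.mul ((h q).sub (h p)))

lemma measurable_testKernel (a b p q : ℝ) : Measurable (testKernel a b p q) := by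
  unfold testKernel
  fun_prop

/-- The growth condition concerns the open half plane only; it reaches the real axis by continuity
along vertical segments. -/
lemma norm_boundary_le {F : ℂ → ℂ} (hF : ContinuousOn F closedU) {R : ℝ}
    (h : ∀ z ∈ U, R ≤ ‖z‖ → ‖F z‖ ≤ 1 * ‖z‖ ^ 2) {x : ℝ} (hx : R ≤ |x|) : ‖F x‖ ≤ x ^ 2 := by
  have hpath : Tendsto (fun δ : ℝ => (x : ℂ) + δ * Complex.I) (𝓝[>] 0) (𝓝[closedU] (x : ℂ)) := by
    refine tendsto_nhdsWithin_iff.2 ⟨?_, ?_⟩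
    · have : Continuous fun δ : ℝ => (x : ℂ) + δ * Complex.I := by fun_prop
      have h0 := this.tendsto 0
      simp only [Complex.ofReal_zero, zero_mul, add_zero] at h0
      exact h0.mono_left nhdsWithin_le_nhds
    · filter_upwards [self_mem_nhdsWithin] with δ hδ
      simpa [closedU] using (le_of_lt hδ : (0 : ℝ) ≤ δ)
  have hFx : Tendsto F (𝓝[closedU] (x : ℂ)) (𝓝 (F x)) := hF x (by simp [closedU])
  have h1 := (hFx.comp hpath).norm
  have h2 : Tendsto (fun δ : ℝ => 1 * ‖(x : ℂ) + δ * Complex.I‖ ^ 2) (𝓝[>] 0) (𝓝 (x ^ 2)) := by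
    have := ((tendsto_nhdsWithin_iff.1 hpath).1.norm.pow 2).const_mul 1
    simpa using this
  refine le_of_tendsto_of_tendsto h1 h2 ?_
  filter_upwards [self_mem_nhdsWithin] with δ hδ
  have hδ : 0 < δ := hδ
  refine h _ (by simpa [U] using hδ) (hx.trans ?_)
  have := Complex.abs_re_le_norm ((x : ℂ) + δ * Complex.I)
  simpa using this

lemma norm_mul_testKernel_le {a b p q K : ℝ}
    (hK : ∀ ζ : ℂ, 0 < ζ.im → ζ.im * ‖testKernel a b p q ζ‖ ≤ K * (1 + ‖ζ‖ ^ 2)⁻¹) (hK0 : 0 ≤ K)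
    (g : ℂ → ℂ) {z : ℂ} (hz : z ∈ U) {ε : ℝ} (hε : 0 ≤ ε) :
    ‖g z * testKernel a b p q (z + ε * Complex.I)‖ ≤
      K * (‖g z‖ / z.im * (1 + ‖z‖ ^ 2)⁻¹) := by
  have hz : 0 < z.im := hz
  have him : (z + ε * Complex.I).im = z.im + ε := by simp
  have h1 := hK (z + ε * Complex.I) (by rw [him]; linarith)
  have h2 : z.im * ‖testKernel a b p q (z + ε * Complex.I)‖ ≤ K * (1 + ‖z‖ ^ 2)⁻¹ := by
    calc _ ≤ (z + ε * Complex.I).im * ‖testKernel a b p q (z + ε * Complex.I)‖ := by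
          gcongr; rw [him]; linarith
      _ ≤ _ := h1
      _ ≤ _ := by
          gcongr
          exact norm_le_norm_add_mul_I hz.le hε
  rw [norm_mul]
  calc ‖g z‖ * ‖testKernel a b p q (z + ε * Complex.I)‖ =
        ‖g z‖ / z.im * (z.im * ‖testKernel a b p q (z + ε * Complex.I)‖) := by field_simp
    _ ≤ ‖g z‖ / z.im * (K * (1 + ‖z‖ ^ 2)⁻¹) := by gcongr
    _ = _ := by ring

section Representation

variable {f : ℝ → ℝ} {F g : ℂ → ℂ}

/-- The poles of `testKernel` lie on the axis, so Green's formula is used with the kernel shifted by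
`iε`. As `f` is real, imaginary parts turn the boundary kernel into a Poisson kernel. The limit is
taken first in the cutoff, then in `ε`. -/
theorem pi_mul_second_difference_eq (hf : Continuous f) (hF : ContinuousOn F closedU)
    (hFf : ∀ x : ℝ, F x = f x) (hg : Measurable g) (hw : HasWeakDbar U F g)
    (ho : F =o[Bornology.cobounded ℂ ⊓ 𝓟 U] fun z : ℂ => z ^ 2)
    (hE : ∫⁻ z in U, ‖g z‖ₑ ^ 2 / ENNReal.ofReal (z.im ^ 2) < ⊤) (a b p q : ℝ) :
    -Real.pi * ((q - p) * (f b - f a) - (b - a) * (f q - f p)) =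
      2 * (∫ z in U, g z * testKernel a b p q z).re := by
  obtain ⟨K, R, hK0, hR1, hK1, hK2, hK3⟩ := exists_testKernel_bounds a b p q
  obtain ⟨R', hR'⟩ := eventually_norm_le_of_isLittleO ho one_pos
  -- Beyond `N` the kernel and growth bounds all apply, and the cutoff of index `N` equals one at
  -- the four points `a`, `b`, `p`, `q`.
  obtain ⟨N, hN⟩ := exists_nat_ge (max R (max R' (max (max |a| |b|) (max |p| |q|))))
  have hNR : R ≤ N := (le_max_left _ _).trans hN
  have hNR' : R' ≤ N := (le_max_left _ _).trans ((le_max_right _ _).trans hN)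
  have hNx : max (max |a| |b|) (max |p| |q|) ≤ N :=
    (le_max_right _ _).trans ((le_max_right _ _).trans hN)
  have hmaj := integrableOn_majorant hg hE
  have hkm : ∀ ε : ℝ, Measurable fun z : ℂ => testKernel a b p q (z + ε * Complex.I) := fun ε =>
    (measurable_testKernel a b p q).comp (by fun_prop)
  have hint : ∀ ε : ℝ, 0 ≤ ε →
      IntegrableOn (fun z => g z * testKernel a b p q (z + ε * Complex.I)) U := fun ε hε =>
    (hmaj.const_mul K).mono' (hg.mul (hkm ε)).aestronglyMeasurable
      ((ae_restrict_iff' measurableSet_U).2 (Eventually.of_forall fun z hz =>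
        norm_mul_testKernel_le hK3 hK0 g hz hε))
  set u : ℕ → ℝ → ℝ := fun n x => f x * cutoff n x with hu
  have hcut : ∀ n, Continuous fun x : ℝ => cutoff n x := fun n => by
    have := Complex.continuous_re.comp
      ((contDiff_cutoff n).continuous.comp Complex.continuous_ofReal)
    simpa [Function.comp_def] using this
  have huc : ∀ n, Continuous (u n) := fun n => hf.mul (hcut n)
  have hus : ∀ n, HasCompactSupport (u n) := fun n =>
    HasCompactSupport.intro (isCompact_closedBall 0 (2 * ((n : ℝ) + 1))) fun x hx => by
      rw [mem_closedBall_zero_iff, not_le] at hx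
      simp only [hu]
      rw [cutoff_eq_zero (by rw [Complex.norm_real]; exact hx.le), mul_zero]
  have hkc : ∀ ε : ℝ, 0 < ε →
      Continuous fun x : ℝ => testKernel a b p q ((x : ℂ) + ε * Complex.I) := fun ε hε => by
    rw [continuous_iff_continuousAt]
    intro x
    exact ContinuousAt.comp (f := fun x : ℝ => (x : ℂ) + ε * Complex.I)
      (analyticAt_testKernel a b p q (by simpa using hε)).continuousAt (by fun_prop)
  have hI : ∀ ε : ℝ, 0 < ε → ∀ n, Integrable fun x : ℝ =>
      u n x * (testKernel a b p q ((x : ℂ) + ε * Complex.I)).im := fun ε hε n =>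
    ((huc n).mul (Complex.continuous_im.comp (hkc ε hε))).integrable_of_hasCompactSupport
      (hus n).mul_right
  have hlim : ∀ ε : ℝ, 0 < ε → Tendsto (fun n => ∫ x : ℝ,
      u n x * (testKernel a b p q ((x : ℂ) + ε * Complex.I)).im) atTop
      (𝓝 (2 * (∫ z in U, g z * testKernel a b p q (z + ε * Complex.I)).re)) := by
    intro ε hε
    have h := tendsto_integral_boundary hF hw ho
      (h := fun z => testKernel a b p q (z + ε * Complex.I)) (C := K) (R₀ := R)
      (fun z hz => AnalyticAt.comp (f := fun z : ℂ => z + ε * Complex.I)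
        (analyticAt_testKernel a b p q (by have : 0 ≤ z.im := hz; simp; linarith))
        (analyticAt_id.add analyticAt_const)) ?_ (hint ε hε.le)
    · have h2 := (Complex.continuous_im.tendsto _).comp h
      have e1 : (2 * Complex.I * ∫ z in U, g z * testKernel a b p q (z + ε * Complex.I)).im =
          2 * (∫ z in U, g z * testKernel a b p q (z + ε * Complex.I)).re := by
        simp [Complex.mul_im]
      rw [e1] at h2
      refine h2.congr fun n => ?_
      simp only [Function.comp_apply]
      have e2 : ∀ x : ℝ, F x * ((cutoff n x : ℂ) * testKernel a b p q ((x : ℂ) + ε * Complex.I)) =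
          (u n x : ℂ) * testKernel a b p q ((x : ℂ) + ε * Complex.I) := fun x => by
        rw [hFf]; simp only [hu]; push_cast; ring
      simp_rw [e2]
      have hIc : Integrable fun x : ℝ =>
          (u n x : ℂ) * testKernel a b p q ((x : ℂ) + ε * Complex.I) :=
        ((Complex.continuous_ofReal.comp (huc n)).mul (hkc ε hε)).integrable_of_hasCompactSupport
          ((hus n).comp_left Complex.ofReal_zero).mul_right
      have e3 := Complex.imCLM.integral_comp_comm hIc
      simp only [Complex.imCLM_apply, Complex.im_ofReal_mul] at e3
      exact e3.symm
    · intro z hz hzR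
      have hz : 0 < z.im := hz
      have hle := norm_le_norm_add_mul_I hz.le hε.le
      have hz0 : 0 < ‖z‖ := by linarith
      refine (hK1 _ (by simp; linarith) (hzR.trans hle)).trans ?_
      gcongr
  -- The tail beyond `N` is `O(ε)` uniformly in `n`: there `|f| ≤ x²` and the imaginary part of the
  -- kernel is `O(ε / x⁴)`. Without the imaginary part, `x² · |x|⁻³` would not be integrable.
  have hdiff : ∀ ε : ℝ, 0 < ε → |2 * (∫ z in U, g z * testKernel a b p q (z + ε * Complex.I)).re -
      ∫ x : ℝ, u N x * (testKernel a b p q ((x : ℂ) + ε * Complex.I)).im| ≤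
      2 * K * ε * Real.pi := by
    intro ε hε
    refine le_of_tendsto ((hlim ε hε).sub_const _).abs ?_
    filter_upwards [eventually_ge_atTop N] with n hn
    have hnN : (N : ℝ) ≤ n := by exact_mod_cast hn
    rw [← integral_sub (hI ε hε n) (hI ε hε N), ← Real.norm_eq_abs, ← integral_univ_inv_one_add_sq,
      ← integral_const_mul]
    refine norm_integral_le_of_norm_le (integrable_inv_one_add_sq.const_mul _)
      (Eventually.of_forall fun x => ?_)
    have e : u n x * (testKernel a b p q ((x : ℂ) + ε * Complex.I)).im -
        u N x * (testKernel a b p q ((x : ℂ) + ε * Complex.I)).im =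
        f x * (cutoff n x - cutoff N x) *
          (testKernel a b p q ((x : ℂ) + ε * Complex.I)).im := by
      simp only [hu]; ring
    rw [e]
    rcases le_or_gt |x| (N + 1) with hx | hx
    · rw [cutoff_eq_one (n := n) (by rw [Complex.norm_real, Real.norm_eq_abs]; linarith),
        cutoff_eq_one (n := N) (by rw [Complex.norm_real, Real.norm_eq_abs]; linarith)]
      simp only [sub_self, mul_zero, zero_mul, norm_zero]
      positivity
    · have hx1 : 1 ≤ |x| := by linarith
      have hx0 : 0 < |x| := by linarith
      have hfx : |f x| ≤ |x| ^ 2 := by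
        have := norm_boundary_le hF hR' (x := x) (by linarith)
        rw [hFf, Complex.norm_real, Real.norm_eq_abs] at this
        rwa [sq_abs]
      have hcx : |cutoff n x - cutoff N x| ≤ 1 := by
        rw [abs_le]
        constructor <;> linarith [cutoff_nonneg n x, cutoff_nonneg N x, cutoff_le_one n x,
          cutoff_le_one N x]
      have hxn : |x| ≤ ‖(x : ℂ) + ε * Complex.I‖ := by
        have := norm_le_norm_add_mul_I (ζ := (x : ℂ)) (by simp) hε.le
        rwa [Complex.norm_real, Real.norm_eq_abs] at this
      have hkx : |(testKernel a b p q ((x : ℂ) + ε * Complex.I)).im| ≤ K * ε / |x| ^ 4 := by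
        refine (hK2 _ (by simpa using hε) (by linarith)).trans ?_
        have : ((x : ℂ) + ε * Complex.I).im = ε := by simp
        rw [this]
        gcongr
      rw [norm_mul, norm_mul, Real.norm_eq_abs, Real.norm_eq_abs, Real.norm_eq_abs]
      calc _ ≤ |x| ^ 2 * 1 * (K * ε / |x| ^ 4) := by gcongr
        _ = K * ε / |x| ^ 2 := by field_simp
        _ ≤ 2 * K * ε * (1 + x ^ 2)⁻¹ := by
            rw [← div_eq_mul_inv, ← sq_abs x, div_le_div_iff₀ (by positivity) (by positivity)]
            have : 0 ≤ K * ε := by positivity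
            nlinarith [mul_le_mul_of_nonneg_left (one_le_pow₀ hx1 : 1 ≤ |x| ^ 2) this]
  set ε : ℕ → ℝ := fun n => 1 / ((n : ℝ) + 1) with hεdef
  have hε : ∀ n, 0 < ε n := fun n => by positivity
  have hε0 : Tendsto ε atTop (𝓝 0) := tendsto_one_div_add_atTop_nhds_zero_nat
  -- `norm_mul_testKernel_le` dominates the area integrals uniformly in the shift.
  have hA : Tendsto (fun n => ∫ z in U, g z * testKernel a b p q (z + ε n * Complex.I)) atTop
      (𝓝 (∫ z in U, g z * testKernel a b p q z)) := by
    refine tendsto_integral_of_dominated_convergence _ (fun n => (hint _ (hε n).le).1)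
      (hmaj.const_mul K) (fun n => (ae_restrict_iff' measurableSet_U).2
        (Eventually.of_forall fun z hz => norm_mul_testKernel_le hK3 hK0 g hz (hε n).le)) ?_
    refine (ae_restrict_iff' measurableSet_U).2 (Eventually.of_forall fun z hz => ?_)
    refine Tendsto.const_mul _ ?_
    refine (analyticAt_testKernel a b p q (show 0 < z.im from hz)).continuousAt.tendsto.comp ?_
    have : Tendsto (fun n => z + (ε n : ℂ) * Complex.I) atTop (𝓝 (z + ((0 : ℝ) : ℂ) * Complex.I)) :=
      (((Complex.continuous_ofReal.tendsto _).comp hε0).mul_const _).const_add _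
    simpa using this
  have hB := tendsto_integral_mul_im_testKernel (huc N) (hus N) a b p q hε hε0
  have hAB := (((Complex.continuous_re.tendsto _).comp hA).const_mul 2).sub hB
  have hzero : Tendsto (fun n => 2 * (∫ z in U, g z * testKernel a b p q (z + ε n * Complex.I)).re -
      ∫ x : ℝ, u N x * (testKernel a b p q ((x : ℂ) + ε n * Complex.I)).im) atTop (𝓝 0) := by
    refine squeeze_zero_norm (fun n => hdiff (ε n) (hε n)) ?_
    simpa using (hε0.const_mul (2 * K)).mul_const Real.pi
  have huN : ∀ x : ℝ, |x| ≤ N → u N x = f x := fun x hx => by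
    simp only [hu]
    rw [cutoff_eq_one (by rw [Complex.norm_real, Real.norm_eq_abs]; linarith), mul_one]
  have hfin := tendsto_nhds_unique hAB hzero
  rw [huN a (((le_max_left _ _).trans (le_max_left _ _)).trans hNx),
    huN b (((le_max_right _ _).trans (le_max_left _ _)).trans hNx),
    huN p (((le_max_left _ _).trans (le_max_right _ _)).trans hNx),
    huN q (((le_max_right _ _).trans (le_max_right _ _)).trans hNx)] at hfin
  linarith

/-- Since `(ζ - s)⁻²` is the derivative of `(ζ - s)⁻¹` in `s`, the kernel is the double integral of
`(ζ - s)⁻² - (ζ - t)⁻²` over the rectangle. -/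
lemma enorm_testKernel_le {a b p q : ℝ} (hab : a ≤ b) (hpq : p ≤ q) {ζ : ℂ} (hζ : 0 < ζ.im) :
    ‖testKernel a b p q ζ‖ₑ ≤ ∫⁻ x in Icc a b ×ˢ Icc p q,
      ‖((ζ - x.1) ^ 2)⁻¹ - ((ζ - x.2) ^ 2)⁻¹‖ₑ := by
  have hc : Continuous fun s : ℝ => ((ζ - s) ^ 2)⁻¹ :=
    Continuous.inv₀ (by fun_prop) fun s => pow_ne_zero _ (sub_ofReal_ne_zero hζ s)
  have hd : ∀ s : ℝ, HasDerivAt (fun s : ℝ => (ζ - s)⁻¹) (((ζ - s) ^ 2)⁻¹) s := by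
    intro s
    have h1 : HasDerivAt (fun s : ℝ => ζ - s) (-1) s := by
      simpa using (Complex.ofRealCLM.hasDerivAt (x := s)).const_sub ζ
    have := h1.fun_inv (sub_ofReal_ne_zero hζ s)
    simpa using this
  have hint : ∀ x y : ℝ, ∫ s in x..y, ((ζ - s) ^ 2)⁻¹ = (ζ - y)⁻¹ - (ζ - x)⁻¹ := fun x y =>
    intervalIntegral.integral_eq_sub_of_hasDerivAt (fun s _ => hd s) (hc.intervalIntegrable _ _)
  have hinner : ∀ s : ℝ, ∫ t in p..q, (((ζ - s) ^ 2)⁻¹ - ((ζ - t) ^ 2)⁻¹) =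
      (q - p) * ((ζ - s) ^ 2)⁻¹ - ((ζ - q)⁻¹ - (ζ - p)⁻¹) := by
    intro s
    rw [intervalIntegral.integral_sub intervalIntegrable_const (hc.intervalIntegrable _ _), hint,
      intervalIntegral.integral_const, Complex.real_smul, Complex.ofReal_sub]
  have hrep : testKernel a b p q ζ = ∫ s in a..b, ∫ t in p..q,
      (((ζ - s) ^ 2)⁻¹ - ((ζ - t) ^ 2)⁻¹) := by
    simp_rw [hinner]
    rw [intervalIntegral.integral_sub ((hc.intervalIntegrable _ _).const_mul _)
      intervalIntegrable_const, intervalIntegral.integral_const_mul, hint,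
      intervalIntegral.integral_const, Complex.real_smul, Complex.ofReal_sub]
    rfl
  have hm : Measurable fun x : ℝ × ℝ => ‖((ζ - x.1) ^ 2)⁻¹ - ((ζ - x.2) ^ 2)⁻¹‖ₑ := by fun_prop
  rw [hrep, Measure.volume_eq_prod, ← Measure.prod_restrict, lintegral_prod _ hm.aemeasurable,
    intervalIntegral.integral_of_le hab]
  refine (enorm_integral_le_lintegral_enorm _).trans
    ((lintegral_mono fun s => ?_).trans (lintegral_mono_set Ioc_subset_Icc_self))
  rw [intervalIntegral.integral_of_le hpq]
  exact (enorm_integral_le_lintegral_enorm _).trans (lintegral_mono_set Ioc_subset_Icc_self)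

theorem enorm_second_difference_le (hf : Continuous f) (hF : ContinuousOn F closedU)
    (hFf : ∀ x : ℝ, F x = f x) (hg : Measurable g) (hw : HasWeakDbar U F g)
    (ho : F =o[Bornology.cobounded ℂ ⊓ 𝓟 U] fun z : ℂ => z ^ 2)
    (hE : ∫⁻ z in U, ‖g z‖ₑ ^ 2 / ENNReal.ofReal (z.im ^ 2) < ⊤) (a b p q : ℝ) (hab : a ≤ b)
    (hpq : p ≤ q) :
    ‖(q - p) * (f b - f a) - (b - a) * (f q - f p)‖ₑ ≤
      ∫⁻ x in Icc a b ×ˢ Icc p q, cauchyIncrement g x.1 x.2 := by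
  have h := pi_mul_second_difference_eq hf hF hFf hg hw ho hE a b p q
  set S := (q - p) * (f b - f a) - (b - a) * (f q - f p)
  set Y := ∫ z in U, g z * testKernel a b p q z
  -- The representation gives `π |S| ≤ 2 |Y|`; the spare factor `2/π < 1` is dropped.
  have hS : ‖S‖ ≤ ‖Y‖ := by
    have h1 : Real.pi * |S| = 2 * |Y.re| := by
      have := congrArg abs h
      rwa [abs_mul, abs_mul, abs_neg, abs_of_pos Real.pi_pos, abs_two] at this
    have h2 := Complex.abs_re_le_norm Y
    rw [Real.norm_eq_abs]
    nlinarith [Real.pi_gt_three, abs_nonneg S]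
  have hm : Measurable fun w : ℂ × (ℝ × ℝ) =>
      ‖g w.1‖ₑ * ‖((w.1 - w.2.1) ^ 2)⁻¹ - ((w.1 - w.2.2) ^ 2)⁻¹‖ₑ := by fun_prop
  calc ‖S‖ₑ ≤ ‖Y‖ₑ := enorm_le_iff_norm_le.2 hS
    _ ≤ ∫⁻ z in U, ‖g z * testKernel a b p q z‖ₑ := enorm_integral_le_lintegral_enorm _
    _ ≤ ∫⁻ z in U, ∫⁻ x in Icc a b ×ˢ Icc p q,
        ‖g z‖ₑ * ‖((z - x.1) ^ 2)⁻¹ - ((z - x.2) ^ 2)⁻¹‖ₑ := by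
        refine setLIntegral_mono' measurableSet_U fun z hz => ?_
        rw [enorm_mul, lintegral_const_mul _ (by fun_prop)]
        gcongr
        exact enorm_testKernel_le hab hpq hz
    _ = _ := by
        rw [lintegral_lintegral_swap hm.aemeasurable]
        rfl

lemma HasWeakDbar.congr_ae {Ω : Set ℂ} {g' : ℂ → ℂ} (hw : HasWeakDbar Ω F g)
    (h : g =ᵐ[volume.restrict Ω] g') : HasWeakDbar Ω F g' := by
  refine ⟨hw.1, fun x hx => ?_, fun φ h1 h2 h3 => ?_⟩
  · obtain ⟨s, hs, hi⟩ := hw.2.1 x hx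
    refine ⟨s ∩ Ω, inter_mem hs self_mem_nhdsWithin, (hi.mono_set inter_subset_left).congr ?_⟩
    exact ae_restrict_of_ae_restrict_of_subset inter_subset_right h
  · rw [hw.2.2 φ h1 h2 h3]
    congr 1
    refine integral_congr_ae ?_
    filter_upwards [h] with z hz
    rw [hz]

theorem memHThreeHalves_of_extension (hf : Continuous f) (hF : ContinuousOn F closedU)
    (hFf : ∀ x : ℝ, F x = f x) (hw : HasWeakDbar U F g)
    (ho : F =o[Bornology.cobounded ℂ ⊓ 𝓟 U] fun z : ℂ => z ^ 2)
    (hE : ∫⁻ z in U, ‖g z‖ₑ ^ 2 / ENNReal.ofReal (z.im ^ 2) < ⊤) : MemHThreeHalves f := by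
  -- The Schur test needs a Borel function, so `g` is replaced by an almost everywhere equal
  -- representative, with the same weak derivative property and energy.
  have hgm : AEStronglyMeasurable g (volume.restrict U) := hw.2.1.aestronglyMeasurable
  obtain ⟨g', hg', hae⟩ := hgm
  have hw' := hw.congr_ae hae
  have hg'm := hg'.measurable
  have hE' : ∫⁻ z in U, ‖g' z‖ₑ ^ 2 / ENNReal.ofReal (z.im ^ 2) < ⊤ := by
    refine lt_of_le_of_lt (le_of_eq (lintegral_congr_ae ?_)) hE
    filter_upwards [hae] with z hz
    rw [hz]
  have hT := measurable_cauchyIncrement hg'm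
  refine memHThreeHalves_of_increment_le hT ?_
    (enorm_second_difference_le hf hF hFf hg'm hw' ho hE')
  have hm : Measurable fun p : ℝ × ℝ => cauchyIncrement g' p.1 p.2 ^ 2 / ‖p.1 - p.2‖ₑ ^ 2 := by
    fun_prop
  rw [Measure.volume_eq_prod, lintegral_prod _ hm.aemeasurable]
  exact lintegral_sq_cauchyIncrement_lt_top hg'm hE'

end Representation

/-! ### Classical derivatives are weak derivatives -/

lemma isOpen_U : IsOpen U := isOpen_lt continuous_const Complex.continuous_im

lemma integrable_mul_of_tsupport_subset {Ω : Set ℂ} (hΩ : IsOpen Ω) {H φ : ℂ → ℂ}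
    (hH : ContinuousOn H Ω) (hφ : Continuous φ) (hc : HasCompactSupport φ) (hs : tsupport φ ⊆ Ω) :
    Integrable fun z => H z * φ z := by
  have hsub : tsupport (fun z => H z * φ z) ⊆ tsupport φ := closure_mono fun z hz => by
    intro h0
    exact hz (by simp [h0])
  have hcont : Continuous fun z => H z * φ z := continuous_of_tsupport fun z hz =>
    ((hH z (hs (hsub hz))).continuousAt (hΩ.mem_nhds (hs (hsub hz)))).mul hφ.continuousAt
  exact hcont.integrable_of_hasCompactSupport hc.mul_left

lemma hasWeakDbar_of_contDiffOn {F : ℂ → ℂ} (hF : ContDiffOn ℝ 1 F U) :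
    HasWeakDbar U F (dbar F) ∧ ContinuousOn (dbar F) U := by
  have hfd : ContinuousOn (fderiv ℝ F) U := hF.continuousOn_fderiv_of_isOpen isOpen_U le_rfl
  have hfv : ∀ v : ℂ, ContinuousOn (fun z => fderiv ℝ F z v) U := fun v =>
    hfd.clm_apply continuousOn_const
  have hdb : ContinuousOn (dbar F) U :=
    continuousOn_const.mul ((hfv 1).add (continuousOn_const.mul (hfv Complex.I)))
  refine ⟨⟨hF.continuousOn.locallyIntegrableOn measurableSet_U,
    hdb.locallyIntegrableOn measurableSet_U, fun φ hφ hc hs => ?_⟩, hdb⟩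
  have hφc : Continuous φ := hφ.continuous
  have hφd : Continuous (fderiv ℝ φ) := hφ.continuous_fderiv (by norm_num)
  have hφv : ∀ v : ℂ, Continuous fun z => fderiv ℝ φ z v := fun v => hφd.clm_apply continuous_const
  have hφvc : ∀ v : ℂ, HasCompactSupport fun z => fderiv ℝ φ z v := fun v =>
    (hc.fderiv (𝕜 := ℝ)).comp_left (g := fun L : ℂ →L[ℝ] ℂ => L v) rfl
  have hφvs : ∀ v : ℂ, tsupport (fun z => fderiv ℝ φ z v) ⊆ U := fun v =>
    (tsupport_fderiv_apply_subset ℝ v).trans hs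
  have h1 : ∀ v, Integrable fun z => fderiv ℝ F z v * φ z := fun v =>
    integrable_mul_of_tsupport_subset isOpen_U (hfv v) hφc hc hs
  have h2 : ∀ v, Integrable fun z => F z * fderiv ℝ φ z v := fun v =>
    integrable_mul_of_tsupport_subset isOpen_U hF.continuousOn (hφv v) (hφvc v) (hφvs v)
  have h3 := integrable_mul_of_tsupport_subset isOpen_U hF.continuousOn hφc hc hs
  have key : ∀ v, ∫ z, F z * fderiv ℝ φ z v = -∫ z, fderiv ℝ F z v * φ z := fun v =>
    integral_mul_fderiv_eq_neg_fderiv_mul_of_integrable (h1 v) (h2 v) h3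
      (fun z hz => (hF.contDiffAt (isOpen_U.mem_nhds (hs hz))).differentiableAt (by norm_num))
      (fun z _ => hφ.differentiable (by norm_num) z)
  have hz0 : ∀ z ∉ U, φ z = 0 := fun z hz => image_eq_zero_of_notMem_tsupport fun h => hz (hs h)
  have hz1 : ∀ v, ∀ z ∉ U, fderiv ℝ φ z v = 0 := fun v z hz =>
    image_eq_zero_of_notMem_tsupport (f := fun z => fderiv ℝ φ z v) fun h => hz (hφvs v h)
  rw [setIntegral_eq_integral_of_forall_compl_eq_zero (fun z hz => by
      simp [dbar, hz1 _ z hz]), setIntegral_eq_integral_of_forall_compl_eq_zero (fun z hz => by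
      simp [hz0 z hz])]
  have e1 : ∀ z, F z * dbar φ z = 1 / 2 * (F z * fderiv ℝ φ z 1) +
      Complex.I / 2 * (F z * fderiv ℝ φ z Complex.I) := fun z => by unfold dbar; ring
  have e2 : ∀ z, dbar F z * φ z = 1 / 2 * (fderiv ℝ F z 1 * φ z) +
      Complex.I / 2 * (fderiv ℝ F z Complex.I * φ z) := fun z => by unfold dbar; ring
  simp_rw [e1, e2]
  rw [integral_add ((h2 1).const_mul _) ((h2 Complex.I).const_mul _),
    integral_add ((h1 1).const_mul _) ((h1 Complex.I).const_mul _)]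
  simp only [integral_const_mul]
  rw [key, key]
  ring

/-! ### The Beurling–Ahlfors extension -/

section Extension

variable (f : ℝ → ℝ)

/-- The primitive of `f` vanishing at the origin. -/
noncomputable def primitive (x : ℝ) : ℝ := ∫ t in (0 : ℝ)..x, f t

/-- The average of `f` over `[x - y, x + y]`. -/
noncomputable def extRe (x y : ℝ) : ℝ := (primitive f (x + y) - primitive f (x - y)) / (2 * y)

/-- The difference of the integrals of `f` over `[x, x + y]` and `[x - y, x]`, divided by `y`. -/
noncomputable def extIm (x y : ℝ) : ℝ :=
  (primitive f (x + y) - 2 * primitive f x + primitive f (x - y)) / y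

open Classical in
/-- The Beurling–Ahlfors extension of `f` to the plane. -/
noncomputable def extension (z : ℂ) : ℂ :=
  if z.im = 0 then (f z.re : ℂ) else (extRe f z.re z.im : ℂ) + Complex.I * (extIm f z.re z.im : ℂ)

variable {f}

lemma hasDerivAt_primitive (hf : Continuous f) (x : ℝ) : HasDerivAt (primitive f) (f x) x :=
  intervalIntegral.integral_hasDerivAt_right (hf.intervalIntegrable _ _)
    (hf.stronglyMeasurableAtFilter _ _) hf.continuousAt

lemma contDiff_primitive (hf : Continuous f) : ContDiff ℝ 1 (primitive f) := by
  rw [contDiff_one_iff_deriv]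
  refine ⟨fun x => (hasDerivAt_primitive hf x).differentiableAt, ?_⟩
  have : deriv (primitive f) = f := funext fun x => (hasDerivAt_primitive hf x).deriv
  rwa [this]

lemma primitive_sub (hf : Continuous f) (a b : ℝ) :
    primitive f b - primitive f a = ∫ t in a..b, f t :=
  intervalIntegral.integral_interval_sub_left (hf.intervalIntegrable _ _)
    (hf.intervalIntegrable _ _)

lemma extension_ofReal (x : ℝ) : extension f x = f x := by simp [extension]

lemma extension_of_mem {z : ℂ} (hz : z ∈ U) :
    extension f z = (extRe f z.re z.im : ℂ) + Complex.I * (extIm f z.re z.im : ℂ) :=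
  if_neg (ne_of_gt hz)

lemma contDiffOn_extension (hf : Continuous f) : ContDiffOn ℝ 1 (extension f) U := by
  have hP := contDiff_primitive hf
  have hre : ContDiff ℝ 1 (fun z : ℂ => z.re) := Complex.reCLM.contDiff
  have him : ContDiff ℝ 1 (fun z : ℂ => z.im) := Complex.imCLM.contDiff
  have hA : ContDiffOn ℝ 1 (fun z : ℂ => extRe f z.re z.im) U := by
    unfold extRe
    refine ContDiffOn.div ?_ ?_ fun z hz => mul_ne_zero two_ne_zero (ne_of_gt hz)
    · exact ((hP.comp (hre.add him)).sub (hP.comp (hre.sub him))).contDiffOn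
    · exact (contDiff_const.mul him).contDiffOn
  have hB : ContDiffOn ℝ 1 (fun z : ℂ => extIm f z.re z.im) U := by
    unfold extIm
    refine ContDiffOn.div ?_ him.contDiffOn fun z hz => ne_of_gt hz
    exact (((hP.comp (hre.add him)).sub (contDiff_const.mul (hP.comp hre))).add
      (hP.comp (hre.sub him))).contDiffOn
  refine ContDiffOn.congr (f := fun z : ℂ => (extRe f z.re z.im : ℂ) +
    Complex.I * (extIm f z.re z.im : ℂ)) ?_ fun z hz => extension_of_mem hz
  exact (Complex.ofRealCLM.contDiff.comp_contDiffOn hA).add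
    (contDiffOn_const.mul (Complex.ofRealCLM.contDiff.comp_contDiffOn hB))

lemma hasDerivAt_comp_affine (hf : Continuous f) (x c : ℝ) :
    HasDerivAt (fun t => primitive f (x + c * t)) (c * f x) 0 := by
  have h1 : HasDerivAt (fun t : ℝ => x + c * t) c 0 := by
    simpa using ((hasDerivAt_id (0 : ℝ)).const_mul c).const_add x
  have h2 : HasDerivAt (primitive f) (f x) (x + c * 0) := by
    simpa using hasDerivAt_primitive hf x
  have := h2.comp 0 h1
  rw [mul_comm] at this
  exact this

lemma hasDerivAt_extRe_fst (hf : Continuous f) (x y : ℝ) :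
    HasDerivAt (fun t => extRe f (x + t) y) ((f (x + y) - f (x - y)) / (2 * y)) 0 := by
  have h := ((hasDerivAt_comp_affine hf (x + y) 1).sub
    (hasDerivAt_comp_affine hf (x - y) 1)).div_const (2 * y)
  simp only [one_mul] at h
  refine h.congr_of_eventuallyEq (Eventually.of_forall fun t => ?_)
  simp only [extRe, Pi.sub_apply]
  congr 3 <;> ring

lemma hasDerivAt_extIm_fst (hf : Continuous f) (x y : ℝ) :
    HasDerivAt (fun t => extIm f (x + t) y) ((f (x + y) - 2 * f x + f (x - y)) / y) 0 := by
  have h := (((hasDerivAt_comp_affine hf (x + y) 1).sub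
    ((hasDerivAt_comp_affine hf x 1).const_mul 2)).add
    (hasDerivAt_comp_affine hf (x - y) 1)).div_const y
  simp only [one_mul] at h
  refine h.congr_of_eventuallyEq (Eventually.of_forall fun t => ?_)
  simp only [extIm, Pi.sub_apply, Pi.add_apply]
  congr 4 <;> ring

lemma hasDerivAt_extRe_snd (hf : Continuous f) (x : ℝ) {y : ℝ} (hy : y ≠ 0) :
    HasDerivAt (fun t => extRe f x (y + t)) ((f (x + y) + f (x - y)) / (2 * y) -
      (primitive f (x + y) - primitive f (x - y)) / (2 * y ^ 2)) 0 := by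
  have hd : HasDerivAt (fun t : ℝ => 2 * (y + t)) 2 0 := by
    simpa using ((hasDerivAt_id (0 : ℝ)).const_add y).const_mul 2
  have h := ((hasDerivAt_comp_affine hf (x + y) 1).sub
    (hasDerivAt_comp_affine hf (x - y) (-1))).div hd (by simpa using hy)
  refine (h.congr_of_eventuallyEq (Eventually.of_forall fun t => ?_)).congr_deriv ?_
  · simp only [extRe, Pi.sub_apply, Pi.div_apply]
    congr 3 <;> ring
  · simp only [Pi.sub_apply, mul_zero, add_zero]
    field_simp
    ring

lemma hasDerivAt_extIm_snd (hf : Continuous f) (x : ℝ) {y : ℝ} (hy : y ≠ 0) :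
    HasDerivAt (fun t => extIm f x (y + t)) ((f (x + y) - f (x - y)) / y -
      (primitive f (x + y) - 2 * primitive f x + primitive f (x - y)) / y ^ 2) 0 := by
  have hd : HasDerivAt (fun t : ℝ => y + t) 1 0 := (hasDerivAt_id (0 : ℝ)).const_add y
  have h := (((hasDerivAt_comp_affine hf (x + y) 1).sub_const (2 * primitive f x)).add
    (hasDerivAt_comp_affine hf (x - y) (-1))).div hd (by simpa using hy)
  refine (h.congr_of_eventuallyEq (Eventually.of_forall fun t => ?_)).congr_deriv ?_
  · simp only [extIm, Pi.add_apply, Pi.div_apply]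
    rw [show x + (y + t) = x + y + 1 * t by ring, show x - (y + t) = x - y + -1 * t by ring]
  · simp only [Pi.add_apply, mul_zero, add_zero]
    field_simp
    ring

/-- The extension is differentiable on `U`, so its partial derivatives can be read off along
horizontal and vertical lines. -/
lemma dbar_extension (hf : Continuous f) {z : ℂ} (hz : z ∈ U) :
    dbar (extension f) z = 1 / 2 * (
      (((f (z.re + z.im) - f (z.re - z.im)) / (2 * z.im) -
        ((f (z.re + z.im) - f (z.re - z.im)) / z.im - (primitive f (z.re + z.im) -
          2 * primitive f z.re + primitive f (z.re - z.im)) / z.im ^ 2) : ℝ) : ℂ) +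
      Complex.I * (((f (z.re + z.im) - 2 * f z.re + f (z.re - z.im)) / z.im +
        ((f (z.re + z.im) + f (z.re - z.im)) / (2 * z.im) -
      (primitive f (z.re + z.im) - primitive f (z.re - z.im)) / (2 * z.im ^ 2)) : ℝ) : ℂ)) := by
  have hz0 : 0 < z.im := hz
  have hL := (((contDiffOn_extension hf).contDiffAt (isOpen_U.mem_nhds hz)).differentiableAt
    (by norm_num)).hasFDerivAt
  have hpath : ∀ v : ℂ, HasDerivAt (fun t : ℝ => z + t * v) v 0 := fun v => by
    simpa using ((Complex.ofRealCLM.hasDerivAt (x := (0 : ℝ))).mul_const v).const_add z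
  have hcomp : ∀ v : ℂ, HasDerivAt (fun t : ℝ => extension f (z + t * v))
      (fderiv ℝ (extension f) z v) 0 := fun v => by
    have hL' : HasFDerivAt (extension f) (fderiv ℝ (extension f) z)
        (z + ((0 : ℝ) : ℂ) * v) := by simpa using hL
    exact hL'.comp_hasDerivAt (0 : ℝ) (hpath v)
  have d1 := (hasDerivAt_extRe_fst hf z.re z.im).ofReal_comp.add
    ((hasDerivAt_extIm_fst hf z.re z.im).ofReal_comp.const_mul Complex.I)
  have d2 := (hasDerivAt_extRe_snd hf z.re hz0.ne').ofReal_comp.add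
    ((hasDerivAt_extIm_snd hf z.re hz0.ne').ofReal_comp.const_mul Complex.I)
  have h1 := (hcomp 1).unique (d1.congr_of_eventuallyEq (Eventually.of_forall fun t => by
    have : z + t * 1 ∈ U := by simpa [U] using hz0
    dsimp only
    rw [extension_of_mem this]
    simp))
  have h2 := (hcomp Complex.I).unique (d2.congr_of_eventuallyEq (by
    filter_upwards [lt_mem_nhds (show -z.im < 0 by linarith)] with t ht
    have : z + t * Complex.I ∈ U := by
      simp only [U, mem_ofPred_eq, Complex.add_im, Complex.mul_im, Complex.ofReal_re, Complex.I_im,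
        Complex.ofReal_im, Complex.I_re]
      linarith
    rw [extension_of_mem this]
    simp))
  unfold dbar
  rw [h1, h2]
  have hI : Complex.I * Complex.I = -1 := Complex.I_mul_I
  push_cast
  linear_combination (1 / 2 * (((f (z.re + z.im) - f (z.re - z.im)) / z.im -
    (primitive f (z.re + z.im) - 2 * primitive f z.re + primitive f (z.re - z.im)) /
      z.im ^ 2 : ℂ))) * hI

/-- The size of `∂/∂z̄` of the extension is controlled by the deviation of `f` from affine. -/
lemma norm_dbar_extension_le (hf : Continuous f) {z : ℂ} (hz : z ∈ U) {m S : ℝ}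
    (hS : ∀ t ∈ Icc (z.re - z.im) (z.re + z.im), |f t - f z.re - m * (t - z.re)| ≤ S) :
    ‖dbar (extension f) z‖ ≤ 7 / 2 * S / z.im := by
  have hy : 0 < z.im := hz
  rw [dbar_extension hf hz]
  set x := z.re
  set y := z.im
  have hint : ∀ a b : ℝ, ∫ t in a..b, (f t - f x - m * (t - x)) =
      primitive f b - primitive f a - f x * (b - a) - m * ((b - x) ^ 2 - (a - x) ^ 2) / 2 := by
    intro a b
    have hI1 : IntervalIntegrable (fun t => f t - f x) volume a b :=
      (hf.sub continuous_const).intervalIntegrable _ _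
    have hI2 : IntervalIntegrable (fun t => m * (t - x)) volume a b :=
      Continuous.intervalIntegrable (by fun_prop) _ _
    have e : ∫ t in a..b, (t - x) = ((b - x) ^ 2 - (a - x) ^ 2) / 2 := by
      rw [intervalIntegral.integral_comp_sub_right (fun t => t), integral_id]
    rw [intervalIntegral.integral_sub hI1 hI2,
      intervalIntegral.integral_sub (hf.intervalIntegrable _ _) intervalIntegrable_const,
      intervalIntegral.integral_const_mul, e, intervalIntegral.integral_const, primitive_sub hf]
    simp
    ring
  have hp := intervalIntegral.norm_integral_le_of_norm_le_const (a := x) (b := x + y) (C := S)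
    (f := fun t => f t - f x - m * (t - x)) fun t ht => by
      rw [uIoc_of_le (by linarith)] at ht
      exact hS t ⟨by linarith [ht.1], ht.2⟩
  have hm := intervalIntegral.norm_integral_le_of_norm_le_const (a := x - y) (b := x) (C := S)
    (f := fun t => f t - f x - m * (t - x)) fun t ht => by
      rw [uIoc_of_le (by linarith)] at ht
      exact hS t ⟨ht.1.le, by linarith [ht.2]⟩
  rw [hint, Real.norm_eq_abs, show x + y - x = y by ring, abs_of_pos hy] at hp
  rw [hint, Real.norm_eq_abs, show x - (x - y) = y by ring, abs_of_pos hy] at hm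
  have h1 := hS (x + y) ⟨by linarith, le_rfl⟩
  have h2 := hS (x - y) ⟨le_rfl, by linarith⟩
  set Hp := primitive f (x + y) - primitive f x - f x * y - m * (y ^ 2 - (x - x) ^ 2) / 2
  set Hm := primitive f x - primitive f (x - y) - f x * y - m * ((x - x) ^ 2 - (x - y - x) ^ 2) / 2
  set hp' := f (x + y) - f x - m * (x + y - x)
  set hm' := f (x - y) - f x - m * (x - y - x)
  -- Both parts of `∂/∂z̄` annihilate affine functions, so `f` may be replaced by its deviation:
  -- `hp'`, `hm'` are its endpoint values (at most `S`) and `Hp`, `Hm` its half-integrals (at most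
  -- `S y`). The resulting bounds `3S/y` and `4S/y` give the `7/2`.
  have hre : (f (x + y) - f (x - y)) / (2 * y) - ((f (x + y) - f (x - y)) / y -
      (primitive f (x + y) - 2 * primitive f x + primitive f (x - y)) / y ^ 2) =
      (Hp - Hm - (hp' - hm') / 2 * y) / y ^ 2 := by
    field_simp
    simp only [Hp, Hm, hp', hm']
    ring
  have him : (f (x + y) - 2 * f x + f (x - y)) / y + ((f (x + y) + f (x - y)) / (2 * y) -
      (primitive f (x + y) - primitive f (x - y)) / (2 * y ^ 2)) =
      (3 / 2 * (hp' + hm') * y - (Hp + Hm) / 2) / y ^ 2 := by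
    field_simp
    simp only [Hp, Hm, hp', hm']
    ring
  rw [hre, him]
  have b1 : |(Hp - Hm - (hp' - hm') / 2 * y) / y ^ 2| ≤ 3 * S / y := by
    rw [abs_div, abs_of_pos (show 0 < y ^ 2 by positivity), div_le_div_iff₀ (by positivity) hy]
    rw [abs_le] at *
    have : |Hp - Hm - (hp' - hm') / 2 * y| ≤ 3 * S * y := by
      rw [abs_le]
      constructor <;> nlinarith
    nlinarith
  have b2 : |(3 / 2 * (hp' + hm') * y - (Hp + Hm) / 2) / y ^ 2| ≤ 4 * S / y := by
    rw [abs_div, abs_of_pos (show 0 < y ^ 2 by positivity), div_le_div_iff₀ (by positivity) hy]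
    rw [abs_le] at *
    have : |3 / 2 * (hp' + hm') * y - (Hp + Hm) / 2| ≤ 4 * S * y := by
      rw [abs_le]
      constructor <;> nlinarith
    nlinarith
  calc _ ≤ 1 / 2 * (3 * S / y + 4 * S / y) := by
        rw [norm_mul]
        have : ‖(1 / 2 : ℂ)‖ = 1 / 2 := by norm_num
        rw [this]
        gcongr
        refine (norm_add_le _ _).trans ?_
        rw [norm_mul, Complex.norm_I, one_mul, Complex.norm_real, Complex.norm_real,
          Real.norm_eq_abs, Real.norm_eq_abs]
        exact add_le_add b1 b2
    _ = _ := by ring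

/-- The extension at `z` is close to any constant to which `f` is close near `z`. -/
lemma norm_extension_sub_le (hf : Continuous f) {z : ℂ} (hz : z ∈ closedU) {c S : ℝ}
    (hS : ∀ t ∈ Icc (z.re - z.im) (z.re + z.im), |f t - c| ≤ S) :
    ‖extension f z - c‖ ≤ 3 * S := by
  rcases (show 0 ≤ z.im from hz).eq_or_lt with h0 | hy
  · have h1 := hS z.re (by rw [← h0]; simp)
    have hS0 := (abs_nonneg _).trans h1
    rw [extension, if_pos h0.symm, ← Complex.ofReal_sub, Complex.norm_real, Real.norm_eq_abs]
    linarith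
  rw [extension_of_mem hy]
  set x := z.re
  set y := z.im
  have hint : ∀ a b : ℝ, ∫ t in a..b, (f t - c) =
      primitive f b - primitive f a - c * (b - a) := by
    intro a b
    rw [intervalIntegral.integral_sub (hf.intervalIntegrable _ _) intervalIntegrable_const,
      intervalIntegral.integral_const, primitive_sub hf]
    simp
    ring
  have hp := intervalIntegral.norm_integral_le_of_norm_le_const (a := x) (b := x + y) (C := S)
    (f := fun t => f t - c) fun t ht => by
      rw [uIoc_of_le (by linarith)] at ht
      exact hS t ⟨by linarith [ht.1], ht.2⟩
  have hm := intervalIntegral.norm_integral_le_of_norm_le_const (a := x - y) (b := x) (C := S)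
    (f := fun t => f t - c) fun t ht => by
      rw [uIoc_of_le (by linarith)] at ht
      exact hS t ⟨ht.1.le, by linarith [ht.2]⟩
  rw [hint, Real.norm_eq_abs, show x + y - x = y by ring, abs_of_pos hy] at hp
  rw [hint, Real.norm_eq_abs, show x - (x - y) = y by ring, abs_of_pos hy] at hm
  set Hp := primitive f (x + y) - primitive f x - c * y
  set Hm := primitive f x - primitive f (x - y) - c * y
  have hA : extRe f x y - c = (Hp + Hm) / (2 * y) := by
    simp only [extRe, Hp, Hm]
    field_simp
    ring
  have hB : extIm f x y = (Hp - Hm) / y := by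
    simp only [extIm, Hp, Hm]
    ring
  have b1 : |(Hp + Hm) / (2 * y)| ≤ S := by
    rw [abs_div, abs_of_pos (show 0 < 2 * y by positivity), div_le_iff₀ (by positivity)]
    rw [abs_le] at *
    constructor <;> linarith
  have b2 : |(Hp - Hm) / y| ≤ 2 * S := by
    rw [abs_div, abs_of_pos hy, div_le_iff₀ hy]
    rw [abs_le] at *
    constructor <;> linarith
  calc ‖(extRe f x y : ℂ) + Complex.I * (extIm f x y : ℂ) - c‖
      = ‖((extRe f x y - c : ℝ) : ℂ) + Complex.I * (extIm f x y : ℂ)‖ := by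
        congr 1; push_cast; ring
    _ ≤ S + 2 * S := by
        refine (norm_add_le _ _).trans ?_
        rw [norm_mul, Complex.norm_I, one_mul, Complex.norm_real, Complex.norm_real,
          Real.norm_eq_abs, Real.norm_eq_abs, hA, hB]
        exact add_le_add b1 b2
    _ = _ := by ring

lemma continuousOn_extension (hf : Continuous f) : ContinuousOn (extension f) closedU := by
  intro z hz
  rcases (show 0 ≤ z.im from hz).eq_or_lt with h0 | hy
  · have hzx : z = (z.re : ℂ) := by apply Complex.ext <;> simp [← h0]
    rw [ContinuousWithinAt, Metric.tendsto_nhdsWithin_nhds]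
    intro ε hε
    obtain ⟨δ, hδ, hfδ⟩ := Metric.continuousAt_iff.1 (hf.continuousAt (x := z.re)) (ε / 4)
      (by positivity)
    refine ⟨δ / 2, by positivity, fun w hw hwz => ?_⟩
    have hval : extension f z = (f z.re : ℂ) := by rw [hzx, extension_ofReal]; simp
    rw [hval, dist_eq_norm]
    have hd : ‖w - z‖ < δ / 2 := by rwa [dist_eq_norm] at hwz
    have h1 : |w.re - z.re| < δ / 2 := (Complex.abs_re_le_norm (w - z)).trans_lt hd
    have h2 : |w.im| < δ / 2 := by
      have := (Complex.abs_im_le_norm (w - z)).trans_lt hd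
      rwa [Complex.sub_im, ← h0, sub_zero] at this
    have h3 := norm_extension_sub_le hf hw (c := f z.re) (S := ε / 4) fun t ht => by
      have := hfδ (x := t) (by
        rw [Real.dist_eq]
        rw [abs_lt] at *
        constructor <;> linarith [ht.1, ht.2, h1.1, h1.2, h2.1, h2.2])
      rw [Real.dist_eq] at this
      exact this.le
    linarith
  · exact ((contDiffOn_extension hf).continuousOn.continuousAt
      (isOpen_U.mem_nhds hy)).continuousWithinAt

end Extension

/-! ### Size of the extension of a function in `H^{3/2}` -/

section Energy

variable {f φ : ℝ → ℝ}

/-- The unnormalized mean square oscillation of `φ` on the interval of radius `y` around `x`. -/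
noncomputable def oscEnergy (φ : ℝ → ℝ) (x y : ℝ) : ℝ≥0∞ :=
  ∫⁻ u in Icc (x - y) (x + y), ∫⁻ v in Icc (x - y) (x + y), ‖φ u - φ v‖ₑ ^ 2

/-- The Douglas-type double integral defining `H^{1/2}`. -/
noncomputable def douglas (φ : ℝ → ℝ) : ℝ≥0∞ :=
  ∫⁻ u : ℝ, ∫⁻ v : ℝ, ‖φ u - φ v‖ₑ ^ 2 / ‖u - v‖ₑ ^ 2

lemma sq_enorm_sub_le_mul_div (φ : ℝ → ℝ) {u v r : ℝ} (h : |u - v| ≤ r) :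
    ‖φ u - φ v‖ₑ ^ 2 ≤ ENNReal.ofReal r ^ 2 * (‖φ u - φ v‖ₑ ^ 2 / ‖u - v‖ₑ ^ 2) := by
  rcases eq_or_ne u v with rfl | huv
  · simp
  have h0 : ‖u - v‖ₑ ^ 2 ≠ 0 := pow_ne_zero _ (by simpa [sub_eq_zero] using huv)
  have h1 : ‖u - v‖ₑ ≤ ENNReal.ofReal r := by
    rw [← ofReal_norm, Real.norm_eq_abs]
    exact ENNReal.ofReal_le_ofReal h
  calc ‖φ u - φ v‖ₑ ^ 2 = ‖u - v‖ₑ ^ 2 * (‖φ u - φ v‖ₑ ^ 2 / ‖u - v‖ₑ ^ 2) :=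
        (ENNReal.mul_div_cancel h0 (by finiteness)).symm
    _ ≤ _ := by gcongr

/-- Points of the interval are at distance at most `2y`, so `|u - v|⁻²` costs at most `(2y)²`. -/
lemma oscEnergy_le (φ : ℝ → ℝ) (x y : ℝ) :
    oscEnergy φ x y ≤ ENNReal.ofReal (2 * y) ^ 2 * douglas φ := by
  have hfin : ENNReal.ofReal (2 * y) ^ 2 ≠ ⊤ := by finiteness
  unfold oscEnergy douglas
  rw [← lintegral_const_mul' _ _ hfin]
  refine (setLIntegral_mono' measurableSet_Icc fun u hu => ?_).trans (setLIntegral_le_lintegral _ _)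
  rw [← lintegral_const_mul' _ _ hfin]
  refine (setLIntegral_mono' measurableSet_Icc fun v hv => ?_).trans (setLIntegral_le_lintegral _ _)
  exact sq_enorm_sub_le_mul_div φ (abs_le.2 ⟨by linarith [hu.1, hv.2], by linarith [hu.2, hv.1]⟩)

/-- The chord slope `m` is the mean of `φ` on the interval and the deviation is `∫ (φ - m)` from `x`
to `t`. Cauchy–Schwarz is used twice, for this integral and for `φ(u) - m` as a mean over `v`; the
powers of the length `2y` cancel. -/
lemma sq_enorm_sub_affine_le (hφ : Measurable φ) (hI : ∀ a b, IntervalIntegrable φ volume a b)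
    (hf : ∀ a b, ∫ t in a..b, φ t = f b - f a) {x y t : ℝ} (hy : 0 < y)
    (ht : t ∈ Icc (x - y) (x + y)) :
    ‖f t - f x - (f (x + y) - f (x - y)) / (2 * y) * (t - x)‖ₑ ^ 2 ≤ oscEnergy φ x y := by
  set m := (f (x + y) - f (x - y)) / (2 * y) with hm
  set c := ENNReal.ofReal (2 * y) with hc
  have hc0 : c ≠ 0 := by simpa [hc] using hy
  have hct : c ≠ ⊤ := by finiteness
  have hvol : (volume.restrict (Icc (x - y) (x + y))) univ = c := by
    rw [Measure.restrict_apply_univ, Real.volume_Icc, hc]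
    congr 1
    ring
  have hle : x - y ≤ x + y := by linarith
  have h1 : ‖f t - f x - m * (t - x)‖ₑ ≤ ∫⁻ u in Icc (x - y) (x + y), ‖φ u - m‖ₑ := by
    have e : f t - f x - m * (t - x) = ∫ u in x..t, (φ u - m) := by
      rw [intervalIntegral.integral_sub (hI _ _) intervalIntegrable_const, hf,
        intervalIntegral.integral_const, smul_eq_mul, mul_comm m]
    rw [e, ← ofReal_norm, intervalIntegral.norm_integral_eq_norm_integral_uIoc, ofReal_norm]
    refine (enorm_integral_le_lintegral_enorm _).trans (lintegral_mono_set ?_)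
    intro u hu
    rcases le_total x t with h | h
    · rw [uIoc_of_le h] at hu
      exact ⟨by linarith [hu.1], hu.2.trans ht.2⟩
    · rw [uIoc_of_ge h] at hu
      exact ⟨ht.1.trans hu.1.le, by linarith [hu.2]⟩
  have h2 : ∀ u, ‖φ u - m‖ₑ ^ 2 ≤ c⁻¹ * ∫⁻ v in Icc (x - y) (x + y), ‖φ u - φ v‖ₑ ^ 2 := by
    intro u
    have e : φ u - m = (2 * y)⁻¹ * ∫ v in (x - y)..(x + y), (φ u - φ v) := by
      rw [intervalIntegral.integral_sub intervalIntegrable_const (hI _ _), hf,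
        intervalIntegral.integral_const, smul_eq_mul, hm]
      field_simp
      ring
    have hb : ‖φ u - m‖ₑ ≤ c⁻¹ * ∫⁻ v in Icc (x - y) (x + y), ‖φ u - φ v‖ₑ := by
      rw [e, enorm_mul, intervalIntegral.integral_of_le hle, ← integral_Icc_eq_integral_Ioc]
      have : ‖(2 * y)⁻¹‖ₑ = c⁻¹ := by
        rw [← ofReal_norm, Real.norm_of_nonneg (by positivity),
          ENNReal.ofReal_inv_of_pos (by positivity)]
      rw [this]
      gcongr
      exact enorm_integral_le_lintegral_enorm _
    have hmeas : Measurable fun v => ‖φ u - φ v‖ₑ := by fun_prop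
    calc ‖φ u - m‖ₑ ^ 2 ≤ (c⁻¹ * ∫⁻ v in Icc (x - y) (x + y), ‖φ u - φ v‖ₑ) ^ 2 := by gcongr
      _ ≤ c⁻¹ ^ 2 * (c * ∫⁻ v in Icc (x - y) (x + y), ‖φ u - φ v‖ₑ ^ 2) := by
        rw [mul_pow, ← hvol]
        gcongr
        exact sq_setLIntegral_le hmeas.aemeasurable
      _ = c⁻¹ * (c⁻¹ * c) * ∫⁻ v in Icc (x - y) (x + y), ‖φ u - φ v‖ₑ ^ 2 := by ring
      _ = _ := by rw [ENNReal.inv_mul_cancel hc0 hct, mul_one]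
  have hmeas : Measurable fun u => ‖φ u - m‖ₑ := by fun_prop
  calc ‖f t - f x - m * (t - x)‖ₑ ^ 2
      ≤ (∫⁻ u in Icc (x - y) (x + y), ‖φ u - m‖ₑ) ^ 2 := by gcongr
    _ ≤ c * ∫⁻ u in Icc (x - y) (x + y), ‖φ u - m‖ₑ ^ 2 := by
        rw [← hvol]
        exact sq_setLIntegral_le hmeas.aemeasurable
    _ ≤ c * ∫⁻ u in Icc (x - y) (x + y), c⁻¹ *
          ∫⁻ v in Icc (x - y) (x + y), ‖φ u - φ v‖ₑ ^ 2 := by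
        gcongr with u
        exact h2 u
    _ = oscEnergy φ x y := by
        rw [lintegral_const_mul' _ _ (ENNReal.inv_ne_top.2 hc0), ← mul_assoc,
          ENNReal.mul_inv_cancel hc0 hct, one_mul, oscEnergy]

lemma sq_enorm_dbar_extension_le (hfc : Continuous f) (hφ : Measurable φ)
    (hI : ∀ a b, IntervalIntegrable φ volume a b) (hf : ∀ a b, ∫ t in a..b, φ t = f b - f a)
    (hD : douglas φ < ⊤) {z : ℂ} (hz : z ∈ U) :
    ‖dbar (extension f) z‖ₑ ^ 2 ≤
      ENNReal.ofReal (49 / 4) * (oscEnergy φ z.re z.im / ENNReal.ofReal z.im ^ 2) := by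
  have hy : 0 < z.im := hz
  have hE : oscEnergy φ z.re z.im ≠ ⊤ :=
    ((oscEnergy_le φ _ _).trans_lt (ENNReal.mul_lt_top (by finiteness) hD)).ne
  set E := oscEnergy φ z.re z.im with hEdef
  have h := norm_dbar_extension_le hfc hz (m := (f (z.re + z.im) - f (z.re - z.im)) / (2 * z.im))
    (S := Real.sqrt E.toReal) fun t ht => by
      apply Real.abs_le_sqrt
      have := ENNReal.toReal_mono hE (sq_enorm_sub_affine_le hφ hI hf hy ht)
      rwa [ENNReal.toReal_pow, toReal_enorm, Real.norm_eq_abs, sq_abs] at this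
  have h2 : ‖dbar (extension f) z‖ ^ 2 ≤ 49 / 4 * (E.toReal / z.im ^ 2) := by
    calc ‖dbar (extension f) z‖ ^ 2 ≤ (7 / 2 * Real.sqrt E.toReal / z.im) ^ 2 := by gcongr
      _ = _ := by
        rw [div_pow, mul_pow, Real.sq_sqrt ENNReal.toReal_nonneg]
        ring
  rw [← ofReal_norm, ← ENNReal.ofReal_pow (norm_nonneg _)]
  refine (ENNReal.ofReal_le_ofReal h2).trans ?_
  rw [ENNReal.ofReal_mul (by norm_num), ENNReal.ofReal_div_of_pos (pow_pos hy 2),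
    ENNReal.ofReal_toReal hE, ENNReal.ofReal_pow hy.le]

lemma setLIntegral_Ici_div_pow {r : ℝ} (hr : 0 < r) :
    ∫⁻ y in Ici (r / 2), ENNReal.ofReal (2 * y) / ENNReal.ofReal y ^ 4 =
      4 / ENNReal.ofReal r ^ 2 := by
  have hr2 : 0 < r / 2 := by positivity
  rw [setLIntegral_congr Ioi_ae_eq_Ici.symm]
  have e : ∫⁻ y in Ioi (r / 2), ENNReal.ofReal (2 * y) / ENNReal.ofReal y ^ 4 =
      ∫⁻ y in Ioi (r / 2), ENNReal.ofReal (2 * y ^ (-3 : ℝ)) := by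
    refine setLIntegral_congr_fun measurableSet_Ioi fun y hy => ?_
    have hy0 : 0 < y := hr2.trans hy
    rw [← ENNReal.ofReal_pow hy0.le, ← ENNReal.ofReal_div_of_pos (by positivity)]
    congr 1
    rw [Real.rpow_neg hy0.le, show (3 : ℝ) = ((3 : ℕ) : ℝ) by norm_num, Real.rpow_natCast]
    field_simp
  rw [e, ← ofReal_integral_eq_lintegral_ofReal]
  · rw [integral_const_mul, integral_Ioi_rpow_of_lt (by norm_num) hr2,
      ← ENNReal.ofReal_pow hr.le, show (4 : ℝ≥0∞) = ENNReal.ofReal 4 by norm_num,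
      ← ENNReal.ofReal_div_of_pos (by positivity)]
    congr 1
    rw [show (-3 : ℝ) + 1 = -((2 : ℕ) : ℝ) by norm_num, Real.rpow_neg hr2.le, Real.rpow_natCast]
    field_simp
    norm_num
  · exact (integrableOn_Ioi_rpow_of_lt (by norm_num) hr2).const_mul 2
  · refine (ae_restrict_iff' measurableSet_Ioi).2 (Eventually.of_forall fun y hy => ?_)
    exact mul_nonneg zero_le_two (Real.rpow_nonneg (hr2.trans hy).le _)

/-- The pairs of points lying in the real interval of radius `z.im` around `z.re`. -/
def tent : Set (ℂ × (ℝ × ℝ)) :=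
  {q | |q.2.1 - q.1.re| ≤ q.1.im ∧ |q.2.2 - q.1.re| ≤ q.1.im}

lemma measurableSet_tent : MeasurableSet tent := by
  have h1 : Measurable fun q : ℂ × (ℝ × ℝ) => q.1.re := Complex.measurable_re.comp measurable_fst
  have h2 : Measurable fun q : ℂ × (ℝ × ℝ) => q.1.im := Complex.measurable_im.comp measurable_fst
  exact (measurableSet_le ((measurable_snd.fst.sub h1).abs) h2).inter
    (measurableSet_le ((measurable_snd.snd.sub h1).abs) h2)

/-- Both points lie within `y` of `x` only if `y ≥ |u - v| / 2`, and then `x` ranges over a set of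
length at most `2y`. Integrating `2y / y⁴` from `|u - v| / 2` gives exactly `4 / |u - v|²`. -/
lemma lintegral_tent_le {u v : ℝ} (huv : u ≠ v) :
    ∫⁻ z in U, tent.indicator (fun _ => 1) (z, (u, v)) / ENNReal.ofReal z.im ^ 4 ≤
      4 / ‖u - v‖ₑ ^ 2 := by
  have hm : Measurable fun z : ℂ =>
      tent.indicator (fun _ => (1 : ℝ≥0∞)) (z, (u, v)) / ENNReal.ofReal z.im ^ 4 :=
    (((measurable_const.indicator measurableSet_tent).comp
      (measurable_id.prodMk measurable_const)).div
      (Complex.measurable_im.ennreal_ofReal.pow_const 4))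
  rw [lintegral_U_eq hm]
  have hr : 0 < |u - v| := abs_pos.2 (sub_ne_zero.2 huv)
  rw [← ofReal_norm, Real.norm_eq_abs, ← setLIntegral_Ici_div_pow hr,
    ← lintegral_indicator measurableSet_Ici]
  refine (lintegral_mono fun y => ?_).trans (setLIntegral_le_lintegral _ _)
  have hle : ∀ x : ℝ, tent.indicator (fun _ => (1 : ℝ≥0∞)) ((⟨x, y⟩ : ℂ), (u, v)) ≤
      (if |u - v| / 2 ≤ y then 1 else 0) * (Icc (u - y) (u + y)).indicator (fun _ => 1) x := by
    intro x
    by_cases hx : ((⟨x, y⟩ : ℂ), (u, v)) ∈ tent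
    · obtain ⟨h1, h2⟩ := hx
      simp only at h1 h2
      have hxm : x ∈ Icc (u - y) (u + y) := by
        rw [abs_le] at h1
        exact ⟨by linarith, by linarith⟩
      have hy : |u - v| / 2 ≤ y := by
        have := abs_sub_le u x v
        rw [abs_sub_comm x v] at this
        linarith
      rw [indicator_of_mem hxm, if_pos hy, mul_one]
      exact indicator_le_self' (fun _ _ => zero_le) _
    · rw [indicator_of_notMem hx]
      exact zero_le
  calc ∫⁻ x : ℝ, tent.indicator (fun _ => 1) ((⟨x, y⟩ : ℂ), (u, v)) / ENNReal.ofReal y ^ 4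
      ≤ ∫⁻ x : ℝ, (if |u - v| / 2 ≤ y then 1 else 0) *
          (Icc (u - y) (u + y)).indicator (fun _ => 1) x * (ENNReal.ofReal y ^ 4)⁻¹ := by
        refine lintegral_mono fun x => ?_
        rw [div_eq_mul_inv]
        gcongr
        exact hle x
    _ ≤ _ := by
        have hind : Measurable fun x => (Icc (u - y) (u + y)).indicator (fun _ => (1 : ℝ≥0∞)) x :=
          measurable_const.indicator measurableSet_Icc
        rw [lintegral_mul_const _ (hind.const_mul _), lintegral_const_mul _ hind,
          lintegral_indicator measurableSet_Icc, lintegral_const, one_mul,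
          Measure.restrict_apply_univ, Real.volume_Icc, show u + y - (u - y) = 2 * y by ring]
        by_cases hy : |u - v| / 2 ≤ y
        · rw [if_pos hy, one_mul, indicator_of_mem (show y ∈ Ici (|u - v| / 2) from hy),
            div_eq_mul_inv]
        · simp [if_neg hy]

/-- Tonelli: integrate first over the half-plane points whose interval contains both `u` and `v`.
The power `y⁻⁴` consists of `y⁻²` from the bound on `|∂/∂z̄|²` and `y⁻²` from the energy weight. -/
lemma lintegral_oscEnergy_le (hφ : Measurable φ) :
    ∫⁻ z in U, oscEnergy φ z.re z.im / ENNReal.ofReal z.im ^ 4 ≤ 4 * douglas φ := by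
  have hd : Measurable fun p : ℝ × ℝ => ‖φ p.1 - φ p.2‖ₑ ^ 2 := by fun_prop
  have hT : Measurable fun q : ℂ × (ℝ × ℝ) =>
      tent.indicator (fun _ => (1 : ℝ≥0∞)) q / ENNReal.ofReal q.1.im ^ 4 :=
    (measurable_const.indicator measurableSet_tent).div
      ((Complex.measurable_im.comp measurable_fst).ennreal_ofReal.pow_const 4)
  have hK : Measurable fun q : ℂ × (ℝ × ℝ) =>
      tent.indicator (fun _ => (1 : ℝ≥0∞)) q / ENNReal.ofReal q.1.im ^ 4 *
        ‖φ q.2.1 - φ q.2.2‖ₑ ^ 2 := hT.mul (hd.comp measurable_snd)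
  have e : ∀ z ∈ U, oscEnergy φ z.re z.im / ENNReal.ofReal z.im ^ 4 =
      ∫⁻ p : ℝ × ℝ, tent.indicator (fun _ => 1) (z, p) / ENNReal.ofReal z.im ^ 4 *
        ‖φ p.1 - φ p.2‖ₑ ^ 2 := by
    intro z hz
    have hz0 : 0 < z.im := hz
    have h4 : (ENNReal.ofReal z.im ^ 4)⁻¹ ≠ ⊤ :=
      ENNReal.inv_ne_top.2 (pow_ne_zero _ (by simpa using hz0))
    have e1 : oscEnergy φ z.re z.im = ∫⁻ p in Icc (z.re - z.im) (z.re + z.im) ×ˢ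
        Icc (z.re - z.im) (z.re + z.im), ‖φ p.1 - φ p.2‖ₑ ^ 2 := by
      rw [Measure.volume_eq_prod, ← Measure.prod_restrict,
        lintegral_prod _ hd.aemeasurable, oscEnergy]
    rw [e1, div_eq_mul_inv, ← lintegral_mul_const' _ _ h4,
      ← lintegral_indicator (measurableSet_Icc.prod measurableSet_Icc)]
    refine lintegral_congr fun p => ?_
    have hiff : p ∈ Icc (z.re - z.im) (z.re + z.im) ×ˢ Icc (z.re - z.im) (z.re + z.im) ↔
        (z, p) ∈ tent := by
      simp only [tent, mem_prod, mem_Icc, mem_ofPred_eq, abs_le]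
      constructor
      · rintro ⟨⟨h1, h2⟩, h3, h4⟩
        exact ⟨⟨by linarith, by linarith⟩, by linarith, by linarith⟩
      · rintro ⟨⟨h1, h2⟩, h3, h4⟩
        exact ⟨⟨by linarith, by linarith⟩, by linarith, by linarith⟩
    by_cases hp : (z, p) ∈ tent
    · rw [indicator_of_mem (hiff.2 hp), indicator_of_mem hp, one_div, mul_comm]
    · rw [indicator_of_notMem (fun h => hp (hiff.1 h)), indicator_of_notMem hp, ENNReal.zero_div,
        zero_mul]
  rw [setLIntegral_congr_fun measurableSet_U e, lintegral_lintegral_swap hK.aemeasurable]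
  have hdd : Measurable fun p : ℝ × ℝ => ‖φ p.1 - φ p.2‖ₑ ^ 2 / ‖p.1 - p.2‖ₑ ^ 2 :=
    hd.div (by fun_prop)
  have e2 : douglas φ = ∫⁻ p : ℝ × ℝ, ‖φ p.1 - φ p.2‖ₑ ^ 2 / ‖p.1 - p.2‖ₑ ^ 2 := by
    rw [Measure.volume_eq_prod, lintegral_prod _ hdd.aemeasurable, douglas]
  rw [e2, ← lintegral_const_mul _ hdd]
  refine lintegral_mono fun p => ?_
  obtain ⟨u, v⟩ := p
  dsimp only
  rcases eq_or_ne u v with rfl | huv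
  · simp
  · have hm : Measurable fun z : ℂ =>
        tent.indicator (fun _ => (1 : ℝ≥0∞)) (z, (u, v)) / ENNReal.ofReal z.im ^ 4 :=
      hT.comp (measurable_id.prodMk measurable_const)
    rw [lintegral_mul_const _ hm]
    calc _ ≤ 4 / ‖u - v‖ₑ ^ 2 * ‖φ u - φ v‖ₑ ^ 2 := by
          gcongr
          exact lintegral_tent_le huv
      _ = _ := by
          rw [div_eq_mul_inv, div_eq_mul_inv]
          ring

lemma lintegral_sq_enorm_dbar_extension_lt_top (hfc : Continuous f) (hφ : Measurable φ)
    (hI : ∀ a b, IntervalIntegrable φ volume a b) (hf : ∀ a b, ∫ t in a..b, φ t = f b - f a)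
    (hD : douglas φ < ⊤) :
    ∫⁻ z in U, ‖dbar (extension f) z‖ₑ ^ 2 / ENNReal.ofReal (z.im ^ 2) < ⊤ := by
  calc _ ≤ ∫⁻ z in U, ENNReal.ofReal (49 / 4) *
        (oscEnergy φ z.re z.im / ENNReal.ofReal z.im ^ 4) := by
        refine setLIntegral_mono' measurableSet_U fun z hz => ?_
        have hy : 0 < z.im := hz
        have hne : ENNReal.ofReal z.im ≠ 0 := by simpa using hy
        rw [ENNReal.ofReal_pow hy.le]
        calc _ ≤ ENNReal.ofReal (49 / 4) * (oscEnergy φ z.re z.im / ENNReal.ofReal z.im ^ 2) /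
              ENNReal.ofReal z.im ^ 2 := by
              gcongr
              exact sq_enorm_dbar_extension_le hfc hφ hI hf hD hz
          _ = _ := by
              have h4 : (ENNReal.ofReal z.im ^ 4)⁻¹ =
                  (ENNReal.ofReal z.im ^ 2)⁻¹ * (ENNReal.ofReal z.im ^ 2)⁻¹ := by
                rw [← ENNReal.mul_inv (Or.inl (pow_ne_zero _ hne)) (Or.inl (by finiteness)),
                  ← pow_add]
              simp only [div_eq_mul_inv, h4, mul_assoc]
    _ = ENNReal.ofReal (49 / 4) *
        ∫⁻ z in U, oscEnergy φ z.re z.im / ENNReal.ofReal z.im ^ 4 :=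
        lintegral_const_mul' _ _ (by finiteness)
    _ ≤ ENNReal.ofReal (49 / 4) * (4 * douglas φ) := by
        gcongr
        exact lintegral_oscEnergy_le hφ
    _ < ⊤ := ENNReal.mul_lt_top (by finiteness) (ENNReal.mul_lt_top (by finiteness) hD)

/-- The crude bound `oscEnergy_le` is of order `y²`, exactly cancelling the `y⁻²` in the estimate of
`|∂/∂z̄|²`; the constant is `49/4 · 4`. -/
lemma memLp_top_dbar_extension (hfc : Continuous f) (hφ : Measurable φ)
    (hI : ∀ a b, IntervalIntegrable φ volume a b) (hf : ∀ a b, ∫ t in a..b, φ t = f b - f a)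
    (hD : douglas φ < ⊤) : MemLp (dbar (extension f)) ⊤ (volume.restrict U) := by
  have hcont := (hasWeakDbar_of_contDiffOn (contDiffOn_extension hfc)).2
  refine memLp_top_of_bound (hcont.aestronglyMeasurable measurableSet_U)
    (Real.sqrt (49 * douglas φ).toReal)
    ((ae_restrict_iff' measurableSet_U).2 (Eventually.of_forall fun z hz => ?_))
  have hy : 0 < z.im := hz
  have hne : ENNReal.ofReal z.im ^ 2 ≠ 0 := pow_ne_zero _ (by simpa using hy)
  have h : ‖dbar (extension f) z‖ₑ ^ 2 ≤ 49 * douglas φ := by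
    calc _ ≤ ENNReal.ofReal (49 / 4) * (ENNReal.ofReal (2 * z.im) ^ 2 * douglas φ /
          ENNReal.ofReal z.im ^ 2) := by
          refine (sq_enorm_dbar_extension_le hfc hφ hI hf hD hz).trans ?_
          gcongr
          exact oscEnergy_le φ _ _
      _ = ENNReal.ofReal (49 / 4) * ENNReal.ofReal 4 * douglas φ *
          (ENNReal.ofReal z.im ^ 2 * (ENNReal.ofReal z.im ^ 2)⁻¹) := by
          rw [ENNReal.ofReal_mul zero_le_two, mul_pow, ← ENNReal.ofReal_pow zero_le_two,
            div_eq_mul_inv (_ * douglas φ), show (2 : ℝ) ^ 2 = 4 by norm_num]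
          ring
      _ = _ := by
          rw [ENNReal.mul_inv_cancel hne (by finiteness), mul_one,
            ← ENNReal.ofReal_mul (by norm_num)]
          norm_num
  have h2 := ENNReal.toReal_mono (ENNReal.mul_lt_top (by finiteness) hD).ne h
  rw [ENNReal.toReal_pow, toReal_enorm] at h2
  exact Real.le_sqrt_of_sq_le h2

end Energy

/-! ### Growth at infinity of functions in `H^{3/2}` and of their extensions -/

section Growth

variable {f φ : ℝ → ℝ}

lemma setLIntegral_sq_enorm_le (hφ : Measurable φ) (u R : ℝ) :
    ∫⁻ v in Icc (-R) R, ‖φ v‖ₑ ^ 2 ≤ 2 * (ENNReal.ofReal (R + |u|) ^ 2 *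
      (∫⁻ v : ℝ, ‖φ u - φ v‖ₑ ^ 2 / ‖u - v‖ₑ ^ 2) + ENNReal.ofReal (2 * R) * ‖φ u‖ₑ ^ 2) := by
  have hm : Measurable fun v => ‖φ u - φ v‖ₑ ^ 2 := by fun_prop
  have hfin : ENNReal.ofReal (R + |u|) ^ 2 ≠ ⊤ := by finiteness
  calc _ ≤ ∫⁻ v in Icc (-R) R, 2 * (‖φ u - φ v‖ₑ ^ 2 + ‖φ u‖ₑ ^ 2) := by
        refine lintegral_mono fun v => le_trans ?_ (sq_add_le_two_mul _ _)
        gcongr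
        calc ‖φ v‖ₑ = ‖(φ v - φ u) + φ u‖ₑ := by rw [sub_add_cancel]
          _ ≤ ‖φ v - φ u‖ₑ + ‖φ u‖ₑ := enorm_add_le _ _
          _ = _ := by rw [enorm_sub_rev]
    _ = 2 * ((∫⁻ v in Icc (-R) R, ‖φ u - φ v‖ₑ ^ 2) + ENNReal.ofReal (2 * R) * ‖φ u‖ₑ ^ 2) := by
        rw [lintegral_const_mul' _ _ (by finiteness), lintegral_add_left hm, lintegral_const,
          Measure.restrict_apply_univ, Real.volume_Icc, mul_comm (‖φ u‖ₑ ^ 2),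
          show R - -R = 2 * R by ring]
    _ ≤ _ := by
        gcongr
        rw [← lintegral_const_mul' _ _ hfin]
        refine (setLIntegral_mono' measurableSet_Icc fun v hv => ?_).trans
          (setLIntegral_le_lintegral _ _)
        refine sq_enorm_sub_le_mul_div φ ?_
        have := abs_sub u v
        have := abs_le.2 hv
        linarith

/-- Fixing one good base point `u` bounds `∫ |φ|²` over `[-R, R]` by `O(R²)`; Cauchy–Schwarz then
gives `|f t - f 0|² = O(R · R²)`. -/
lemma exists_abs_le_mul_rpow (hφ : Measurable φ) (hf : ∀ a b, ∫ t in a..b, φ t = f b - f a)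
    (hD : douglas φ < ⊤) :
    ∃ C : ℝ, ∀ R, 1 ≤ R → ∀ t, |t| ≤ R → |f t| ≤ C * R ^ (3 / 2 : ℝ) := by
  have hmk : Measurable fun u => ∫⁻ v : ℝ, ‖φ u - φ v‖ₑ ^ 2 / ‖u - v‖ₑ ^ 2 := by
    refine Measurable.lintegral_prod_right' (f := fun p : ℝ × ℝ =>
      ‖φ p.1 - φ p.2‖ₑ ^ 2 / ‖p.1 - p.2‖ₑ ^ 2) (Measurable.div (by fun_prop) (by fun_prop))
  -- Finite energy makes the inner integral finite for almost every `u`; one such point suffices.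
  obtain ⟨u, hu⟩ := (ae_lt_top hmk hD.ne).exists
  set k := ∫⁻ v : ℝ, ‖φ u - φ v‖ₑ ^ 2 / ‖u - v‖ₑ ^ 2
  set K := 4 * (ENNReal.ofReal (1 + |u|) ^ 2 * k + 2 * ‖φ u‖ₑ ^ 2) with hK
  have hKt : K ≠ ⊤ := by
    have : k ≠ ⊤ := hu.ne
    rw [hK]
    finiteness
  refine ⟨|f 0| + Real.sqrt K.toReal, fun R hR t ht => ?_⟩
  have hR0 : 0 ≤ R := by linarith
  have hm : Measurable fun v => ‖φ v‖ₑ := by fun_prop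
  have h1 : ‖f t - f 0‖ₑ ^ 2 ≤ ENNReal.ofReal (R ^ 3) * K := by
    have hsub : uIoc 0 t ⊆ Icc (-R) R := by
      intro v hv
      rw [abs_le] at ht
      rcases le_total 0 t with h | h
      · rw [uIoc_of_le h] at hv
        exact ⟨by linarith [hv.1], hv.2.trans ht.2⟩
      · rw [uIoc_of_ge h] at hv
        exact ⟨ht.1.trans hv.1.le, by linarith [hv.2]⟩
    calc ‖f t - f 0‖ₑ ^ 2 ≤ (∫⁻ v in Icc (-R) R, ‖φ v‖ₑ) ^ 2 := by
          gcongr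
          rw [← hf, ← ofReal_norm, intervalIntegral.norm_integral_eq_norm_integral_uIoc,
            ofReal_norm]
          exact (enorm_integral_le_lintegral_enorm _).trans (lintegral_mono_set hsub)
      _ ≤ ENNReal.ofReal (2 * R) * ∫⁻ v in Icc (-R) R, ‖φ v‖ₑ ^ 2 := by
          refine (sq_setLIntegral_le hm.aemeasurable).trans_eq ?_
          rw [Measure.restrict_apply_univ, Real.volume_Icc, show R - -R = 2 * R by ring]
      _ ≤ ENNReal.ofReal (2 * R) * (2 * (ENNReal.ofReal (R * (1 + |u|)) ^ 2 * k +
            ENNReal.ofReal (2 * R ^ 2) * ‖φ u‖ₑ ^ 2)) := by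
          refine mul_le_mul_right ((setLIntegral_sq_enorm_le hφ u R).trans ?_) _
          gcongr
          · nlinarith [abs_nonneg u]
          · nlinarith
      _ = _ := by
          rw [hK, ENNReal.ofReal_mul zero_le_two, ENNReal.ofReal_mul zero_le_two,
            ENNReal.ofReal_mul hR0, ENNReal.ofReal_pow hR0, ENNReal.ofReal_pow hR0,
            ENNReal.ofReal_ofNat]
          ring
  have h2 := ENNReal.toReal_mono (ENNReal.mul_lt_top (by finiteness) hKt.lt_top).ne h1
  rw [ENNReal.toReal_pow, toReal_enorm, ENNReal.toReal_mul, ENNReal.toReal_ofReal (by positivity),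
    Real.norm_eq_abs] at h2
  have hrp : (R ^ (3 / 2 : ℝ)) ^ 2 = R ^ 3 := by
    rw [← Real.rpow_natCast, ← Real.rpow_mul hR0, ← Real.rpow_natCast]
    norm_num
  have h3 : |f t - f 0| ≤ R ^ (3 / 2 : ℝ) * Real.sqrt K.toReal := by
    refine abs_le_of_sq_le_sq ?_ (by positivity)
    rw [mul_pow, hrp, Real.sq_sqrt ENNReal.toReal_nonneg, ← sq_abs]
    exact h2
  have h4 : 1 ≤ R ^ (3 / 2 : ℝ) := Real.one_le_rpow hR (by norm_num)
  have h5 : |f t| ≤ |f 0| + |f t - f 0| := by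
    have := abs_add_le (f 0) (f t - f 0)
    rwa [add_sub_cancel] at this
  nlinarith [abs_nonneg (f 0)]

/-- The value at `z` depends on `f` only within `[-2|z|, 2|z|]`, so the exponent `3/2 < 2` passes
from `f` to the extension. -/
lemma isLittleO_extension (hfc : Continuous f) (hφ : Measurable φ)
    (hf : ∀ a b, ∫ t in a..b, φ t = f b - f a) (hD : douglas φ < ⊤) :
    extension f =o[Bornology.cobounded ℂ ⊓ 𝓟 U] fun z : ℂ => z ^ 2 := by
  obtain ⟨C, hC⟩ := exists_abs_le_mul_rpow hφ hf hD
  have hO : extension f =O[Bornology.cobounded ℂ ⊓ 𝓟 U] fun z : ℂ => ‖z‖ ^ (3 / 2 : ℝ) := by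
    refine IsBigO.of_bound (3 * (C * 2 ^ (3 / 2 : ℝ))) ?_
    rw [eventually_inf_principal]
    filter_upwards [tendsto_norm_cobounded_atTop.eventually_ge_atTop 1] with z hz hzU
    have hzU' : 0 < z.im := hzU
    have h := norm_extension_sub_le hfc (U_subset_closedU hzU) (c := 0)
      (S := C * (2 * ‖z‖) ^ (3 / 2 : ℝ)) fun t ht => by
        rw [sub_zero]
        refine hC _ (by linarith) t ?_
        have h1 := abs_le.1 (Complex.abs_re_le_norm z)
        have h2 := abs_le.1 (Complex.abs_im_le_norm z)
        rw [abs_le]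
        constructor <;> linarith [ht.1, ht.2]
    rw [Complex.ofReal_zero, sub_zero, Real.mul_rpow zero_le_two (norm_nonneg _)] at h
    rw [Real.norm_of_nonneg (by positivity)]
    linarith
  refine hO.trans_isLittleO (IsLittleO.mono ?_ inf_le_left)
  have hlt : (fun x : ℝ => x ^ (3 / 2 : ℝ)) =o[atTop] fun x : ℝ => x ^ (2 : ℝ) := by
    refine isLittleO_of_tendsto' ?_ ?_
    · filter_upwards [eventually_gt_atTop (0 : ℝ)] with x hx h0
      exact absurd h0 (Real.rpow_pos_of_pos hx _).ne'
    · refine (tendsto_rpow_neg_atTop (show (0 : ℝ) < 1 / 2 by norm_num)).congr' ?_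
      filter_upwards [eventually_gt_atTop (0 : ℝ)] with x hx
      rw [← Real.rpow_sub hx]
      norm_num
  have := hlt.comp_tendsto (tendsto_norm_cobounded_atTop (E := ℂ))
  refine IsLittleO.of_norm_right (this.congr_right fun z => ?_)
  simp

end Growth

/-- A function in `H^{3/2}` has all the properties of its explicit extension. -/
theorem extension_properties {f : ℝ → ℝ} (hf : Continuous f) (h : MemHThreeHalves f) :
    MemLp (dbar (extension f)) ⊤ (volume.restrict U) ∧
      (extension f =o[Bornology.cobounded ℂ ⊓ 𝓟 U] fun z : ℂ => z ^ 2) ∧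
      ∫⁻ z in U, ‖dbar (extension f) z‖ₑ ^ 2 / ENNReal.ofReal (z.im ^ 2) < ⊤ := by
  have hφ := measurable_deriv f
  have hI : ∀ a b, IntervalIntegrable (deriv f) volume a b := fun a b =>
    (h.1 a b).intervalIntegrable_deriv
  have hF : ∀ a b, ∫ t in a..b, deriv f t = f b - f a := fun a b =>
    (h.1 a b).integral_deriv_eq_sub
  have hD : douglas (deriv f) < ⊤ := h.2.2
  exact ⟨memLp_top_dbar_extension hf hφ hI hF hD, isLittleO_extension hf hφ hF hD,
    lintegral_sq_enorm_dbar_extension_lt_top hf hφ hI hF hD⟩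

end QCDef

theorem theorem8p2 (f : ℝ → ℝ) (hf : Continuous f) :
    QCDef.MemHThreeHalves f ↔
      ∃ F : ℂ → ℂ,
        ContinuousOn F QCDef.closedU ∧
        (∀ x : ℝ, F (x : ℂ) = (f x : ℂ)) ∧
        QCDef.IsQuasiconformalDeformation QCDef.U F ∧
        (F =o[Bornology.cobounded ℂ ⊓ 𝓟 QCDef.U] fun z : ℂ => z ^ 2) ∧
        ∃ g : ℂ → ℂ, QCDef.HasWeakDbar QCDef.U F g ∧
          ∫⁻ z in QCDef.U, ‖g z‖ₑ ^ 2 / ENNReal.ofReal (z.im ^ 2) < (⊤ : ENNReal) := by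
  constructor
  · intro h
    obtain ⟨h1, h2, h3⟩ := QCDef.extension_properties hf h
    have hw := (QCDef.hasWeakDbar_of_contDiffOn (QCDef.contDiffOn_extension hf)).1
    exact ⟨QCDef.extension f, QCDef.continuousOn_extension hf, QCDef.extension_ofReal,
      ⟨_, hw, h1⟩, h2, _, hw, h3⟩
  · rintro ⟨F, hF, hFf, -, ho, g, hw, hE⟩
    exact QCDef.memHThreeHalves_of_extension hf hF hFf hw ho hE
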